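/- For $z\in\mathbb{C}$ put $q=e^{2\pi i z}$ and $q^{r}=e^{2\pi i r z}$; let $\zeta_k=e^{2\pi i/k}$, $(a;q)_n=\prod_{j=0}^{n-1}(1-aq^j)$, and let $\eta$ be the Dedekind eta function. Let $$\theta_1=\frac{\eta(z)^2}{\eta(2z)},\qquad \theta_2=\frac{\eta(z)^2}{\eta(z/2)},\qquad \theta_3=\frac{\eta(z)^2}{\eta(\frac z2+\frac12)}\qquad(\operatorname{Im}z>0),$$ $$\theta_{1,n}=\frac{(q;q)_n}{(-q;q)_n},\qquad \theta_{2,n}=q^{1/16}\frac{(q;q)_n}{(q^{1/2};q)_{n+1}},\qquad \theta_{3,n}=\frac{\zeta_{16}}{\zeta_{12}}\,q^{1/16}\frac{(q;q)_n}{(-q^{1/2};q)_{n+1}},$$ $\theta_i^S=\sum_{n\ge 0}\theta_{i,n}$, and let $\phi_i(x)=\theta_i^S(e^{2\pi i x})$ for $x$ in the set $D_i\subset\mathbb{Q}$ of rationals (with $z=x$) at which no denominator vanishes and the series converges. For $x=a/b$ in lowest terms, $x\in D_1$ iff $b$ is odd, $x\in D_2$ iff $a$ is odd, and $x\in D_3$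 iff $ab$ is even. The following hold. (1) The series $$G_1=2\sum_{n\ge0}\frac{q^{2n+1}(q;q)_{2n}}{(1+q^{2n+1})(-q;q)_{2n}},\qquad G_2=-q^{7/16}\sum_{n\ge0}\frac{q^{n/2}(q;q)_n}{(q^{1/2};q)_{n+1}},\qquad G_3=\frac{\zeta_{16}}{\zeta_{12}}\,q^{7/16}\sum_{n\ge0}\frac{(-1)^nq^{n/2}(q;q)_n}{(-q^{1/2};q)_{n+1}}$$ are well defined and converge for $|q|<1$ (that is, $\operatorname{Im}z>0$). For every $x\in\mathbb{Q}$ with $-x\in D_i$, the series $G_i$ is also well defined and convergent at $z=x$, and $\theta_i^S(q^{-1})=G_i(q)$ there; that is, $\phi_i(-x)$ equals the value of $G_i$ at $z=x$. (2) The vector $\phi=(\phi_1,\phi_2,\phi_3)^T$ is a vector-valued quantum modular form of weight $3/2$ for $\mathrm{SL}_2(\mathbb{Z})$. That is, for every $\gamma=\begin{pmatrix}a&b\\c&d\end{pmatrix}\in \mathrm{SL}_2(\mathbb{Z})$ there are an invertible complex $3\times3$ matrix $\rho$ and functions $h_i:\mathbb{R}\to\mathbb{C}$, smooth off a finite set,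 such that for all $x\in\mathbb{Q}$ with $cx+d\ne0$ and all $i$: $\gamma x\in D_i$ if and only if $x\in D_j$ for all $j$ with $\rho_{ij}\neq0$, and in that case $$J_\gamma(x)\,\phi_i(\gamma x)-\sum_j\rho_{ij}\phi_j(x)=h_i(x),$$ where $J_\gamma(x)=\bigl(i\,\mathrm{sgn}(c)(cx+d)\bigr)^{-3/2}$ if $c\ne0$ and $J_\gamma(x)=1$ if $c=0$. Here and below all powers are principal, and a sum over $j$ omits the terms with coefficient $0$. In particular, with $$M_T=\begin{pmatrix}1&0&0\\0&0&\zeta_{12}\\0&\zeta_{24}&0\end{pmatrix},\qquad M_S=\begin{pmatrix}0&\sqrt2&0\\1/\sqrt2&0&0\\0&0&1\end{pmatrix},\qquad g_i(x)=\frac{i}{\pi(1+i)}\int_0^{i\infty}\frac{\theta_i(z)}{(z-x)^{3/2}}\,dz$$ (the integral being taken along the imaginary axis), each component of $$\phi(x+1)-M_T\,\phi(x)=0\quad(x\in\mathbb{Q}),\qquad \Bigl(\frac{x}{-i}\Bigr)^{-3/2}\phi(-1/x)+M_S\,\phi(x)=M_S\,g(x)\quad(x\in\mathbb{Q}\setminus\{0\})$$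 holds wherever its left side is defined. In the $i$-th component, $\phi_i(x+1)$ (respectively $\phi_i(-1/x)$) is defined if and only if $\phi_j(x)$ is defined for all $j$ with $(M_T)_{ij}\ne0$ (respectively $(M_S)_{ij}\neq0$). The integrals $g_1(x)$, $g_3(x)$ converge absolutely for all $x\in\mathbb{R}$ and $g_2(x)$ for all $x\in\mathbb{R}\setminus\{0\}$. The functions $g_1$ and $g_3$ are $C^\infty$ on $\mathbb{R}$; $g_2$ is $C^\infty$ on $\mathbb{R}\setminus\{0\}$, and $g_2(x)+\frac{i}{\pi x}$ extends to a $C^\infty$ function on $\mathbb{R}$. -/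

import Mathlib

open Complex
open scoped ContDiff MatrixGroups

noncomputable section

namespace StrangeTheta

/-- `q ^ r`, where `q = exp (2 π i z)`. All powers of `q` are taken with respect to `z`. -/
def qpow (r z : ℂ) : ℂ := cexp (2 * Real.pi * I * r * z)

/-- `ζ_k = exp (2 π i / k)`. -/
def zeta (k : ℕ) : ℂ := cexp (2 * Real.pi * I / k)

/-- The `q`-Pochhammer symbol `(a; q)_n = ∏_{0 ≤ j < n} (1 - a q ^ j)`. -/
def qPoch (a q : ℂ) (n : ℕ) : ℂ := ∏ j ∈ Finset.range n, (1 - a * q ^ j)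

/-- The vector `(θ₁, θ₂, θ₃)` of eta-quotients on the upper half plane (indices `0, 1, 2`). -/
def theta (z : ℂ) : Fin 3 → ℂ :=
  ![ModularForm.eta z ^ 2 / ModularForm.eta (2 * z),
    ModularForm.eta z ^ 2 / ModularForm.eta (z / 2),
    ModularForm.eta z ^ 2 / ModularForm.eta (z / 2 + 1 / 2)]

/-- The numerators of the finite products `θ_{i,n}`. -/
def truncNum (n : ℕ) (z : ℂ) : Fin 3 → ℂ :=
  ![qPoch (qpow 1 z) (qpow 1 z) n,
    qpow (1 / 16) z * qPoch (qpow 1 z) (qpow 1 z) n,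
    zeta 16 / zeta 12 * qpow (1 / 16) z * qPoch (qpow 1 z) (qpow 1 z) n]

/-- The denominators of the finite products `θ_{i,n}`. -/
def truncDen (n : ℕ) (z : ℂ) : Fin 3 → ℂ :=
  ![qPoch (-qpow 1 z) (qpow 1 z) n,
    qPoch (qpow (1 / 2) z) (qpow 1 z) (n + 1),
    qPoch (-qpow (1 / 2) z) (qpow 1 z) (n + 1)]

/-- The finite product `θ_{i,n}`. -/
def thetaTrunc (n : ℕ) (z : ℂ) (i : Fin 3) : ℂ := truncNum n z i / truncDen n z i

/-- The set of rational `x` at which the strange series `θ_i^S = ∑ θ_{i,n}` converges: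
every term is well defined (no vanishing denominator) and the series of terms converges. -/
def strangeDomain (i : Fin 3) : Set ℚ :=
  {x | (∀ n, truncDen n (x : ℂ) i ≠ 0) ∧ Summable fun n => thetaTrunc n (x : ℂ) i}

/-- The strange series `θ_i^S`, as a function of `z` with `q = exp (2 π i z)`. -/
def thetaS (z : ℂ) (i : Fin 3) : ℂ := ∑' n, thetaTrunc n z i

/-- The vector `φ(x) = (θ_i^S(exp (2 π i x)))_i`; the `i`-th component is meaningful only for
`x ∈ strangeDomain i`. -/
def phi (x : ℚ) (i : Fin 3) : ℂ := thetaS (x : ℂ) i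

/-- The numerators of the terms of the reflected series `G_i`. -/
def reflNum (n : ℕ) (z : ℂ) : Fin 3 → ℂ :=
  ![2 * qpow 1 z ^ (2 * n + 1) * qPoch (qpow 1 z) (qpow 1 z) (2 * n),
    -(qpow (7 / 16) z * qpow (1 / 2) z ^ n * qPoch (qpow 1 z) (qpow 1 z) n),
    zeta 16 / zeta 12 * qpow (7 / 16) z * (-qpow (1 / 2) z) ^ n *
      qPoch (qpow 1 z) (qpow 1 z) n]

/-- The denominators of the terms of the reflected series `G_i`. -/
def reflDen (n : ℕ) (z : ℂ) : Fin 3 → ℂ :=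
  ![(1 + qpow 1 z ^ (2 * n + 1)) * qPoch (-qpow 1 z) (qpow 1 z) (2 * n),
    qPoch (qpow (1 / 2) z) (qpow 1 z) (n + 1),
    qPoch (-qpow (1 / 2) z) (qpow 1 z) (n + 1)]

/-- The series `G_i` is well defined and converges at `q = exp (2 π i z)`. -/
def ReflConverges (i : Fin 3) (z : ℂ) : Prop :=
  (∀ n, reflDen n z i ≠ 0) ∧ Summable fun n => reflNum n z i / reflDen n z i

/-- The `q`-series `G_i`, as a function of `z` with `q = exp (2 π i z)`. -/
def G (z : ℂ) (i : Fin 3) : ℂ := ∑' n, reflNum n z i / reflDen n z i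

/-- The integrand of `∫_0^{i∞} θ_i(z) (z - x)^{-3/2} dz` along `z = i t`, `t > 0`
(principal branch; `i t - x` lies in the upper half plane). -/
def periodIntegrand (i : Fin 3) (x t : ℝ) : ℂ :=
  theta (I * t) i / (I * t - x) ^ (3 / 2 : ℂ) * I

/-- The vector of period integrals
`g_i(x) = i / (π (1 + i)) * ∫_0^{i∞} θ_i(z) (z - x)^{-3/2} dz`. -/
def g (x : ℝ) (i : Fin 3) : ℂ :=
  I / (Real.pi * (1 + I)) * ∫ t in Set.Ioi (0 : ℝ), periodIntegrand i x t

/-- The matrix of `x ↦ x + 1`. -/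
def MT : Matrix (Fin 3) (Fin 3) ℂ :=
  !![1, 0, 0; 0, 0, zeta 12; 0, zeta 24, 0]

/-- The matrix of `x ↦ -1 / x`. -/
def MS : Matrix (Fin 3) (Fin 3) ℂ :=
  !![0, (Real.sqrt 2 : ℂ), 0; 1 / (Real.sqrt 2 : ℂ), 0, 0; 0, 0, 1]

/-- The automorphy factor of weight `k` at a real point `x`. For `c ≠ 0` it is
`(i sgn(c) (c x + d)) ^ (-k)` (principal branch), a constant multiple of the boundary value of a
holomorphic branch of `(c z + d) ^ (-k)` on the lower half plane; for `c = 0` it is `1`. -/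
def autFactor (k : ℂ) (γ : SL(2, ℤ)) (x : ℚ) : ℂ :=
  if γ 1 0 = 0 then 1
  else (I * ((γ 1 0).sign : ℂ) * ((γ 1 0 : ℂ) * (x : ℂ) + (γ 1 1 : ℂ))) ^ (-k)

/-- A vector `φ` of functions whose `i`-th component lives on `D i ⊆ ℚ` is a vector-valued quantum
modular form of weight `k` for `SL₂(ℤ)`: for every `γ` there are an invertible matrix `ρ` and
error functions `h i`, smooth on `ℝ` off a finite set, such that the `i`-th component of
`φ |_k γ - ρ φ = h` holds at every rational `x` with `γ x ≠ ∞` at which it makes sense. The left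
side `φ i (γ x)` makes sense exactly where all `φ j x` that occur with nonzero coefficient do. -/
def IsVectorQuantumModularForm {m : ℕ} (k : ℂ) (D : Fin m → Set ℚ) (φ : ℚ → Fin m → ℂ) : Prop :=
  ∀ γ : SL(2, ℤ), ∃ (ρ : Matrix (Fin m) (Fin m) ℂ) (h : Fin m → ℝ → ℂ) (s : Finset ℝ),
    IsUnit ρ.det ∧ (∀ i, ContDiffOn ℝ ∞ (h i) (s : Set ℝ)ᶜ) ∧
    ∀ x : ℚ, (γ 1 0 : ℚ) * x + (γ 1 1 : ℚ) ≠ 0 → ∀ i : Fin m,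
      let y : ℚ := ((γ 0 0 : ℚ) * x + (γ 0 1 : ℚ)) / ((γ 1 0 : ℚ) * x + (γ 1 1 : ℚ))
      (y ∈ D i ↔ ∀ j, ρ i j ≠ 0 → x ∈ D j) ∧
      (y ∈ D i → autFactor k γ x * φ y i - (ρ.mulVec (φ x)) i = h i (x : ℝ))

end StrangeTheta

end

noncomputable section

namespace StrangeTheta

open Filter Topology MeasureTheory

/-! ### Finite `q`-Pochhammer symbols -/

/-! Components are indexed `0, 1, 2`. The terms `θ_{i,n}` are, up to a factor independent of `n`,
the coefficients `(aq;q)_n / (apq;q)_n` at `a = 1`, with `p = -1`, `q^{1/2}`, `-q^{1/2}`. For such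
coefficients `(1 - a) ∑ (aq;q)_n / (apq;q)_n a^n` satisfies a functional equation under `a ↦ aq`
(Rogers–Fine). For `p = -1`, and for `q = p²` after division by `1 - ap`, its solution is a partial
theta series (`fineFun_neg_one`, `fineFun_sq`). The same two identities are used in two regimes.

For `|q| < 1` and `a = 1` they become Gauss's product formulas, so each eta quotient is a theta
series (`theta_eq_tsum`). For `q` a root of unity and `0 < a < 1`, the limit `a → 1⁻` shows that
`φ_i(x)` is the regularized value of the same theta series at the boundary point `x`
(`tendsto_phi`). The subordination formula, `∫ t^{-3/2} exp(-a²/t - b²t) dt = (√π/a) exp(-2ab)`,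
turns this limit into `φ_i(x) = (√2 π)⁻¹ ∫_0^∞ t^{-3/2} θ_i(x + it) dt` (`phi_eq_integral`). The
integral converges because the parity condition defining `D_i` says exactly that the modular group
carries the pair `(i, x)` to a component that decays exponentially at `i∞`; hence `θ_i` vanishes to
infinite order at `x` (`exists_theta_decay`).

Thus `φ_j(x)` is, up to a constant, the integral of `θ_j(z) (z - x)^{-3/2} dz` from `x` to `i∞`. By
modularity of `θ`, `φ_i(-1/x)` is the integral of the same form along the semicircle from `x` to
`0`, and `g_j(x)` is its integral from `0` to `i∞`. Cauchy's theorem on the ideal triangle with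
vertices `x`, `0`, `i∞` gives the law under `x ↦ -1/x` (`phi_neg_inv`); the law under `x ↦ x + 1` is
termwise. Differentiation under the integral sign gives smoothness of `g`, where the only
singularity comes from `θ_1(it) ~ (2t)^{-1/2}` at `t = 0` and can be integrated in closed form.

Both generators act by monomial matrices whose permutations also permute the parity conditions.
Induction over words in `S` and `T`, with the cocycle relation for the automorphy factor, extends
the law to all of `SL₂(ℤ)` (`hasCocycle`). The reflected series arise from inverting `q` factor by
factor in the Pochhammer quotients. -/

@[simp] lemma qPoch_zero (a q : ℂ) : qPoch a q 0 = 1 := by simp [qPoch]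

lemma qPoch_succ (a q : ℂ) (n : ℕ) : qPoch a q (n + 1) = qPoch a q n * (1 - a * q ^ n) := by
  simp [qPoch, Finset.prod_range_succ]

lemma qPoch_succ' (a q : ℂ) (n : ℕ) : qPoch a q (n + 1) = (1 - a) * qPoch (a * q) q n := by
  simp only [qPoch, Finset.prod_range_succ', pow_zero, mul_one]
  rw [mul_comm]
  congr 1
  exact Finset.prod_congr rfl fun j _ => by ring

lemma qPoch_ne_zero_iff (a q : ℂ) (n : ℕ) : qPoch a q n ≠ 0 ↔ ∀ j < n, 1 - a * q ^ j ≠ 0 := by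
  simp [qPoch, Finset.prod_ne_zero_iff]

lemma qPoch_add (a q : ℂ) (m n : ℕ) :
    qPoch a q (m + n) = qPoch a q m * qPoch (a * q ^ m) q n := by
  simp only [qPoch, Finset.prod_range_add]
  congr 1
  exact Finset.prod_congr rfl fun j _ => by ring

/-- The powers `q ^ j`, `j < b`, run once through the `b`-th roots of unity, so this is the
factorization of `1 ^ b - a ^ b`. -/
lemma qPoch_primitive {q : ℂ} {b : ℕ} (hq : IsPrimitiveRoot q b) (hb : 0 < b) (a : ℂ) :
    qPoch a q b = 1 - a ^ b := by
  have : NeZero b := ⟨hb.ne'⟩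
  have h := hq.pow_sub_pow_eq_prod_sub_mul 1 a hb
  rw [one_pow] at h
  rw [h, qPoch]
  symm
  -- Reindexing by the discrete logarithm to base `q`; the default value `0` is never taken on roots
  -- of unity.
  refine Finset.prod_bij' (i := fun ζ hζ => if h : ∃ i, i < b ∧ q ^ i = ζ then h.choose else 0)
    (j := fun i _ => q ^ i) ?_ ?_ ?_ ?_ ?_
  · intro ζ hζ
    obtain ⟨i, hi⟩ := hq.eq_pow_of_pow_eq_one ((Polynomial.mem_nthRootsFinset hb _).1 hζ)
    have : ∃ i, i < b ∧ q ^ i = ζ := ⟨i, hi⟩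
    simp only [this, dif_pos, Finset.mem_range]
    exact this.choose_spec.1
  · intro i _
    rw [Polynomial.mem_nthRootsFinset hb, ← pow_mul, mul_comm, pow_mul, hq.pow_eq_one, one_pow]
  · intro ζ hζ
    obtain ⟨i, hi⟩ := hq.eq_pow_of_pow_eq_one ((Polynomial.mem_nthRootsFinset hb _).1 hζ)
    have : ∃ i, i < b ∧ q ^ i = ζ := ⟨i, hi⟩
    simp only [this, dif_pos]
    exact this.choose_spec.2
  · intro i hi
    have : ∃ i', i' < b ∧ q ^ i' = q ^ i := ⟨i, Finset.mem_range.1 hi, rfl⟩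
    simp only [this, dif_pos]
    exact hq.pow_inj this.choose_spec.1 (Finset.mem_range.1 hi) this.choose_spec.2
  · intro ζ hζ
    obtain ⟨i, hi⟩ := hq.eq_pow_of_pow_eq_one ((Polynomial.mem_nthRootsFinset hb _).1 hζ)
    have : ∃ i, i < b ∧ q ^ i = ζ := ⟨i, hi⟩
    simp only [this, dif_pos, this.choose_spec.2, mul_comm]

/-! ### A specialization of the Rogers–Fine identity -/

/-- The coefficients `(a q; q)_n / (a p q; q)_n` of a Rogers–Fine series. -/
def fineCoeff (p q a : ℂ) (n : ℕ) : ℂ := qPoch (a * q) q n / qPoch (a * p * q) q n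

@[simp] lemma fineCoeff_zero (p q a : ℂ) : fineCoeff p q a 0 = 1 := by simp [fineCoeff]

lemma fineCoeff_succ {p q a : ℂ} (h : ∀ n : ℕ, 1 - a * p * q ^ (n + 1) ≠ 0) (n : ℕ) :
    fineCoeff p q a (n + 1) * (1 - a * p * q ^ (n + 1)) =
      fineCoeff p q a n * (1 - a * q ^ (n + 1)) := by
  have h1 : 1 - a * p * q * q ^ n ≠ 0 := by simpa [pow_succ', mul_assoc] using h n
  have h2 : qPoch (a * p * q) q n ≠ 0 := by
    rw [qPoch_ne_zero_iff]
    intro j _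
    simpa [pow_succ', mul_assoc] using h j
  rw [fineCoeff, fineCoeff, qPoch_succ, qPoch_succ,
    show 1 - a * p * q ^ (n + 1) = 1 - a * p * q * q ^ n by ring,
    show 1 - a * q ^ (n + 1) = 1 - a * q * q ^ n by ring]
  generalize qPoch (a * p * q) q n = x at *
  generalize 1 - a * p * q * q ^ n = y at *
  field_simp

/-- Replacing `a` by `a q` drops the first factor of numerator and denominator. This links the
series at `a q` with the one at `a`. -/
lemma fineCoeff_mul_shift {p q a : ℂ} (h : ∀ n : ℕ, 1 - a * p * q ^ (n + 1) ≠ 0) (n : ℕ) :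
    (1 - a * q) * fineCoeff p q (a * q) n = (1 - a * p * q) * fineCoeff p q a (n + 1) := by
  have h1 : 1 - a * p * q ≠ 0 := by simpa using h 0
  rw [fineCoeff, fineCoeff, qPoch_succ' (a * q), qPoch_succ' (a * p * q)]
  rw [show a * q * p * q = a * p * q * q by ring]
  generalize 1 - a * p * q = y at *
  rw [mul_div_assoc', mul_div_assoc', mul_div_mul_left _ _ h1]

/-- `∑ (a q; q)_n / (a p q; q)_n (a q)^n`. -/
def fineSum (p q a : ℂ) : ℂ := ∑' n, fineCoeff p q a n * (a * q) ^ n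

/-- `(1 - a) ∑ (a q; q)_n / (a p q; q)_n a^n`, written through `fineSum` so that it makes sense
on the boundary `|a| = 1` as well when `|q| < 1`. -/
def fineFun (p q a : ℂ) : ℂ := 1 - a * p + (a * p - a ^ 2 * q) * fineSum p q a

/-- Multiply the two-term recurrence `fineCoeff_succ` by `a ^ (n + 1)` and sum over `n`: with `U = ∑
c_n a^n` and `V = ∑ c_n (aq)^n` this reads `(U - 1) - ap (V - 1) = a U - a² q V`. -/
lemma one_sub_mul_tsum_fineCoeff {p q a : ℂ} (h : ∀ n : ℕ, 1 - a * p * q ^ (n + 1) ≠ 0)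
    (hU : Summable fun n => fineCoeff p q a n * a ^ n)
    (hV : Summable fun n => fineCoeff p q a n * (a * q) ^ n) :
    (1 - a) * ∑' n, fineCoeff p q a n * a ^ n = fineFun p q a := by
  have hU1 := (summable_nat_add_iff 1).2 hU
  have hV1 := (summable_nat_add_iff 1).2 hV
  have key : (∑' n, fineCoeff p q a (n + 1) * a ^ (n + 1)) -
      a * p * ∑' n, fineCoeff p q a (n + 1) * (a * q) ^ (n + 1) =
      a * (∑' n, fineCoeff p q a n * a ^ n) -
        a ^ 2 * q * ∑' n, fineCoeff p q a n * (a * q) ^ n := by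
    rw [← tsum_mul_left, ← tsum_mul_left, ← tsum_mul_left, ← hU1.tsum_sub (hV1.mul_left _),
      ← (hU.mul_left _).tsum_sub (hV.mul_left _)]
    refine tsum_congr fun n => ?_
    have := fineCoeff_succ h n
    simp only [mul_pow]
    linear_combination a ^ (n + 1) * this
  have e1 := hU.tsum_eq_zero_add
  have e2 := hV.tsum_eq_zero_add
  simp only [fineCoeff_zero, pow_zero, one_mul] at e1 e2
  rw [fineFun, fineSum]
  rw [e1, e2] at key ⊢
  linear_combination key

/-- Dropping the term `n = 0` of `fineSum` and applying the shift relation to the rest produces the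
series whose value is `fineFun p q (a * q)`; this closes the recursion in `a`. -/
lemma fineSum_sub_one {p q a : ℂ} (h : ∀ n : ℕ, 1 - a * p * q ^ (n + 1) ≠ 0)
    (hV : Summable fun n => fineCoeff p q a n * (a * q) ^ n) :
    a * q * ((1 - a * q) * ∑' n, fineCoeff p q (a * q) n * (a * q) ^ n) =
      (1 - a * p * q) * (fineSum p q a - 1) := by
  have e2 := hV.tsum_eq_zero_add
  simp only [fineCoeff_zero, pow_zero, one_mul] at e2
  rw [fineSum, e2, add_sub_cancel_left, ← tsum_mul_left, ← tsum_mul_left, ← tsum_mul_left]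
  refine tsum_congr fun n => ?_
  linear_combination (a * q) ^ (n + 1) * fineCoeff_mul_shift h n

/-- The functional equation relating `fineFun` at `a` and `a q`. -/
lemma fineFun_functional {p q a : ℂ} (h : ∀ n : ℕ, 1 - a * p * q ^ (n + 1) ≠ 0)
    (hV : Summable fun n => fineCoeff p q a n * (a * q) ^ n)
    (hU' : Summable fun n => fineCoeff p q (a * q) n * (a * q) ^ n)
    (hV' : Summable fun n => fineCoeff p q (a * q) n * (a * q * q) ^ n) :
    fineFun p q a =
      1 - a ^ 2 * q + (p - a * q) / (1 - a * p * q) * (a ^ 2 * q) * fineFun p q (a * q) := by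
  have h1 : 1 - a * p * q ≠ 0 := by simpa using h 0
  have h' : ∀ n : ℕ, 1 - a * q * p * q ^ (n + 1) ≠ 0 := fun n => by
    have := h (n + 1)
    rwa [show a * p * q ^ (n + 1 + 1) = a * q * p * q ^ (n + 1) by ring] at this
  rw [← one_sub_mul_tsum_fineCoeff h' hU' hV']
  have := fineSum_sub_one h hV
  rw [fineFun, show (p - a * q) / (1 - a * p * q) * (a ^ 2 * q) *
    ((1 - a * q) * ∑' n, fineCoeff p q (a * q) n * (a * q) ^ n) = (p - a * q) / (1 - a * p * q) *
    a * (a * q * ((1 - a * q) * ∑' n, fineCoeff p q (a * q) n * (a * q) ^ n)) by ring, this]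
  field_simp
  ring

/-- Iteration gives `‖g 0‖ ≤ ρ ^ k * C` for every `k`. This is the uniqueness principle for the
functional equations: it needs only boundedness along the orbit `a q ^ k`, so it also applies when
`|q| = 1` and the orbit does not tend to `0`. -/
lemma eq_zero_of_norm_le_mul_succ {g : ℕ → ℂ} {ρ C : ℝ} (h0 : 0 ≤ ρ) (h1 : ρ < 1)
    (hg : ∀ k, ‖g k‖ ≤ ρ * ‖g (k + 1)‖) (hC : ∀ k, ‖g k‖ ≤ C) : g 0 = 0 := by
  have h : ∀ k, ‖g 0‖ ≤ ρ ^ k * ‖g k‖ := by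
    intro k
    induction k with
    | zero => simp
    | succ k ih =>
      calc ‖g 0‖ ≤ ρ ^ k * ‖g k‖ := ih
        _ ≤ ρ ^ k * (ρ * ‖g (k + 1)‖) := by gcongr; exact hg k
        _ = _ := by ring
  have h2 : ∀ k, ‖g 0‖ ≤ ρ ^ k * C := fun k => (h k).trans (by gcongr; exact hC k)
  have h3 : Tendsto (fun k => ρ ^ k * C) atTop (𝓝 (0 * C)) :=
    (tendsto_pow_atTop_nhds_zero_of_lt_one h0 h1).mul_const C
  rw [zero_mul] at h3
  exact norm_le_zero_iff.1 (ge_of_tendsto' h3 h2)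

/-- The data needed to iterate the functional equation of `fineFun` along `a, a q, a q², …`. -/
structure FineAdmissible (p q a : ℂ) : Prop where
  norm_a : ‖a‖ ≤ 1
  norm_q : ‖q‖ ≤ 1
  lt_one : ‖a ^ 2 * q‖ < 1
  ne : ∀ n : ℕ, 1 - a * p * q ^ (n + 1) ≠ 0
  summable : ∀ k : ℕ, Summable fun n => fineCoeff p q (a * q ^ k) n * (a * q ^ (k + 1)) ^ n
  bdd : ∃ C : ℝ, ∀ k : ℕ, ‖fineFun p q (a * q ^ k)‖ ≤ C

namespace FineAdmissible
variable {p q a : ℂ}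

lemma norm_orbit_sq (H : FineAdmissible p q a) (k : ℕ) :
    ‖(a * q ^ k) ^ 2 * q‖ ≤ ‖a ^ 2 * q‖ := by
  rw [show (a * q ^ k) ^ 2 * q = (a ^ 2 * q) * (q ^ k) ^ 2 by ring, norm_mul]
  refine mul_le_of_le_one_right (norm_nonneg _) ?_
  rw [norm_pow, norm_pow]
  exact pow_le_one₀ (by positivity) (pow_le_one₀ (norm_nonneg _) H.norm_q)

lemma functional (H : FineAdmissible p q a) (k : ℕ) :
    fineFun p q (a * q ^ k) = 1 - (a * q ^ k) ^ 2 * q +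
      (p - a * q ^ k * q) / (1 - a * q ^ k * p * q) * ((a * q ^ k) ^ 2 * q) *
        fineFun p q (a * q ^ (k + 1)) := by
  have hne : ∀ n : ℕ, 1 - a * q ^ k * p * q ^ (n + 1) ≠ 0 := fun n => by
    have := H.ne (k + n)
    rwa [show a * p * q ^ (k + n + 1) = a * q ^ k * p * q ^ (n + 1) by ring] at this
  have e : a * q ^ k * q = a * q ^ (k + 1) := by ring
  have hV := H.summable k
  rw [fineFun_functional hne (by simpa [e] using hV) ?_ ?_, e]
  · have h1 : 1 - a * q ^ k * p * q ≠ 0 := by simpa using hne 0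
    rw [e]
    -- This case is impossible since `‖a q ^ (k + 1)‖ < 1`: either `‖q‖ < 1`, or `‖q‖ = 1` and
    -- `lt_one` forces `‖a‖ < 1`.
    by_cases h0 : 1 - a * q ^ (k + 1) = 0
    · exfalso
      have hn1 : ‖a * q ^ (k + 1)‖ = 1 := by
        rw [← sub_eq_zero.1 h0, norm_one]
      have hlt : ‖a * q ^ (k + 1)‖ < 1 := by
        have h2 := H.lt_one
        rw [norm_mul, norm_pow] at h2 ⊢
        rcases lt_or_eq_of_le H.norm_q with hq | hq
        · exact mul_lt_one_of_nonneg_of_lt_one_right H.norm_a (by positivity)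
            (pow_lt_one₀ (norm_nonneg _) hq (by omega))
        · rw [hq] at h2 ⊢
          simp only [one_pow, mul_one] at h2 ⊢
          nlinarith [norm_nonneg a]
      linarith
    · have h2 := ((summable_nat_add_iff 1).2 hV).mul_left
        ((1 - a * q ^ k * p * q) / (1 - a * q ^ (k + 1)))
      -- By the shift relation, the series at `w = a q ^ (k + 1)` with powers of `w` is a constant
      -- multiple of the tail of a known one, after division by `w`; for `w = 0` only the term `n =
      -- 0` survives.
      by_cases hz : a * q ^ (k + 1) = 0
      · refine summable_of_ne_finset_zero (s := {0}) fun n hn => ?_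
        rw [hz, zero_pow (by simpa using hn), mul_zero]
      · refine (h2.mul_left (a * q ^ (k + 1))⁻¹).congr fun n => ?_
        have := fineCoeff_mul_shift hne n
        rw [e] at this
        generalize 1 - a * q ^ k * p * q = y at *
        generalize a * q ^ (k + 1) = w at *
        rw [pow_succ]
        field_simp
        linear_combination -this
  · have := H.summable (k + 1)
    rw [e]
    exact this.congr fun n => by ring

/-- The Rogers–Fine series with `p = -1` is a partial theta series. -/
theorem fineFun_neg_one (H : FineAdmissible (-1) q a) :
    fineFun (-1) q a =
      ∑' n : ℕ, (if n = 0 then 1 else 2 * (-1) ^ n) * (a ^ (2 * n) * q ^ (n ^ 2)) := by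
  set R : ℂ → ℂ := fun a => ∑' n : ℕ, (if n = 0 then 1 else 2 * (-1) ^ n) *
    (a ^ (2 * n) * q ^ (n ^ 2)) with hR
  have hb : ∀ (k n : ℕ), ‖(if n = 0 then (1 : ℂ) else 2 * (-1) ^ n) *
      ((a * q ^ k) ^ (2 * n) * q ^ (n ^ 2))‖ ≤ 2 * ‖a ^ 2 * q‖ ^ n := by
    intro k n
    rw [norm_mul]
    gcongr
    · split_ifs <;> simp
    · obtain ⟨m, hm⟩ : ∃ m, n ^ 2 = n + m := ⟨n ^ 2 - n, by have : n ≤ n ^ 2 := by nlinarith [sq_nonneg n, Nat.le_mul_self n]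
                                                            omega⟩
      rw [hm, pow_add, ← mul_assoc, pow_mul, ← mul_pow, norm_mul, norm_pow, norm_pow]
      calc _ ≤ ‖a ^ 2 * q‖ ^ n * 1 := by
            gcongr
            · exact H.norm_orbit_sq k
            · exact pow_le_one₀ (norm_nonneg _) H.norm_q
        _ = _ := mul_one _
  have hgs : Summable fun n : ℕ => 2 * ‖a ^ 2 * q‖ ^ n :=
    (summable_geometric_of_lt_one (norm_nonneg _) H.lt_one).mul_left 2
  have hs : ∀ k, Summable fun n : ℕ => (if n = 0 then (1 : ℂ) else 2 * (-1) ^ n) *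
      ((a * q ^ k) ^ (2 * n) * q ^ (n ^ 2)) := fun k => .of_norm_bounded hgs (hb k)
  have hRb : ∀ k, ‖R (a * q ^ k)‖ ≤ ∑' n : ℕ, 2 * ‖a ^ 2 * q‖ ^ n := fun k =>
    tsum_of_norm_bounded hgs.hasSum (hb k)
  have hRf : ∀ k, R (a * q ^ k) = 1 - (a * q ^ k) ^ 2 * q -
      (a * q ^ k) ^ 2 * q * R (a * q ^ (k + 1)) := by
    intro k
    have h1 := (hs k).tsum_eq_zero_add
    have h2 := ((summable_nat_add_iff 1).2 (hs k)).tsum_eq_zero_add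
    have h3 := (hs (k + 1)).tsum_eq_zero_add
    simp only [hR]
    -- The coefficient jumps from `1` to `∓2` after `n = 0`, so two terms are split off on the left
    -- but only one on the right before the tails agree.
    rw [h1, h2, h3, mul_add ((a * q ^ k) ^ 2 * q), ← tsum_mul_left]
    have : ∀ n : ℕ, (a * q ^ k) ^ 2 * q * ((if n + 1 = 0 then 1 else 2 * (-1) ^ (n + 1)) *
      ((a * q ^ (k + 1)) ^ (2 * (n + 1)) * q ^ ((n + 1) ^ 2))) =
      - ((if n + 1 + 1 = 0 then 1 else 2 * (-1) ^ (n + 1 + 1)) *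
        ((a * q ^ k) ^ (2 * (n + 1 + 1)) * q ^ ((n + 1 + 1) ^ 2))) := by
      intro n
      simp only [Nat.add_eq_zero_iff, one_ne_zero, and_false, if_false]
      ring
    simp only [this, tsum_neg]
    simp
    ring
  obtain ⟨C, hC⟩ := H.bdd
  have := eq_zero_of_norm_le_mul_succ (g := fun k => fineFun (-1) q (a * q ^ k) - R (a * q ^ k))
    (norm_nonneg _) H.lt_one (C := C + ∑' n : ℕ, 2 * ‖a ^ 2 * q‖ ^ n) ?_ ?_
  · have h0 := sub_eq_zero.1 this
    simpa only [pow_zero, mul_one] using h0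
  · intro k
    have hne : 1 - a * q ^ k * -1 * q ≠ 0 := by
      have := H.ne k
      rwa [show a * -1 * q ^ (k + 1) = a * q ^ k * -1 * q by ring] at this
    have hne' : 1 + a * q ^ k * q ≠ 0 := by
      convert hne using 1; ring
    rw [H.functional k, hRf k]
    -- For `p = -1` the fraction in the functional equation is identically `-1`, so the partial
    -- theta series obeys the same recursion.
    rw [show (-1 - a * q ^ k * q) / (1 - a * q ^ k * -1 * q) = -1 by
      rw [div_eq_iff hne]; ring]
    rw [show 1 - (a * q ^ k) ^ 2 * q + -1 * ((a * q ^ k) ^ 2 * q) * fineFun (-1) q (a * q ^ (k + 1)) -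
      (1 - (a * q ^ k) ^ 2 * q - (a * q ^ k) ^ 2 * q * R (a * q ^ (k + 1))) =
      -((a * q ^ k) ^ 2 * q * (fineFun (-1) q (a * q ^ (k + 1)) - R (a * q ^ (k + 1)))) by ring,
      norm_neg, norm_mul]
    gcongr
    exact H.norm_orbit_sq k
  · intro k
    exact (norm_sub_le _ _).trans (add_le_add (hC k) (hRb k))

/-- The Rogers–Fine series with `q = p ^ 2` is a partial theta series. -/
theorem fineFun_sq (H : FineAdmissible p (p ^ 2) a)
    (hne : ∀ k : ℕ, 1 - a * p * (p ^ 2) ^ k ≠ 0)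
    (hbd : ∃ C : ℝ, ∀ k : ℕ, ‖(1 - a * p * (p ^ 2) ^ k)⁻¹‖ ≤ C) :
    (1 - a * p)⁻¹ * fineFun p (p ^ 2) a = ∑' n : ℕ, a ^ n * p ^ (n * (n + 1) / 2) := by
  set q := p ^ 2 with hq
  have hp1 : ‖p‖ ≤ 1 := by
    have := H.norm_q
    rw [hq, norm_pow] at this
    exact (pow_le_one_iff_of_nonneg (norm_nonneg _) (by norm_num)).1 this
  have hap : ‖a * p‖ < 1 := by
    have := H.lt_one
    rw [hq, ← mul_pow, norm_pow] at this
    exact (pow_lt_one_iff_of_nonneg (norm_nonneg _) (by norm_num)).1 this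
  set R : ℂ → ℂ := fun a => ∑' n : ℕ, a ^ n * p ^ (n * (n + 1) / 2) with hR
  have hb : ∀ (k n : ℕ), ‖(a * q ^ k) ^ n * p ^ (n * (n + 1) / 2)‖ ≤ ‖a * p‖ ^ n := by
    intro k n
    obtain ⟨m, hm⟩ : ∃ m, n * (n + 1) / 2 = n + m := ⟨n * (n + 1) / 2 - n, by
      have : n ≤ n * (n + 1) / 2 := by
        rw [Nat.le_div_iff_mul_le (by norm_num)]
        rcases n with _ | n
        · simp
        · nlinarith
      omega⟩
    rw [hm, show (a * q ^ k) ^ n * p ^ (n + m) = (a * p) ^ n * ((q ^ k) ^ n * p ^ m) by ring,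
      norm_mul, norm_pow]
    refine mul_le_of_le_one_right (by positivity) ?_
    rw [norm_mul, norm_pow _ n, norm_pow _ k, norm_pow p m]
    exact mul_le_one₀ (pow_le_one₀ (by positivity) (pow_le_one₀ (norm_nonneg _) H.norm_q))
      (by positivity) (pow_le_one₀ (norm_nonneg _) hp1)
  have hgs : Summable fun n : ℕ => ‖a * p‖ ^ n :=
    summable_geometric_of_lt_one (norm_nonneg _) hap
  have hs : ∀ k, Summable fun n : ℕ => (a * q ^ k) ^ n * p ^ (n * (n + 1) / 2) :=
    fun k => .of_norm_bounded hgs (hb k)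
  have hRb : ∀ k, ‖R (a * q ^ k)‖ ≤ ∑' n : ℕ, ‖a * p‖ ^ n := fun k =>
    tsum_of_norm_bounded hgs.hasSum (hb k)
  have hRf : ∀ k, R (a * q ^ k) = 1 + a * q ^ k * p +
      (a * q ^ k) ^ 2 * q * p * R (a * q ^ (k + 1)) := by
    intro k
    have h1 := (hs k).tsum_eq_zero_add
    have h2 := ((summable_nat_add_iff 1).2 (hs k)).tsum_eq_zero_add
    simp only [hR]
    rw [h1, h2, ← tsum_mul_left]
    have : ∀ n : ℕ, (a * q ^ k) ^ (n + 1 + 1) * p ^ ((n + 1 + 1) * (n + 1 + 1 + 1) / 2) =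
      (a * q ^ k) ^ 2 * q * p * ((a * q ^ (k + 1)) ^ n * p ^ (n * (n + 1) / 2)) := by
      intro n
      have : (n + 1 + 1) * (n + 1 + 1 + 1) / 2 = n * (n + 1) / 2 + 2 * n + 3 := by
        rw [show (n + 1 + 1) * (n + 1 + 1 + 1) = n * (n + 1) + (2 * n + 3) * 2 by ring,
          Nat.add_mul_div_right _ _ (by norm_num)]
        ring
      rw [this, hq]
      ring
    simp only [this]
    simp
    ring
  obtain ⟨C, hC⟩ := H.bdd
  obtain ⟨C', hC'⟩ := hbd
  have := eq_zero_of_norm_le_mul_succ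
    (g := fun k => (1 - a * p * q ^ k)⁻¹ * fineFun p q (a * q ^ k) - R (a * q ^ k))
    (norm_nonneg _) H.lt_one (C := C' * C + ∑' n : ℕ, ‖a * p‖ ^ n) ?_ ?_
  · have h0 := sub_eq_zero.1 this
    simpa only [pow_zero, mul_one] using h0
  · intro k
    have h0 := hne k
    have h1 := hne (k + 1)
    have h1' : 1 - a * q ^ k * p * q ≠ 0 := by
      convert h1 using 1; ring
    rw [H.functional k, hRf k]
    -- For `q = p²` one has `p - a q^(k+1) = p (1 - a p q^k)`; dividing by `1 - a p q^k` therefore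
    -- leaves the constant multiplier `p`, and the free term becomes `1 + a q^k p`.
    rw [show (1 - a * p * q ^ k)⁻¹ * (1 - (a * q ^ k) ^ 2 * q +
        (p - a * q ^ k * q) / (1 - a * q ^ k * p * q) * ((a * q ^ k) ^ 2 * q) *
          fineFun p q (a * q ^ (k + 1))) -
        (1 + a * q ^ k * p + (a * q ^ k) ^ 2 * q * p * R (a * q ^ (k + 1))) =
        (a * q ^ k) ^ 2 * q * (p * ((1 - a * p * q ^ (k + 1))⁻¹ * fineFun p q (a * q ^ (k + 1))
          - R (a * q ^ (k + 1)))) by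
      rw [show a * q ^ k * p * q = a * p * q ^ (k + 1) by ring]
      field_simp
      rw [hq]
      ring, norm_mul]
    refine mul_le_mul (H.norm_orbit_sq k) ?_ (norm_nonneg _) (norm_nonneg _)
    rw [norm_mul]
    exact mul_le_of_le_one_left (norm_nonneg _) hp1
  · intro k
    refine (norm_sub_le _ _).trans (add_le_add ?_ (hRb k))
    rw [norm_mul]
    exact mul_le_mul (hC' k) (hC k) (norm_nonneg _) ((norm_nonneg _).trans (hC' k))

end FineAdmissible

/-! ### The case `|q| < 1`: Gauss's product formulas -/

/-- With `r = ‖q‖`, each factor of the quotient is at most `(1 + r^(j+1)) / (1 - r^(j+1)) ≤ exp (2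
r^(j+1) / (1 - r))`, and these exponents are summable, uniformly for `a` in the closed unit disc. -/
lemma exists_fineCoeff_bound {p q : ℂ} (hp : ‖p‖ ≤ 1) (hq : ‖q‖ < 1) :
    ∃ C : ℝ, 0 ≤ C ∧ ∀ a : ℂ, ‖a‖ ≤ 1 → ∀ n, ‖fineCoeff p q a n‖ ≤ C := by
  set r := ‖q‖ with hr
  have hr0 : 0 ≤ r := norm_nonneg _
  have hrn : ∀ j : ℕ, r ^ (j + 1) ≤ r := fun j => pow_le_of_le_one hr0 hq.le (by omega)
  have hsum : Summable fun j : ℕ => 2 * r ^ (j + 1) / (1 - r) := by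
    have := (summable_nat_add_iff 1).2 (summable_geometric_of_lt_one hr0 hq)
    simpa [mul_div_right_comm] using this.mul_left (2 / (1 - r))
  have hpos : ∀ j : ℕ, 0 ≤ 2 * r ^ (j + 1) / (1 - r) := fun j => by
    have : 0 < 1 - r := by linarith
    positivity
  refine ⟨Real.exp (∑' j : ℕ, 2 * r ^ (j + 1) / (1 - r)), (Real.exp_pos _).le, fun a ha n => ?_⟩
  have key : ‖fineCoeff p q a n‖ ≤ Real.exp (∑ j ∈ Finset.range n, 2 * r ^ (j + 1) / (1 - r)) := by
    rw [fineCoeff, qPoch, qPoch, ← Finset.prod_div_distrib, norm_prod, Real.exp_sum]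
    refine Finset.prod_le_prod (fun _ _ => norm_nonneg _) fun j _ => ?_
    rw [norm_div]
    have h1 : ‖1 - a * q * q ^ j‖ ≤ 1 + r ^ (j + 1) := by
      refine (norm_sub_le _ _).trans ?_
      rw [norm_one, show a * q * q ^ j = a * q ^ (j + 1) by ring, norm_mul, norm_pow]
      gcongr
      exact mul_le_of_le_one_left (by positivity) ha
    have h2 : 1 - r ^ (j + 1) ≤ ‖1 - a * p * q * q ^ j‖ := by
      refine le_trans ?_ (norm_sub_norm_le _ _)
      rw [norm_one, show a * p * q * q ^ j = a * p * q ^ (j + 1) by ring, norm_mul, norm_pow]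
      gcongr
      refine mul_le_of_le_one_left (by positivity) ?_
      rw [norm_mul]
      exact mul_le_one₀ ha (norm_nonneg _) hp
    have h3 : 0 < 1 - r ^ (j + 1) := by linarith [hrn j]
    calc ‖1 - a * q * q ^ j‖ / ‖1 - a * p * q * q ^ j‖
        ≤ (1 + r ^ (j + 1)) / (1 - r ^ (j + 1)) := by gcongr
      _ = 2 * r ^ (j + 1) / (1 - r ^ (j + 1)) + 1 := by field_simp; ring
      _ ≤ 2 * r ^ (j + 1) / (1 - r) + 1 := by
          gcongr
          exact hrn j
      _ ≤ _ := Real.add_one_le_exp _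
  exact key.trans (Real.exp_le_exp.2 (hsum.sum_le_tsum _ fun j _ => hpos j))

lemma one_sub_ne_zero_of_norm_lt {w : ℂ} (h : ‖w‖ < 1) : 1 - w ≠ 0 := by
  intro h0
  rw [← sub_eq_zero.1 h0, norm_one] at h
  exact lt_irrefl _ h

lemma norm_inv_one_sub_le {w : ℂ} {r : ℝ} (h : ‖w‖ ≤ r) (hr : r < 1) :
    ‖(1 - w)⁻¹‖ ≤ (1 - r)⁻¹ := by
  rw [norm_inv]
  have := norm_sub_norm_le 1 w
  rw [norm_one] at this
  exact inv_anti₀ (by linarith) (by linarith)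

lemma fineAdmissible_one {p q : ℂ} (hp : ‖p‖ ≤ 1) (hq : ‖q‖ < 1) : FineAdmissible p q 1 := by
  obtain ⟨C, hC0, hC⟩ := exists_fineCoeff_bound hp hq
  have hqk : ∀ k : ℕ, ‖1 * q ^ k‖ ≤ 1 := fun k => by
    rw [one_mul, norm_pow]
    exact pow_le_one₀ (norm_nonneg _) hq.le
  have hb : ∀ k n : ℕ, ‖fineCoeff p q (1 * q ^ k) n * (1 * q ^ (k + 1)) ^ n‖ ≤ C * ‖q‖ ^ n := by
    intro k n
    rw [norm_mul]
    refine mul_le_mul (hC _ (hqk k) n) ?_ (norm_nonneg _) hC0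
    rw [norm_pow]
    gcongr
    rw [one_mul, norm_pow]
    exact pow_le_of_le_one (norm_nonneg _) hq.le (by omega)
  have hg : Summable fun n : ℕ => C * ‖q‖ ^ n :=
    (summable_geometric_of_lt_one (norm_nonneg _) hq).mul_left C
  refine ⟨by simp, hq.le, by simpa using hq, fun n => ?_, fun k => .of_norm_bounded hg (hb k),
    2 + 2 * ∑' n : ℕ, C * ‖q‖ ^ n, fun k => ?_⟩
  · apply one_sub_ne_zero_of_norm_lt
    rw [one_mul, norm_mul, norm_pow]
    exact mul_lt_one_of_nonneg_of_lt_one_right hp (by positivity)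
      (pow_lt_one₀ (norm_nonneg _) hq (by omega))
  · have hV : ‖fineSum p q (1 * q ^ k)‖ ≤ ∑' n : ℕ, C * ‖q‖ ^ n := by
      refine tsum_of_norm_bounded hg.hasSum fun n => ?_
      have := hb k n
      rwa [pow_succ, ← mul_assoc 1] at this
    have h1 : ‖1 * q ^ k * p‖ ≤ 1 := by
      rw [norm_mul]
      exact mul_le_one₀ (hqk k) (norm_nonneg _) hp
    have h2 : ‖(1 * q ^ k) ^ 2 * q‖ ≤ 1 := by
      rw [norm_mul, norm_pow]
      exact mul_le_one₀ (pow_le_one₀ (norm_nonneg _) (hqk k)) (norm_nonneg _) hq.le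
    rw [fineFun]
    refine (norm_add_le _ _).trans (add_le_add ?_ ?_)
    · refine (norm_sub_le _ _).trans ?_
      rw [norm_one]
      linarith
    · rw [norm_mul]
      refine mul_le_mul ?_ hV (norm_nonneg _) (by norm_num)
      exact (norm_sub_le _ _).trans (by linarith)

/-- At `a = 1` the recurrence telescopes and expresses the `N`-th coefficient through partial sums
of `∑ c_n q^n`. The infinite product is thus identified with `fineFun p q 1` without taking a limit
in `a`. -/
lemma tendsto_fineCoeff_one {p q : ℂ} (hp : ‖p‖ ≤ 1) (hq : ‖q‖ < 1) :
    Tendsto (fineCoeff p q 1) atTop (𝓝 (fineFun p q 1)) := by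
  have H := fineAdmissible_one hp hq
  have hs : Summable fun n => fineCoeff p q 1 n * q ^ n := by
    simpa using H.summable 0
  have hS := hs.hasSum.tendsto_sum_nat
  have hne := H.ne
  have key : ∀ N, fineCoeff p q 1 N = 1 - p + p * (∑ n ∈ Finset.range (N + 1),
      fineCoeff p q 1 n * q ^ n) - q * ∑ n ∈ Finset.range N, fineCoeff p q 1 n * q ^ n := by
    intro N
    induction N with
    | zero => simp
    | succ N ih =>
      rw [Finset.sum_range_succ _ (N + 1), Finset.sum_range_succ _ N] at *
      linear_combination ih + fineCoeff_succ hne N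
  have h1 := ((hS.comp (tendsto_add_atTop_nat 1)).const_mul p).const_add (1 - p)
  have h2 := h1.sub (hS.const_mul q)
  refine (h2.congr fun N => (key N).symm).trans_eq ?_
  rw [fineFun, fineSum]
  simp only [one_mul]
  congr 1
  ring

/-- The Euler product `∏ (1 - q^n)`. -/
def eulerProd (q : ℂ) : ℂ := ∏' n : ℕ, (1 - q ^ (n + 1))

lemma tendsto_qPoch_self {q : ℂ} (hq : ‖q‖ < 1) :
    Tendsto (qPoch q q) atTop (𝓝 (eulerProd q)) := by
  have := (ModularForm.multipliable_one_sub_pow hq).hasProd.tendsto_prod_nat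
  refine this.congr fun n => ?_
  simp only [qPoch, pow_succ']

lemma eulerProd_ne_zero {q : ℂ} (hq : ‖q‖ < 1) : eulerProd q ≠ 0 := by
  have := tprod_one_add_ne_zero_of_summable (f := fun n : ℕ => -q ^ (n + 1)) (fun n => ?_) ?_
  · simpa [eulerProd, sub_eq_add_neg] using this
  · rw [← sub_eq_add_neg]
    apply one_sub_ne_zero_of_norm_lt
    rw [norm_pow]
    exact pow_lt_one₀ (norm_nonneg _) hq (by omega)
  · simpa using (summable_nat_add_iff 1).2 (summable_geometric_of_lt_one (norm_nonneg _) hq)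

lemma norm_sq_lt_one {q : ℂ} (hq : ‖q‖ < 1) : ‖q ^ 2‖ < 1 := by
  rw [norm_pow]
  exact pow_lt_one₀ (norm_nonneg _) hq (by norm_num)

lemma qPoch_mul_neg (q : ℂ) (n : ℕ) : qPoch q q n * qPoch (-q) q n = qPoch (q ^ 2) (q ^ 2) n := by
  simp only [qPoch, ← Finset.prod_mul_distrib]
  exact Finset.prod_congr rfl fun j _ => by ring

lemma qPoch_mul_sq (p : ℂ) (n : ℕ) :
    qPoch p (p ^ 2) n * qPoch (p ^ 2) (p ^ 2) n = qPoch p p (2 * n) := by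
  induction n with
  | zero => simp
  | succ n ih =>
    rw [show 2 * (n + 1) = 2 * n + 1 + 1 by ring]
    simp only [qPoch_succ]
    rw [← ih]
    ring

/-- Gauss: `∑ (-1)^n q^{n²}` as an infinite product. -/
theorem tsum_neg_one_pow_sq {q : ℂ} (hq : ‖q‖ < 1) :
    ∑' n : ℕ, (if n = 0 then 1 else 2 * (-1) ^ n) * q ^ (n ^ 2) =
      eulerProd q ^ 2 / eulerProd (q ^ 2) := by
  have h := (fineAdmissible_one (p := -1) (by simp) hq).fineFun_neg_one
  simp only [one_pow, one_mul] at h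
  rw [← h]
  refine tendsto_nhds_unique (tendsto_fineCoeff_one (by simp) hq) ?_
  have h1 := tendsto_qPoch_self hq
  have h2 := tendsto_qPoch_self (norm_sq_lt_one hq)
  refine ((h1.pow 2).div h2 (eulerProd_ne_zero (norm_sq_lt_one hq))).congr fun n => ?_
  have hne : qPoch q q n ≠ 0 := by
    rw [qPoch_ne_zero_iff]
    intro j _
    apply one_sub_ne_zero_of_norm_lt
    rw [← pow_succ', norm_pow]
    exact pow_lt_one₀ (norm_nonneg _) hq (by omega)
  simp only [Pi.div_apply, fineCoeff, ← qPoch_mul_neg]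
  rw [show (1 : ℂ) * q = q by ring, show (1 : ℂ) * -1 * q = -q by ring, sq,
    mul_div_mul_left _ _ hne]

/-- Gauss: `∑ p^{n(n+1)/2}` as an infinite product. -/
theorem tsum_pow_triangular {p : ℂ} (hp : ‖p‖ < 1) :
    ∑' n : ℕ, p ^ (n * (n + 1) / 2) = eulerProd (p ^ 2) ^ 2 / eulerProd p := by
  have hq := norm_sq_lt_one hp
  have hpk : ∀ k : ℕ, ‖1 * p * (p ^ 2) ^ k‖ ≤ ‖p‖ := fun k => by
    rw [one_mul, norm_mul]
    refine mul_le_of_le_one_right (norm_nonneg _) ?_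
    rw [norm_pow]
    exact pow_le_one₀ (norm_nonneg _) hq.le
  have h := (fineAdmissible_one (p := p) hp.le hq).fineFun_sq
    (fun k => one_sub_ne_zero_of_norm_lt ((hpk k).trans_lt hp))
    ⟨_, fun k => norm_inv_one_sub_le (hpk k) hp⟩
  simp only [one_pow, one_mul] at h
  rw [← h]
  refine tendsto_nhds_unique ((tendsto_fineCoeff_one hp.le hq).const_mul _) ?_
  have h1 := tendsto_qPoch_self hq
  have h2 := (tendsto_qPoch_self hp).comp
    (tendsto_id.const_mul_atTop' (show 0 < 2 by norm_num))
  -- The factor `(1 - p)⁻¹` completes the denominator to `(p; p²)_{n+1}`, which multiplied by `(p²;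
  -- p²)_{n+1}` is `(p; p)_{2n+2}`; hence the shifted limits.
  have h1' := h1.comp (tendsto_add_atTop_nat 1)
  have h2' := h2.comp (tendsto_add_atTop_nat 1)
  refine ((h1.mul h1').div h2' (eulerProd_ne_zero hp)).congr' ?_ |>.trans_eq (by rw [sq (eulerProd _)])
  filter_upwards with n
  have hne : qPoch (p ^ 2) (p ^ 2) (n + 1) ≠ 0 := by
    rw [qPoch_ne_zero_iff]
    intro j _
    apply one_sub_ne_zero_of_norm_lt
    rw [← pow_succ', norm_pow]
    exact pow_lt_one₀ (norm_nonneg _) hq (by omega)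
  simp only [Function.comp, Pi.div_apply, fineCoeff, id, ← qPoch_mul_sq]
  rw [mul_div_mul_right _ _ hne, qPoch_succ' p, one_mul, one_mul, mul_div_assoc', div_eq_mul_inv,
    div_eq_mul_inv, mul_inv]
  ring

/-! ### Theta series -/

lemma qpow_add (r s z : ℂ) : qpow (r + s) z = qpow r z * qpow s z := by
  rw [qpow, qpow, qpow, ← Complex.exp_add]
  ring_nf

lemma qpow_pow (r z : ℂ) (n : ℕ) : qpow r z ^ n = qpow (n * r) z := by
  rw [qpow, qpow, ← Complex.exp_nat_mul]
  ring_nf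

lemma norm_qpow_lt_one {r : ℝ} (hr : 0 < r) {z : ℂ} (hz : 0 < z.im) : ‖qpow r z‖ < 1 := by
  rw [qpow, Complex.norm_exp, Real.exp_lt_one_iff]
  have : (2 * Real.pi * I * r * z).re = -(2 * Real.pi * r * z.im) := by
    simp
  rw [this]
  have := Real.pi_pos
  have : 0 < 2 * Real.pi * r * z.im := by positivity
  linarith

lemma eta_eq (z : ℂ) : ModularForm.eta z = qpow (1 / 24) z * eulerProd (qpow 1 z) := by
  rw [ModularForm.eta, eulerProd]
  congr 1
  · rw [Function.Periodic.qParam, qpow]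
    congr 1
    push_cast
    ring
  · refine tprod_congr fun n => ?_
    rw [ModularForm.eta_q_eq_pow, qpow]
    ring_nf

/-- The square roots of the exponents of the theta series. -/
def nu (i : Fin 3) (k : ℕ) : ℝ := if i = 0 then k else (2 * k + 1) / 4

/-- The coefficients of the theta series. -/
def coef (i : Fin 3) (k : ℕ) : ℂ :=
  ![if k = 0 then 1 else 2 * (-1) ^ k, 1, zeta 16 / zeta 12 * (-1) ^ (k * (k + 1) / 2)] i

lemma zeta_ne_zero (k : ℕ) : zeta k ≠ 0 := Complex.exp_ne_zero _

lemma norm_zeta (k : ℕ) : ‖zeta k‖ = 1 := by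
  rw [zeta, show 2 * (Real.pi : ℂ) * I / k = ((2 * Real.pi / k : ℝ) : ℂ) * I by push_cast; ring,
    Complex.norm_exp_ofReal_mul_I]

lemma norm_coef_le (i : Fin 3) (k : ℕ) : ‖coef i k‖ ≤ 2 := by
  fin_cases i
  · simp only [coef, Fin.zero_eta, Matrix.cons_val_zero]
    split_ifs <;> simp
  · simp [coef]
  · simp [coef, norm_zeta]

lemma qpow_nu_succ (i : Fin 3) (hi : i ≠ 0) (k : ℕ) (z : ℂ) :
    qpow ((nu i k : ℂ) ^ 2) z = qpow (1 / 16) z * qpow (1 / 2) z ^ (k * (k + 1) / 2) := by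
  rw [qpow_pow, ← qpow_add, nu, if_neg hi]
  congr 1
  have h : ((k * (k + 1) / 2 : ℕ) : ℂ) = k * (k + 1) / 2 := by
    rw [Nat.cast_div (Nat.even_mul_succ_self k).two_dvd (by norm_num)]
    push_cast
    ring
  rw [h]
  push_cast
  ring

/-- The eta quotients `θ_i` are theta series. -/
theorem theta_eq_tsum {z : ℂ} (hz : 0 < z.im) (i : Fin 3) :
    theta z i = ∑' k : ℕ, coef i k * qpow ((nu i k : ℂ) ^ 2) z := by
  have hq : ‖qpow 1 z‖ < 1 := by simpa using norm_qpow_lt_one one_pos hz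
  have hp : ‖qpow (1 / 2) z‖ < 1 := by
    simpa using norm_qpow_lt_one (r := 1 / 2) (by norm_num) hz
  have hsq : qpow (1 / 2) z ^ 2 = qpow 1 z := by rw [qpow_pow]; norm_num
  have h24 : ∀ r, qpow r z ≠ 0 := fun r => Complex.exp_ne_zero _
  fin_cases i
  · have h := tsum_neg_one_pow_sq hq
    simp only [theta, Fin.zero_eta, Matrix.cons_val_zero, eta_eq]
    have e1 : qpow 1 (2 * z) = qpow 1 z ^ 2 := by rw [qpow_pow, qpow, qpow]; push_cast; ring_nf
    have e2 : qpow (1 / 24) (2 * z) = qpow (1 / 24) z ^ 2 := by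
      rw [qpow_pow, qpow, qpow]; push_cast; ring_nf
    rw [e1, e2, mul_pow, mul_div_mul_left _ _ (pow_ne_zero _ (h24 _)), ← h]
    refine tsum_congr fun k => ?_
    rw [qpow_pow]
    simp [coef, nu]
  · have h := tsum_pow_triangular hp
    simp only [theta, Fin.mk_one, Matrix.cons_val_one, Matrix.cons_val_zero, eta_eq]
    have e1 : qpow 1 (z / 2) = qpow (1 / 2) z := by rw [qpow, qpow]; ring_nf
    have e2 : qpow (1 / 24) z ^ 2 = qpow (1 / 16) z * qpow (1 / 24) (z / 2) := by
      rw [qpow_pow, qpow, qpow, qpow, ← Complex.exp_add]; push_cast; ring_nf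
    rw [e1, mul_pow, e2, mul_comm (qpow (1 / 16) z), mul_assoc,
      mul_div_mul_left _ _ (show qpow (1 / 24) (z / 2) ≠ 0 from Complex.exp_ne_zero _),
      mul_div_assoc, ← hsq, ← h, ← tsum_mul_left]
    refine tsum_congr fun k => ?_
    rw [qpow_nu_succ 1 (by simp)]
    simp [coef]
  · have h := tsum_pow_triangular (p := -qpow (1 / 2) z) (by simpa using hp)
    have hv : theta z 2 = ModularForm.eta z ^ 2 / ModularForm.eta (z / 2 + 1 / 2) := rfl
    change theta z 2 = ∑' k : ℕ, coef 2 k * qpow ((nu 2 k : ℂ) ^ 2) z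
    rw [hv, eta_eq, eta_eq]
    have e1 : qpow 1 (z / 2 + 1 / 2) = -qpow (1 / 2) z := by
      rw [qpow, qpow, ← mul_neg_one, ← Complex.exp_pi_mul_I, ← Complex.exp_add]; ring_nf
    -- The constants cancel because `1/16 - 1/12 + 1/48 = 0`; this explains the normalization `ζ₁₆ /
    -- ζ₁₂` of the last component.
    have e2 : qpow (1 / 24) z ^ 2 =
        zeta 16 / zeta 12 * qpow (1 / 16) z * qpow (1 / 24) (z / 2 + 1 / 2) := by
      rw [qpow_pow, qpow, qpow, qpow, zeta, zeta, ← Complex.exp_sub, ← Complex.exp_add,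
        ← Complex.exp_add]
      push_cast
      ring_nf
    rw [e1, mul_pow, e2, mul_comm (_ * qpow (1 / 16) z), mul_assoc,
      mul_div_mul_left _ _ (show qpow (1 / 24) (z / 2 + 1 / 2) ≠ 0 from Complex.exp_ne_zero _),
      mul_div_assoc, ← hsq, ← neg_sq (qpow (1 / 2) z), ← h, ← tsum_mul_left]
    refine tsum_congr fun k => ?_
    rw [qpow_nu_succ 2 (by simp), neg_pow]
    simp [coef]
    ring

/-! ### Roots of unity -/

/-- Writing `n = m b + r` makes the series the product of the geometric series in `σ` with one block
of length `b`. -/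
lemma hasSum_of_quasiperiodic {u : ℕ → ℂ} {σ : ℂ} {b : ℕ} (hb : 0 < b) (hσ : ‖σ‖ < 1)
    (hu : ∀ n, u (n + b) = σ * u n) :
    HasSum u ((1 - σ)⁻¹ * ∑ n ∈ Finset.range b, u n) := by
  have : NeZero b := ⟨hb.ne'⟩
  have hf : Summable fun m : ℕ => ‖σ ^ m‖ := by
    simpa using summable_geometric_of_lt_one (norm_nonneg _) hσ
  have hg : Summable fun r : Fin b => ‖u r‖ := Summable.of_finite
  have h1 := (summable_mul_of_summable_norm hf hg).hasSum
  rw [← tsum_mul_tsum_of_summable_norm hf hg, tsum_geometric_of_norm_lt_one hσ, tsum_fintype,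
    Fin.sum_univ_eq_sum_range (fun n => u n)] at h1
  rw [← (Nat.divModEquiv b).symm.hasSum_iff]
  have h2 : ∀ x : ℕ × Fin b, u ((Nat.divModEquiv b).symm x) = σ ^ x.1 * u x.2 := ?_
  · exact (funext h2 : u ∘ (Nat.divModEquiv b).symm = _) ▸ h1
  rintro ⟨m, r⟩
  simp only [Nat.divModEquiv_symm_apply]
  induction m with
  | zero => simp
  | succ m ih =>
    rw [show (m + 1) * b + (r : ℕ) = m * b + r + b by ring, hu, ih, pow_succ]
    ring

/-- The orbit `a q ^ k` is finite. This supplies the field `bdd` of `FineAdmissible` at roots of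
unity. -/
lemma exists_bound_orbit {q : ℂ} {b : ℕ} (hb : 0 < b) (hq : q ^ b = 1) (F : ℂ → ℝ) (a : ℂ) :
    ∃ C : ℝ, ∀ k : ℕ, F (a * q ^ k) ≤ C := by
  have hfin : ((Finset.range b).image fun k => F (a * q ^ k)).Nonempty :=
    ⟨F (a * q ^ 0), Finset.mem_image_of_mem _ (Finset.mem_range.2 hb)⟩
  refine ⟨Finset.max' _ hfin, fun k => ?_⟩
  rw [← Nat.mod_add_div k b, pow_add, pow_mul, hq, one_pow, mul_one]
  exact Finset.le_max' _ _ (Finset.mem_image_of_mem (fun k => F (a * q ^ k))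
    (Finset.mem_range.2 (Nat.mod_lt _ hb)))

section RootOfUnity
variable {p q : ℂ} {b : ℕ}

lemma norm_eq_one_of_pow_eq_neg_one (hb : 0 < b) (hp : p ^ b = -1) : ‖p‖ = 1 := by
  have : ‖p‖ ^ b = 1 := by rw [← norm_pow, hp]; simp
  exact (pow_eq_one_iff_of_nonneg (norm_nonneg _) hb.ne').1 this

lemma one_sub_mul_pow_ne_zero (hp : p ^ b = -1) (hq : q ^ b = 1) (n : ℕ) :
    1 - p * q ^ n ≠ 0 := by
  intro h
  have h1 : (p * q ^ n) ^ b = 1 := by rw [← sub_eq_zero.1 h, one_pow]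
  rw [mul_pow, hp, ← pow_mul, mul_comm n, pow_mul, hq, one_pow, mul_one] at h1
  norm_num at h1

/-- By `qPoch_primitive` a full period of factors contributes `(1 - a^b) / (1 - (a p)^b)`, and `p^b
= -1`. For `0 < a` this multiplier has modulus less than `1`. -/
lemma fineCoeff_add (hb : 0 < b) (hq : IsPrimitiveRoot q b) (hp : p ^ b = -1) (a : ℂ) (n : ℕ) :
    fineCoeff p q a (n + b) = (1 - a ^ b) / (1 + a ^ b) * fineCoeff p q a n := by
  have hqn : (q ^ n) ^ b = 1 := by rw [← pow_mul, mul_comm, pow_mul, hq.pow_eq_one, one_pow]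
  rw [fineCoeff, fineCoeff, qPoch_add, qPoch_add, qPoch_primitive hq hb, qPoch_primitive hq hb]
  simp only [mul_pow, hp, hqn, hq.pow_eq_one, mul_one]
  rw [mul_neg_one, sub_neg_eq_add]
  simp only [div_eq_mul_inv, mul_inv]
  ring

lemma norm_block_lt_one (b : ℕ) {a : ℝ} (h0 : 0 < a) :
    ‖(1 - (a : ℂ) ^ b) / (1 + (a : ℂ) ^ b)‖ < 1 := by
  have h1 : 0 < a ^ b := by positivity
  rw [show (1 - (a : ℂ) ^ b) / (1 + (a : ℂ) ^ b) = (((1 - a ^ b) / (1 + a ^ b) : ℝ) : ℂ) by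
    push_cast; rfl, Complex.norm_real, Real.norm_eq_abs, abs_div, abs_of_pos (a := 1 + a ^ b)
    (by positivity), div_lt_one (by positivity), abs_lt]
  constructor <;> linarith

lemma summable_fineCoeff (hb : 0 < b) (hq : IsPrimitiveRoot q b) (hp : p ^ b = -1) {a : ℝ}
    (h0 : 0 < a) {w t : ℂ} (hw : w ^ b = (a : ℂ) ^ b) (ht : ‖t‖ ≤ 1) :
    HasSum (fun n => fineCoeff p q w n * t ^ n)
      ((1 - (1 - (a : ℂ) ^ b) / (1 + (a : ℂ) ^ b) * t ^ b)⁻¹ *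
        ∑ n ∈ Finset.range b, fineCoeff p q w n * t ^ n) := by
  refine hasSum_of_quasiperiodic hb ?_ fun n => ?_
  · rw [norm_mul]
    refine mul_lt_one_of_nonneg_of_lt_one_left (norm_nonneg _) (norm_block_lt_one b h0) ?_
    rw [norm_pow]
    exact pow_le_one₀ (norm_nonneg _) ht
  · rw [fineCoeff_add hb hq hp, hw, pow_add]
    ring

lemma fineAdmissible_of_root (hb : 0 < b) (hq : IsPrimitiveRoot q b) (hp : p ^ b = -1) {a : ℝ}
    (h0 : 0 < a) (h1 : a < 1) : FineAdmissible p q a := by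
  have hqn : ‖q‖ = 1 := hq.norm'_eq_one hb.ne'
  have hpn := norm_eq_one_of_pow_eq_neg_one hb hp
  have han : ‖(a : ℂ)‖ = a := by rw [Complex.norm_real, Real.norm_eq_abs, abs_of_pos h0]
  refine ⟨by rw [han]; exact h1.le, hqn.le, ?_, fun n => ?_, fun k => ?_,
    exists_bound_orbit hb hq.pow_eq_one (fun w => ‖fineFun p q w‖) a⟩
  · rw [norm_mul, norm_pow, han, hqn, mul_one]
    exact pow_lt_one₀ h0.le h1 (by norm_num)
  · apply one_sub_ne_zero_of_norm_lt
    rw [norm_mul, norm_mul, norm_pow, han, hpn, hqn]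
    simpa using h1
  · refine (summable_fineCoeff hb hq hp h0 ?_ ?_).summable
    · rw [mul_pow, ← pow_mul, mul_comm k, pow_mul, hq.pow_eq_one, one_pow, mul_one]
    · rw [norm_mul, norm_pow, han, hqn, one_pow, mul_one]
      exact h1.le

lemma one_sub_mul_tsum_of_root (hb : 0 < b) (hq : IsPrimitiveRoot q b) (hp : p ^ b = -1) {a : ℝ}
    (h0 : 0 < a) (h1 : a < 1) :
    (1 - (a : ℂ)) * ∑' n, fineCoeff p q a n * (a : ℂ) ^ n = fineFun p q a := by
  have H := fineAdmissible_of_root hb hq hp h0 h1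
  exact one_sub_mul_tsum_fineCoeff H.ne
    (summable_fineCoeff hb hq hp h0 rfl H.norm_a).summable (by simpa using H.summable 0)

/-- As `a → 1⁻` the Rogers–Fine series at a root of unity tends to a finite sum. -/
lemma tendsto_fineFun_div (hb : 0 < b) (hq : IsPrimitiveRoot q b) (hp : p ^ b = -1) :
    Tendsto (fun a : ℝ => (1 - (a : ℂ))⁻¹ * fineFun p q a) (𝓝[<] 1)
      (𝓝 (∑ n ∈ Finset.range b, fineCoeff p q 1 n)) := by
  -- The closed form of the quasi-periodic series is a rational function of `a` that is regular at
  -- `a = 1`, unlike the series itself, whose convergence there is not needed.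
  have hc : ContinuousAt (fun a : ℝ => (1 - (1 - (a : ℂ) ^ b) / (1 + (a : ℂ) ^ b) * (a : ℂ) ^ b)⁻¹ *
        ∑ n ∈ Finset.range b, fineCoeff p q a n * (a : ℂ) ^ n) 1 := by
    refine ContinuousAt.mul (ContinuousAt.inv₀ ?_ (by simp)) ?_
    · refine continuousAt_const.sub (ContinuousAt.mul (ContinuousAt.div ?_ ?_ ?_) ?_)
      · fun_prop
      · fun_prop
      · simp only [ofReal_one, one_pow]; norm_num
      · fun_prop
    · refine tendsto_finsetSum _ fun n _ => ?_
      refine ContinuousAt.mul (f := fun a : ℝ => fineCoeff p q a n) ?_ (by fun_prop)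
      simp only [fineCoeff, qPoch]
      refine ContinuousAt.div (by fun_prop) (by fun_prop) ?_
      rw [Finset.prod_ne_zero_iff]
      intro j _
      have := one_sub_mul_pow_ne_zero hp hq.pow_eq_one (j + 1)
      rwa [pow_succ', ← mul_assoc, ← one_mul p, ← ofReal_one] at this
  have hl : Tendsto _ (𝓝[<] (1 : ℝ)) _ := hc.tendsto.mono_left nhdsWithin_le_nhds
  -- At `a = 1` the block multiplier is `0`, so only the first block remains.
  have : (1 - (1 - ((1 : ℝ) : ℂ) ^ b) / (1 + ((1 : ℝ) : ℂ) ^ b) * ((1 : ℝ) : ℂ) ^ b)⁻¹ *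
      ∑ n ∈ Finset.range b, fineCoeff p q ((1 : ℝ) : ℂ) n * ((1 : ℝ) : ℂ) ^ n =
      ∑ n ∈ Finset.range b, fineCoeff p q 1 n := by
    simp
  rw [this] at hl
  refine hl.congr' ?_
  filter_upwards [Ioo_mem_nhdsLT (show (0 : ℝ) < 1 by norm_num)] with a ha
  have hne : (1 - (a : ℂ)) ≠ 0 := by
    rw [sub_ne_zero]
    exact_mod_cast ha.2.ne'
  rw [← one_sub_mul_tsum_of_root hb hq hp ha.1 ha.2, inv_mul_cancel_left₀ hne]
  refine (summable_fineCoeff hb hq hp ha.1 rfl ?_).tsum_eq.symm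
  rw [Complex.norm_real, Real.norm_eq_abs, abs_of_pos ha.1]
  exact ha.2.le

end RootOfUnity

/-! ### The strange series at rational points -/

/-- The parameter `p` for which `θ_{i,n}` is a Rogers–Fine coefficient. -/
def fineBase (z : ℂ) : Fin 3 → ℂ := ![-1, qpow (1 / 2) z, -qpow (1 / 2) z]

/-- The constant factor between `θ_{i,n}` and the Rogers–Fine coefficient. -/
def finePrefactor (z : ℂ) : Fin 3 → ℂ :=
  ![1, qpow (1 / 16) z * (1 - qpow (1 / 2) z)⁻¹,
    zeta 16 / zeta 12 * qpow (1 / 16) z * (1 + qpow (1 / 2) z)⁻¹]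

/-- In components `1` and `2` the first factor of the Pochhammer symbol of length `n + 1` is moved
into the prefactor. No denominator has to be nonzero, since inversion in `ℂ` is multiplicative even
at `0`. -/
lemma thetaTrunc_eq (n : ℕ) (z : ℂ) (i : Fin 3) :
    thetaTrunc n z i = finePrefactor z i * fineCoeff (fineBase z i) (qpow 1 z) 1 n := by
  fin_cases i
  · simp [thetaTrunc, truncNum, truncDen, finePrefactor, fineBase, fineCoeff]
  · simp [thetaTrunc, truncNum, truncDen, finePrefactor, fineBase, fineCoeff, qPoch_succ',
      div_eq_mul_inv]
    ring
  · simp [thetaTrunc, truncNum, truncDen, finePrefactor, fineBase, fineCoeff, qPoch_succ',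
      div_eq_mul_inv]
    ring

/-- The parity condition describing the domain of `φ_i`, for a pair of integers. -/
def OddForm (i : Fin 3) (a b : ℤ) : Prop := ![Odd b, Odd a, Odd (a + b)] i

lemma qpow_one_half_mul (x : ℚ) (m : ℂ) : qpow (1 / 2 * m) x = cexp (Real.pi * I * (x * m)) := by
  rw [qpow]
  ring_nf

lemma exp_pi_mul_int (n : ℤ) : cexp (Real.pi * I * n) = (-1) ^ n := by
  rw [mul_comm, Complex.exp_int_mul, Complex.exp_pi_mul_I]

lemma cast_mul_den (x : ℚ) : (x : ℂ) * x.den = x.num := by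
  exact_mod_cast Rat.mul_den_eq_num x

lemma qpow_half_pow_den (x : ℚ) : qpow (1 / 2) x ^ x.den = (-1) ^ x.num := by
  rw [qpow_pow, mul_comm, qpow_one_half_mul, cast_mul_den, exp_pi_mul_int]

lemma isPrimitiveRoot_qpow (x : ℚ) : IsPrimitiveRoot (qpow 1 x) x.den := by
  have := Complex.isPrimitiveRoot_exp_rat x
  rwa [qpow, mul_one]

/-- In all three cases the parity condition amounts to `p ^ b = -1`, the hypothesis of the
root-of-unity analysis. -/
lemma fineBase_pow_den {x : ℚ} {i : Fin 3} (h : OddForm i x.num x.den) :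
    fineBase x i ^ x.den = -1 := by
  fin_cases i
  · exact Odd.neg_one_pow (by simpa [OddForm] using h)
  · change qpow (1 / 2) x ^ x.den = -1
    rw [qpow_half_pow_den]
    exact Odd.neg_one_zpow (by simpa [OddForm] using h)
  · change (-qpow (1 / 2) x) ^ x.den = -1
    have h' : Odd (x.num + x.den) := by simpa [OddForm] using h
    rw [neg_pow, qpow_half_pow_den, ← zpow_natCast, ← zpow_add₀ (by norm_num), add_comm]
    exact Odd.neg_one_zpow h'

lemma fineCoeff_eq_zero {p q : ℂ} {b : ℕ} (hb : 0 < b) (hq : q ^ b = 1) {n : ℕ} (hn : b ≤ n) :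
    fineCoeff p q 1 n = 0 := by
  rw [fineCoeff, div_eq_zero_iff]
  left
  rw [qPoch, Finset.prod_eq_zero_iff]
  refine ⟨b - 1, Finset.mem_range.2 (by omega), ?_⟩
  rw [one_mul, ← pow_succ', Nat.sub_add_cancel hb, hq, sub_self]

lemma truncDen_ne_zero {x : ℚ} {i : Fin 3} (h : OddForm i x.num x.den) (n : ℕ) :
    truncDen n x i ≠ 0 := by
  have hk := one_sub_mul_pow_ne_zero (fineBase_pow_den h) (isPrimitiveRoot_qpow x).pow_eq_one
  fin_cases i
  · change qPoch (-qpow 1 x) (qpow 1 x) n ≠ 0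
    rw [qPoch_ne_zero_iff]
    intro j _
    have := hk (j + 1)
    simpa [fineBase, pow_succ'] using this
  · change qPoch _ _ _ ≠ 0
    rw [qPoch_ne_zero_iff]
    exact fun j _ => hk j
  · change qPoch _ _ _ ≠ 0
    rw [qPoch_ne_zero_iff]
    exact fun j _ => hk j

lemma summable_thetaTrunc (x : ℚ) (i : Fin 3) : Summable fun n => thetaTrunc n (x : ℂ) i := by
  refine summable_of_ne_finset_zero (s := Finset.range x.den) fun n hn => ?_
  rw [thetaTrunc_eq, fineCoeff_eq_zero x.den_pos (isPrimitiveRoot_qpow x).pow_eq_one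
    (by simpa using hn), mul_zero]

lemma phi_eq_sum (x : ℚ) (i : Fin 3) :
    phi x i = finePrefactor x i *
      ∑ n ∈ Finset.range x.den, fineCoeff (fineBase x i) (qpow 1 x) 1 n := by
  rw [phi, thetaS, Finset.mul_sum, tsum_eq_sum (s := Finset.range x.den)]
  · exact Finset.sum_congr rfl fun n _ => thetaTrunc_eq n x i
  · intro n hn
    rw [thetaTrunc_eq, fineCoeff_eq_zero x.den_pos (isPrimitiveRoot_qpow x).pow_eq_one
      (by simpa using hn), mul_zero]

/-- Summability is automatic, as the terms vanish from `n = b` on, where `b` is the denominator of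
`x`; only vanishing denominators matter. When the parity fails, the factor containing `q^{b/2} =
(-1)^{num}` vanishes: `q^{b/2}` is a power of `q` for `b` even, and `q^{1/2}` times a power of `q`
for `b` odd. -/
lemma mem_strangeDomain_iff (x : ℚ) (i : Fin 3) :
    x ∈ strangeDomain i ↔ OddForm i x.num x.den := by
  refine ⟨fun h => ?_, fun h => ⟨truncDen_ne_zero h, summable_thetaTrunc x i⟩⟩
  by_contra hodd
  have hco := x.reduced
  have hpos := x.den_pos
  fin_cases i
  · have hev : Even x.den := by simpa [OddForm] using hodd
    have hnum : Odd x.num := by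
      rw [← Int.natAbs_odd, ← Nat.not_even_iff_odd]
      intro he
      have := Nat.dvd_gcd he.two_dvd hev.two_dvd
      rw [hco.gcd_eq_one] at this
      norm_num at this
    obtain ⟨m, hm⟩ := hev
    have := h.1 m
    change qPoch (-qpow 1 x) (qpow 1 x) m ≠ 0 at this
    rw [qPoch_ne_zero_iff] at this
    refine this (m - 1) (by omega) ?_
    rw [neg_mul, ← pow_succ', Nat.sub_add_cancel (by omega), qpow_pow]
    have h2 : (m : ℂ) * 1 = 1 / 2 * x.den := by rw [hm]; push_cast; ring
    rw [h2, qpow_one_half_mul, cast_mul_den, exp_pi_mul_int, hnum.neg_one_zpow]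
    ring
  all_goals
    have hden : Odd x.den := by
      rw [← Nat.not_even_iff_odd]
      intro he
      have h2 : Odd x.num := by
        rw [← Int.natAbs_odd, ← Nat.not_even_iff_odd]
        intro he'
        have := Nat.dvd_gcd he'.two_dvd he.two_dvd
        rw [hco.gcd_eq_one] at this
        norm_num at this
      refine hodd ?_
      simp [OddForm, h2, Int.odd_add, he]
    obtain ⟨m, hm⟩ := id hden
    have := h.1 m
    have h2 : qpow (1 / 2) x * qpow 1 x ^ m = (-1) ^ x.num := by
      rw [qpow_pow, ← qpow_add, show 1 / 2 + (m : ℂ) * 1 = 1 / 2 * x.den by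
        rw [hm]; push_cast; ring, qpow_one_half_mul, cast_mul_den, exp_pi_mul_int]
  · change qPoch (qpow (1 / 2) x) (qpow 1 x) (m + 1) ≠ 0 at this
    rw [qPoch_ne_zero_iff] at this
    refine this m (by omega) ?_
    have hev : Even x.num := by simpa [OddForm] using hodd
    rw [h2, hev.neg_one_zpow, sub_self]
  · change qPoch (-qpow (1 / 2) x) (qpow 1 x) (m + 1) ≠ 0 at this
    rw [qPoch_ne_zero_iff] at this
    refine this m (by omega) ?_
    have hev : Odd x.num := by
      have hev : Even (x.num + x.den) := by simpa [OddForm] using hodd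
      have hden' : Odd (x.den : ℤ) := by exact_mod_cast hden
      rw [Int.even_add'] at hev
      exact hev.2 hden'
    rw [neg_mul, h2, hev.neg_one_zpow]
    ring

/-- `φ_i(x)` is a regularized derivative of a partial theta series. -/
theorem tendsto_phi {x : ℚ} {i : Fin 3} (h : OddForm i x.num x.den) :
    Tendsto (fun a : ℝ => (1 - (a : ℂ))⁻¹ *
      ∑' k : ℕ, coef i k * qpow ((nu i k : ℂ) ^ 2) x * ((a ^ (2 * nu i k) : ℝ) : ℂ)) (𝓝[<] 1)
      (𝓝 (phi x i)) := by
  have hb := x.den_pos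
  have hq := isPrimitiveRoot_qpow x
  have hp := fineBase_pow_den h
  have hlim := tendsto_fineFun_div hb hq hp
  rw [phi_eq_sum]
  have hIoo := Ioo_mem_nhdsLT (show (0 : ℝ) < 1 by norm_num)
  have hpn := norm_eq_one_of_pow_eq_neg_one hb hp
  have hqn : ‖qpow 1 x‖ = 1 := hq.norm'_eq_one hb.ne'
  have key : ∀ j : Fin 3, j ≠ 0 → i = j → fineBase x i ^ 2 = qpow 1 x → ∀ c : ℂ,
      finePrefactor x i = c * (1 - fineBase x i)⁻¹ →
      (∀ k : ℕ, coef i k * qpow ((nu i k : ℂ) ^ 2) x = c * fineBase x i ^ (k * (k + 1) / 2)) →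
      Tendsto (fun a : ℝ => (1 - (a : ℂ))⁻¹ *
        ∑' k : ℕ, coef i k * qpow ((nu i k : ℂ) ^ 2) x * ((a ^ (2 * nu i k) : ℝ) : ℂ)) (𝓝[<] 1)
        (𝓝 (finePrefactor x i *
          ∑ n ∈ Finset.range x.den, fineCoeff (fineBase x i) (qpow 1 x) 1 n)) := by
    intro j hj hij hsq c hpre hc
    have hnu : ∀ k, 2 * nu i k = k + 1 / 2 := fun k => by
      rw [nu, if_neg (by rw [hij]; exact hj)]
      ring
    have h1p : (1 : ℂ) - fineBase x i ≠ 0 := by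
      have := one_sub_mul_pow_ne_zero hp hq.pow_eq_one 0
      simpa using this
    -- Here `2 ν = k + 1/2`, so a factor `a^{1/2}` is left over, and `fineFun_sq` brings the factor
    -- `(1 - a p)⁻¹`; both have finite limits, the second one entering the prefactor.
    have hsqrt : Tendsto (fun a : ℝ => ((a ^ (1 / 2 : ℝ) : ℝ) : ℂ)) (𝓝[<] 1) (𝓝 1) := by
      have : ContinuousAt (fun a : ℝ => ((a ^ (1 / 2 : ℝ) : ℝ) : ℂ)) 1 :=
        Complex.continuous_ofReal.continuousAt.comp
          (Real.continuousAt_rpow_const _ _ (Or.inl one_ne_zero))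
      have h2 := this.tendsto.mono_left (nhdsWithin_le_nhds (s := Set.Iio 1))
      simpa using h2
    have hinv : Tendsto (fun a : ℝ => (1 - (a : ℂ) * fineBase x i)⁻¹) (𝓝[<] 1)
        (𝓝 (1 - fineBase x i)⁻¹) := by
      have : ContinuousAt (fun a : ℝ => (1 - (a : ℂ) * fineBase x i)⁻¹) 1 :=
        ContinuousAt.inv₀ (by fun_prop) (by simpa using h1p)
      have h2 := this.tendsto.mono_left (nhdsWithin_le_nhds (s := Set.Iio 1))
      simpa using h2
    have hl2 := (hsqrt.mul (hinv.mul hlim)).const_mul c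
    rw [one_mul, ← mul_assoc, ← hpre] at hl2
    refine hl2.congr' ?_
    filter_upwards [hIoo] with a ha
    have H := fineAdmissible_of_root hb hq hp ha.1 ha.2
    rw [← hsq] at H hqn
    have han : ‖(a : ℂ)‖ = a := by rw [Complex.norm_real, Real.norm_eq_abs, abs_of_pos ha.1]
    have hle : ∀ k : ℕ, ‖(a : ℂ) * fineBase x i * (fineBase x i ^ 2) ^ k‖ ≤ a := fun k => by
      rw [norm_mul, norm_mul, norm_pow, hqn, han, hpn]
      simp
    have e := H.fineFun_sq (fun k => one_sub_ne_zero_of_norm_lt ((hle k).trans_lt ha.2))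
      ⟨_, fun k => norm_inv_one_sub_le (hle k) ha.2⟩
    rw [← hsq]
    have e2 : ∑' k : ℕ, coef i k * qpow ((nu i k : ℂ) ^ 2) x * ((a ^ (2 * nu i k) : ℝ) : ℂ) =
        c * ((a ^ (1 / 2 : ℝ) : ℝ) : ℂ) * ∑' n : ℕ, (a : ℂ) ^ n * fineBase x i ^ (n * (n + 1) / 2) := by
      rw [← tsum_mul_left]
      refine tsum_congr fun k => ?_
      rw [hc, hnu, Real.rpow_add ha.1, Real.rpow_natCast]
      push_cast
      ring
    rw [e2, ← e]
    ring
  have hsq : qpow (1 / 2) (x : ℂ) ^ 2 = qpow 1 x := by rw [qpow_pow]; norm_num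
  fin_cases i
  · simp only [finePrefactor, fineBase, Fin.zero_eta, Matrix.cons_val_zero, one_mul] at hlim hp ⊢
    refine hlim.congr' ?_
    filter_upwards [hIoo] with a ha
    rw [(fineAdmissible_of_root hb hq hp ha.1 ha.2).fineFun_neg_one]
    congr 1
    refine tsum_congr fun k => ?_
    have h1 : a ^ (2 * nu 0 k) = a ^ (2 * k) := by
      rw [nu, if_pos rfl, ← Real.rpow_natCast]
      push_cast
      rfl
    rw [h1, qpow_pow]
    simp [coef, nu]
    ring_nf
  · refine key 1 (by simp) rfl hsq (qpow (1 / 16) x) rfl fun k => ?_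
    rw [Fin.mk_one, qpow_nu_succ 1 (by simp)]
    simp [coef, fineBase]
  · refine key 2 (by simp) rfl ?_ (zeta 16 / zeta 12 * qpow (1 / 16) x) ?_ fun k => ?_
    · change (-qpow (1 / 2) (x : ℂ)) ^ 2 = _
      rw [neg_sq, hsq]
    · change _ = _ * (1 - -qpow (1 / 2) (x : ℂ))⁻¹
      rw [sub_neg_eq_add]
      rfl
    · change coef 2 k * qpow ((nu 2 k : ℂ) ^ 2) x = _ * (-qpow (1 / 2) (x : ℂ)) ^ _
      rw [qpow_nu_succ 2 (by simp), neg_pow]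
      simp [coef]
      ring

/-! ### The reflected series -/

lemma reflConverges_of_im_pos (i : Fin 3) {z : ℂ} (hz : 0 < z.im) : ReflConverges i z := by
  have hq : ‖qpow 1 z‖ < 1 := by simpa using norm_qpow_lt_one one_pos hz
  have hp : ‖qpow (1 / 2) z‖ < 1 := by
    simpa using norm_qpow_lt_one (r := 1 / 2) (by norm_num) hz
  have hlt : ∀ (w : ℂ) (n : ℕ), ‖w‖ < 1 → ‖w * qpow 1 z ^ n‖ < 1 := fun w n hw => by
    rw [norm_mul, norm_pow]
    exact mul_lt_one_of_nonneg_of_lt_one_left (norm_nonneg _) hw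
      (pow_le_one₀ (norm_nonneg _) hq.le)
  have hP : ∀ (w : ℂ) (n : ℕ), ‖w‖ < 1 → qPoch w (qpow 1 z) n ≠ 0 := fun w n hw => by
    rw [qPoch_ne_zero_iff]
    exact fun j _ => one_sub_ne_zero_of_norm_lt (hlt w j hw)
  have key : ∀ p c : ℂ, ‖p‖ < 1 → Summable fun n => c * p ^ n * qPoch (qpow 1 z) (qpow 1 z) n /
      qPoch p (qpow 1 z) (n + 1) := by
    intro p c hp
    obtain ⟨C, hC0, hC⟩ := exists_fineCoeff_bound hp.le hq
    refine Summable.of_norm_bounded (g := fun n : ℕ => ‖c * (1 - p)⁻¹‖ * C * ‖p‖ ^ n)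
      ((summable_geometric_of_lt_one (norm_nonneg _) hp).mul_left _) fun n => ?_
    rw [qPoch_succ', show c * p ^ n * qPoch (qpow 1 z) (qpow 1 z) n /
        ((1 - p) * qPoch (p * qpow 1 z) (qpow 1 z) n) =
        c * (1 - p)⁻¹ * fineCoeff p (qpow 1 z) 1 n * p ^ n by
      simp only [fineCoeff, one_mul, div_eq_mul_inv, mul_inv]; ring, norm_mul, norm_mul, norm_pow]
    gcongr
    exact hC 1 (by simp) n
  fin_cases i
  · obtain ⟨C, hC0, hC⟩ := exists_fineCoeff_bound (p := -1) (by simp) hq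
    have hle : ∀ n : ℕ, ‖-qpow 1 z ^ (2 * n + 1)‖ ≤ ‖qpow 1 z‖ := fun n => by
      rw [norm_neg, norm_pow]
      exact pow_le_of_le_one (norm_nonneg _) hq.le (by omega)
    have hne : ∀ n : ℕ, 1 + qpow 1 z ^ (2 * n + 1) ≠ 0 := fun n => by
      have := one_sub_ne_zero_of_norm_lt ((hle n).trans_lt hq)
      rwa [sub_neg_eq_add] at this
    constructor
    · intro n
      exact mul_ne_zero (hne n) (hP _ _ (by simpa using hq))
    · refine Summable.of_norm_bounded
        (g := fun n : ℕ => 2 * ‖qpow 1 z‖ ^ n * ((1 - ‖qpow 1 z‖)⁻¹ * C))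
        (((summable_geometric_of_lt_one (norm_nonneg _) hq).mul_left 2).mul_right _) fun n => ?_
      have e : reflNum n z 0 / reflDen n z 0 = 2 * qpow 1 z ^ (2 * n + 1) *
          ((1 - -qpow 1 z ^ (2 * n + 1))⁻¹ * fineCoeff (-1) (qpow 1 z) 1 (2 * n)) := by
        simp only [reflNum, reflDen, Matrix.cons_val_zero, fineCoeff, one_mul, neg_one_mul,
          div_eq_mul_inv, mul_inv, sub_neg_eq_add]
        ring
      change ‖reflNum n z 0 / reflDen n z 0‖ ≤ _
      rw [e, norm_mul, norm_mul, norm_mul, norm_pow, Complex.norm_two]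
      gcongr ?_ * ?_ * (?_ * ?_)
      · exact pow_le_pow_of_le_one (norm_nonneg _) hq.le (by omega)
      · exact norm_inv_one_sub_le (hle n) hq
      · exact hC 1 (by simp) _
  · refine ⟨fun n => hP _ _ hp, (key _ (-qpow (7 / 16) z) hp).congr fun n => ?_⟩
    simp only [reflNum, reflDen, Fin.mk_one, Matrix.cons_val_one, Matrix.cons_val_zero]
    ring
  · have hp' : ‖-qpow (1 / 2) z‖ < 1 := by simpa using hp
    exact ⟨fun n => hP _ _ hp', key _ (zeta 16 / zeta 12 * qpow (7 / 16) z) hp'⟩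

/-- Factor by factor, with `y = q ^ (j + 1)`: `(1 - y⁻¹) / (1 - p⁻¹ y⁻¹) = p (1 - y) / (1 - p y)`.
The two denominators vanish simultaneously, and then both sides are `0`. -/
lemma qPoch_inv_div (p : ℂ) {q : ℂ} (hp : p ≠ 0) (hq : q ≠ 0) (n : ℕ) :
    qPoch q⁻¹ q⁻¹ n / qPoch (p⁻¹ * q⁻¹) q⁻¹ n = p ^ n * (qPoch q q n / qPoch (p * q) q n) := by
  simp only [qPoch, ← Finset.prod_div_distrib]
  rw [← Finset.card_range n, ← Finset.prod_const, Finset.card_range, ← Finset.prod_mul_distrib]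
  refine Finset.prod_congr rfl fun j _ => ?_
  have hy : q ^ (j + 1) ≠ 0 := pow_ne_zero _ hq
  rw [← pow_succ', mul_assoc, ← pow_succ', mul_assoc, ← pow_succ', inv_pow]
  generalize q ^ (j + 1) = y at *
  by_cases h : 1 - p * y = 0
  · have : 1 - p⁻¹ * y⁻¹ = 0 := by
      rw [← mul_inv, ← sub_eq_zero.1 h]
      simp
    rw [h, this]
    simp
  · have h2 : p * y - 1 ≠ 0 := by
      rw [← neg_sub]
      exact neg_ne_zero.2 h
    have h3 : 1 - p⁻¹ * y⁻¹ ≠ 0 := by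
      have : 1 - p⁻¹ * y⁻¹ = (p * y - 1) / (p * y) := by field_simp
      rw [this]
      exact div_ne_zero h2 (mul_ne_zero hp hy)
    rw [div_eq_iff h3, mul_assoc, div_mul_eq_mul_div, mul_div_assoc', eq_div_iff h]
    field_simp
    ring

lemma qpow_neg (r z : ℂ) : qpow r (-z) = (qpow r z)⁻¹ := by
  rw [qpow, qpow, ← Complex.exp_neg]
  ring_nf

lemma qpow_ne_zero (r z : ℂ) : qpow r z ≠ 0 := Complex.exp_ne_zero _

/-- Besides the inversion of the quotient, the extra denominator factor gives `(1 - p⁻¹)⁻¹ = -p (1 -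
p)⁻¹`; its `q^{1/2}` turns `q^{-1/16}` into `q^{7/16}`. -/
lemma thetaTrunc_neg (n : ℕ) (z : ℂ) {i : Fin 3} (hi : i ≠ 0) :
    thetaTrunc n (-z) i = reflNum n z i / reflDen n z i := by
  have key : ∀ p c : ℂ, p ≠ 0 → c * qPoch (qpow 1 z)⁻¹ (qpow 1 z)⁻¹ n /
      qPoch p⁻¹ (qpow 1 z)⁻¹ (n + 1) = -p * c * p ^ n * qPoch (qpow 1 z) (qpow 1 z) n /
      qPoch p (qpow 1 z) (n + 1) := by
    intro p c hp
    have h := qPoch_inv_div p hp (qpow_ne_zero 1 z) n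
    have h1 : (1 - p⁻¹)⁻¹ = -p * (1 - p)⁻¹ := by
      by_cases h1 : p = 1
      · simp [h1]
      · have h2 : 1 - p ≠ 0 := sub_ne_zero.2 (Ne.symm h1)
        have h3 : p - 1 ≠ 0 := sub_ne_zero.2 h1
        have h4 : 1 - p⁻¹ ≠ 0 := by
          rw [sub_ne_zero]
          intro h
          exact h1 (inv_eq_one.1 h.symm)
        rw [inv_eq_iff_eq_inv, mul_inv, inv_inv]
        field_simp
        ring
    rw [qPoch_succ', qPoch_succ' p]
    simp only [div_eq_mul_inv, mul_inv] at h h1 ⊢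
    rw [h1]
    linear_combination c * (-p * (1 - p)⁻¹) * h
  have h716 : (qpow (1 / 16) z)⁻¹ * qpow (1 / 2) z = qpow (7 / 16) z := by
    rw [← qpow_neg, qpow, qpow, qpow, ← Complex.exp_add]
    ring_nf
  fin_cases i
  · exact absurd rfl hi
  · change qpow (1 / 16) (-z) * qPoch (qpow 1 (-z)) (qpow 1 (-z)) n /
      qPoch (qpow (1 / 2) (-z)) (qpow 1 (-z)) (n + 1) =
      -(qpow (7 / 16) z * qpow (1 / 2) z ^ n * qPoch (qpow 1 z) (qpow 1 z) n) /
      qPoch (qpow (1 / 2) z) (qpow 1 z) (n + 1)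
    rw [qpow_neg, qpow_neg, qpow_neg, key _ _ (qpow_ne_zero _ _), ← h716]
    ring
  · change zeta 16 / zeta 12 * qpow (1 / 16) (-z) * qPoch (qpow 1 (-z)) (qpow 1 (-z)) n /
      qPoch (-qpow (1 / 2) (-z)) (qpow 1 (-z)) (n + 1) =
      zeta 16 / zeta 12 * qpow (7 / 16) z * (-qpow (1 / 2) z) ^ n *
        qPoch (qpow 1 z) (qpow 1 z) n / qPoch (-qpow (1 / 2) z) (qpow 1 z) (n + 1)
    rw [qpow_neg, qpow_neg, qpow_neg, ← inv_neg, key _ _ (neg_ne_zero.2 (qpow_ne_zero _ _)), ← h716]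
    ring

/-- For `p = -1` the inversion produces only the sign `(-1)^m`, with no power of `q` to make terms
small. Pairing consecutive terms creates the decay, through `1 - (1 - y)/(1 + y) = 2y/(1 + y)` with
`y = q^{2n+1}`. -/
lemma thetaTrunc_neg_pair {z : ℂ} (hne : ∀ n, truncDen n z 0 ≠ 0) (n : ℕ) :
    thetaTrunc (2 * n) (-z) 0 + thetaTrunc (2 * n + 1) (-z) 0 = reflNum n z 0 / reflDen n z 0 := by
  have h : ∀ m, thetaTrunc m (-z) 0 =
      (-1) ^ m * (qPoch (qpow 1 z) (qpow 1 z) m / qPoch (-qpow 1 z) (qpow 1 z) m) := fun m => by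
    have h := qPoch_inv_div (-1) (by norm_num) (qpow_ne_zero 1 z) m
    rw [inv_neg_one, neg_one_mul, neg_one_mul] at h
    rw [← h, ← qpow_neg]
    rfl
  have h1 : qPoch (-qpow 1 z) (qpow 1 z) (2 * n) ≠ 0 := hne (2 * n)
  have h2 : qPoch (-qpow 1 z) (qpow 1 z) (2 * n + 1) ≠ 0 := hne (2 * n + 1)
  rw [h, h, qPoch_succ, qPoch_succ] at *
  have h3 := right_ne_zero_of_mul h2
  rw [neg_mul, sub_neg_eq_add, ← pow_succ'] at *
  simp only [reflNum, reflDen, Matrix.cons_val_zero]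
  rw [pow_succ (-1 : ℂ), pow_mul (-1 : ℂ)]
  generalize qPoch (-qpow 1 z) (qpow 1 z) (2 * n) = A at *
  generalize qpow 1 z ^ (2 * n + 1) = B at *
  field_simp
  simp
  ring

lemma oddForm_neg_left {i : Fin 3} {a b : ℤ} : OddForm i (-a) b ↔ OddForm i a b := by
  fin_cases i <;> simp [OddForm, Int.odd_add]

lemma oddForm_neg_right {i : Fin 3} {a b : ℤ} : OddForm i a (-b) ↔ OddForm i a b := by
  fin_cases i <;> simp [OddForm, Int.odd_add]

lemma neg_mem_strangeDomain {x : ℚ} {i : Fin 3} : -x ∈ strangeDomain i ↔ x ∈ strangeDomain i := by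
  rw [mem_strangeDomain_iff, mem_strangeDomain_iff, Rat.neg_num, Rat.neg_den, oddForm_neg_left]

/-- The strange series at `q⁻¹` is the reflected series at `q`. -/
theorem phi_neg_eq_G {x : ℚ} {i : Fin 3} (h : -x ∈ strangeDomain i) :
    ReflConverges i x ∧ phi (-x) i = G x i := by
  have hx := neg_mem_strangeDomain.1 h
  have hs : Summable fun n => thetaTrunc n (-(x : ℂ)) i := by simpa using h.2
  have hphi : phi (-x) i = ∑' n, thetaTrunc n (-(x : ℂ)) i := by simp [phi, thetaS]
  by_cases hi : i = 0
  · subst hi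
    have he : Summable fun n => thetaTrunc (2 * n) (-(x : ℂ)) 0 :=
      hs.comp_injective (mul_right_injective₀ two_ne_zero)
    have ho : Summable fun n => thetaTrunc (2 * n + 1) (-(x : ℂ)) 0 :=
      hs.comp_injective ((add_left_injective 1).comp (mul_right_injective₀ two_ne_zero))
    have hp := fun n => thetaTrunc_neg_pair hx.1 n
    refine ⟨⟨fun n => ?_, (he.add ho).congr hp⟩, ?_⟩
    · have h1 : qPoch (-qpow 1 x) (qpow 1 x) (2 * n + 1) ≠ 0 := hx.1 (2 * n + 1)
      rw [qPoch_succ, neg_mul, sub_neg_eq_add, ← pow_succ'] at h1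
      have h2 : reflDen n (x : ℂ) 0 = (1 + qpow 1 x ^ (2 * n + 1)) *
        qPoch (-qpow 1 x) (qpow 1 x) (2 * n) := rfl
      rw [h2, mul_comm]
      exact h1
    · rw [hphi, ← tsum_even_add_odd (f := fun n => thetaTrunc n (-(x : ℂ)) 0) he ho, ← he.tsum_add ho, G]
      exact tsum_congr hp
  · have ht := fun n => thetaTrunc_neg n (x : ℂ) hi
    refine ⟨⟨fun n => ?_, hs.congr ht⟩, ?_⟩
    · have := hx.1 n
      fin_cases i
      · exact absurd rfl hi
      · exact this
      · exact this
    · rw [hphi, G]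
      exact tsum_congr ht

/-! ### Translation -/

lemma oddForm_num_den {m n : ℤ} (hc : IsCoprime m n) (hn : n ≠ 0) (i : Fin 3) :
    OddForm i ((m : ℚ) / n).num ((m : ℚ) / n).den ↔ OddForm i m n := by
  rcases lt_or_gt_of_ne hn with h | h
  · have hc' : Nat.Coprime (-m).natAbs (-n).natAbs := by
      simpa [← Int.isCoprime_iff_gcd_eq_one, Int.gcd_eq_natAbs, Nat.Coprime] using
        Int.isCoprime_iff_gcd_eq_one.1 hc
    have h1 := Rat.num_div_eq_of_coprime (by omega : 0 < -n) hc'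
    have h2 := Rat.den_div_eq_of_coprime (by omega : 0 < -n) hc'
    rw [← neg_div_neg_eq, ← Int.cast_neg, ← Int.cast_neg, h1, h2, oddForm_neg_left,
      oddForm_neg_right]
  · have hc' : Nat.Coprime m.natAbs n.natAbs := by
      simpa [Int.gcd_eq_natAbs, Nat.Coprime] using Int.isCoprime_iff_gcd_eq_one.1 hc
    rw [Rat.num_div_eq_of_coprime h hc', Rat.den_div_eq_of_coprime h hc']

lemma mem_strangeDomain_div {m n : ℤ} (hc : IsCoprime m n) (hn : n ≠ 0) (i : Fin 3) :
    (m : ℚ) / n ∈ strangeDomain i ↔ OddForm i m n := by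
  rw [mem_strangeDomain_iff, oddForm_num_den hc hn]

lemma qpow_add_one (r z : ℂ) : qpow r (z + 1) = qpow r z * cexp (2 * Real.pi * I * r) := by
  rw [qpow, qpow, ← Complex.exp_add]
  ring_nf

/-- The translation fixes `q` and negates `q^{1/2}`, which exchanges the last two components term by
term. The scalars come from `ζ₁₆² = ζ₁₂ ζ₂₄`. -/
lemma phi_add_one (x : ℚ) :
    phi (x + 1) 0 = phi x 0 ∧ phi (x + 1) 1 = zeta 12 * phi x 2 ∧
      phi (x + 1) 2 = zeta 24 * phi x 1 := by
  have e1 : qpow 1 ((x : ℂ) + 1) = qpow 1 x := by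
    rw [qpow_add_one, mul_one, Complex.exp_two_pi_mul_I, mul_one]
  have e2 : qpow (1 / 2) ((x : ℂ) + 1) = -qpow (1 / 2) x := by
    rw [qpow_add_one, show 2 * (Real.pi : ℂ) * I * (1 / 2) = Real.pi * I by ring,
      Complex.exp_pi_mul_I, mul_neg_one]
  have e3 : qpow (1 / 16) ((x : ℂ) + 1) = qpow (1 / 16) x * zeta 16 := by
    rw [qpow_add_one, zeta]
    push_cast
    ring_nf
  have h12 := zeta_ne_zero 12
  have e4 : zeta 16 * zeta 16 = zeta 12 * zeta 24 := by
    simp only [zeta, ← Complex.exp_add]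
    push_cast
    ring_nf
  simp only [phi, thetaS, ← tsum_mul_left]
  push_cast
  refine ⟨tsum_congr fun n => ?_, tsum_congr fun n => ?_, tsum_congr fun n => ?_⟩
  · change qPoch (qpow 1 (x + 1)) (qpow 1 (x + 1)) n / qPoch (-qpow 1 (x + 1)) (qpow 1 (x + 1)) n =
      qPoch (qpow 1 x) (qpow 1 x) n / qPoch (-qpow 1 x) (qpow 1 x) n
    rw [e1]
  · change qpow (1 / 16) (x + 1) * qPoch (qpow 1 (x + 1)) (qpow 1 (x + 1)) n /
        qPoch (qpow (1 / 2) (x + 1)) (qpow 1 (x + 1)) (n + 1) =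
      zeta 12 * (zeta 16 / zeta 12 * qpow (1 / 16) x * qPoch (qpow 1 x) (qpow 1 x) n /
        qPoch (-qpow (1 / 2) x) (qpow 1 x) (n + 1))
    rw [e1, e2, e3]
    field_simp
  · change zeta 16 / zeta 12 * qpow (1 / 16) (x + 1) * qPoch (qpow 1 (x + 1)) (qpow 1 (x + 1)) n /
        qPoch (-qpow (1 / 2) (x + 1)) (qpow 1 (x + 1)) (n + 1) =
      zeta 24 * (qpow (1 / 16) x * qPoch (qpow 1 x) (qpow 1 x) n /
        qPoch (qpow (1 / 2) x) (qpow 1 x) (n + 1))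
    rw [e1, e2, e3, neg_neg]
    rw [show zeta 16 / zeta 12 * (qpow (1 / 16) x * zeta 16) =
      zeta 16 * zeta 16 / zeta 12 * qpow (1 / 16) x by ring, e4, mul_div_cancel_left₀ _ h12]
    ring

/-! ### Modularity of the eta quotients -/

/-- The principal branch of `(z / i)^{1/2}`. -/
def rootFactor (z : ℂ) : ℂ := (-I * z) ^ (1 / 2 : ℂ)

lemma rootFactor_sq (z : ℂ) : rootFactor z ^ 2 = -I * z := by
  rw [rootFactor, ← Complex.cpow_nat_mul]
  norm_num

lemma rootFactor_ne_zero {z : ℂ} (hz : 0 < z.im) : rootFactor z ≠ 0 := by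
  intro h
  have := rootFactor_sq z
  rw [h] at this
  have h2 : z = 0 := by simpa using this.symm
  simp [h2] at hz

lemma norm_rootFactor_pow_four (z : ℂ) : ‖rootFactor z‖ ^ 4 = ‖z‖ ^ 2 := by
  rw [show (4 : ℕ) = 2 * 2 by norm_num, pow_mul, ← norm_pow, rootFactor_sq]
  simp

lemma ofReal_mul_cpow {r : ℝ} (hr : 0 < r) (w c : ℂ) : ((r : ℂ) * w) ^ c = (r : ℂ) ^ c * w ^ c := by
  have hr' : (r : ℂ) ≠ 0 := by exact_mod_cast hr.ne'
  by_cases hw : w = 0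
  · by_cases hc : c = 0
    · simp [hc]
    · simp [hw, hc]
  · rw [Complex.cpow_def_of_ne_zero (mul_ne_zero hr' hw), Complex.cpow_def_of_ne_zero hr',
      Complex.cpow_def_of_ne_zero hw, Complex.log_ofReal_mul hr hw, Complex.ofReal_log hr.le,
      add_mul, Complex.exp_add]

lemma rootFactor_mul_ofReal {r : ℝ} (hr : 0 < r) (z : ℂ) :
    rootFactor (r * z) = (Real.sqrt r : ℂ) * rootFactor z := by
  rw [rootFactor, rootFactor, show -I * (r * z) = r * (-I * z) by ring,
    ofReal_mul_cpow hr, Real.sqrt_eq_rpow, Complex.ofReal_cpow hr.le]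
  push_cast
  rfl

lemma eta_neg_inv {z : ℂ} (hz : 0 < z.im) :
    ModularForm.eta (-1 / z) = rootFactor z * ModularForm.eta z := by
  have h := ModularForm.eta_comp_eq_csqrt_I_inv hz
  simp only [Function.comp, Pi.smul_apply, Pi.mul_apply, smul_eq_mul] at h
  rw [h, ← mul_assoc]
  congr 1
  have hz0 : z ≠ 0 := fun h => by simp [h] at hz
  -- On the upper half plane `arg z` lies in `[0, π]`, so subtracting `π/2` stays within the
  -- principal range.
  have hlog : log (-I * z) = log z - Real.pi / 2 * I := by
    have : -I * z = cexp (log z - Real.pi / 2 * I) := by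
      rw [Complex.exp_sub, Complex.exp_log hz0, Complex.exp_pi_div_two_mul_I, div_I]
      ring
    rw [this, Complex.log_exp]
    · simp only [sub_im, log_im]
      have := Complex.arg_nonneg_iff.2 hz.le
      have h2 : ((Real.pi : ℂ) / 2 * I).im = Real.pi / 2 := by simp
      rw [h2]
      linarith [Real.pi_pos]
    · simp only [sub_im, log_im]
      have := Complex.arg_le_pi z
      have h2 : ((Real.pi : ℂ) / 2 * I).im = Real.pi / 2 := by simp
      rw [h2]
      linarith [Real.pi_pos]
  rw [rootFactor, Complex.cpow_def_of_ne_zero (by simpa using hz0), hlog,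
    _root_.sqrt_eq_exp I_ne_zero, _root_.sqrt_eq_exp hz0, Complex.log_I, ← Complex.exp_neg,
    ← Complex.exp_add]
  ring_nf

lemma eta_add_one (z : ℂ) : ModularForm.eta (z + 1) = zeta 24 * ModularForm.eta z := by
  rw [eta_eq, eta_eq, qpow_add_one, qpow_add_one, mul_one, Complex.exp_two_pi_mul_I, mul_one, zeta]
  push_cast
  ring_nf

/-- Even powers of `p` occur in both of the first two symbols, while odd ones pair up as `(1 -
p^m)(1 + p^m) = 1 - p^{2m}`; the symbol in `p⁴` fills in the missing factors. -/
lemma qPoch_neg_half (p : ℂ) (n : ℕ) : qPoch p p (2 * n) * qPoch (-p) (-p) (2 * n) *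
    qPoch (p ^ 4) (p ^ 4) n = qPoch (p ^ 2) (p ^ 2) n ^ 2 * qPoch (p ^ 2) (p ^ 2) (2 * n) := by
  induction n with
  | zero => simp
  | succ n ih =>
    rw [show 2 * (n + 1) = 2 * n + 1 + 1 by ring]
    simp only [qPoch_succ]
    have h1 : (-p) ^ (2 * n) = p ^ (2 * n) := by rw [neg_pow, pow_mul (-1 : ℂ)]; simp
    have h2 : (-p) ^ (2 * n + 1) = -p ^ (2 * n + 1) := by rw [pow_succ, h1]; ring
    rw [h1, h2]
    linear_combination (1 - p * p ^ (2 * n)) * (1 - p * p ^ (2 * n + 1)) * (1 + p * p ^ (2 * n)) *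
      (1 - p * p ^ (2 * n + 1)) * (1 - p ^ 4 * (p ^ 4) ^ n) * ih

lemma eulerProd_neg_mul {p : ℂ} (hp : ‖p‖ < 1) :
    eulerProd p * eulerProd (-p) * eulerProd (p ^ 4) = eulerProd (p ^ 2) ^ 3 := by
  have h2 := norm_sq_lt_one hp
  have h4 : ‖p ^ 4‖ < 1 := by
    rw [norm_pow]
    exact pow_lt_one₀ (norm_nonneg _) hp (by norm_num)
  have ht : Tendsto (fun n : ℕ => 2 * n) atTop atTop :=
    tendsto_id.const_mul_atTop' (show 0 < 2 by norm_num)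
  have e1 := (((tendsto_qPoch_self hp).comp ht).mul
    ((tendsto_qPoch_self (q := -p) (by simpa using hp)).comp ht)).mul (tendsto_qPoch_self h4)
  have e2 := ((tendsto_qPoch_self h2).pow 2).mul ((tendsto_qPoch_self h2).comp ht)
  have := tendsto_nhds_unique (e1.congr fun n => qPoch_neg_half p n) e2
  rw [this]
  ring

/-- The argument `z/2 + 1/2` is not adapted to `z ↦ -1/z`. The product identity replaces it by
`z/2`, `z` and `2z`, which the inversion permutes up to its action on each. -/
lemma theta_two_eq {z : ℂ} (hz : 0 < z.im) :
    theta z 2 = ModularForm.eta (z / 2) * ModularForm.eta (2 * z) /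
      (zeta 48 * ModularForm.eta z) := by
  have hv : theta z 2 = ModularForm.eta z ^ 2 / ModularForm.eta (z / 2 + 1 / 2) := rfl
  have hz2 : 0 < (z / 2 + 1 / 2).im := by
    have : (z / 2 + 1 / 2).im = z.im / 2 := by simp
    rw [this]; positivity
  rw [hv, div_eq_div_iff (ModularForm.eta_ne_zero hz2)
    (mul_ne_zero (zeta_ne_zero _) (ModularForm.eta_ne_zero hz))]
  have hp : ‖qpow (1 / 2) z‖ < 1 := by
    simpa using norm_qpow_lt_one (r := 1 / 2) (by norm_num) hz
  have h := eulerProd_neg_mul hp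
  simp only [eta_eq]
  have e1 : qpow 1 (z / 2 + 1 / 2) = -qpow (1 / 2) z := by
    rw [qpow, qpow, ← mul_neg_one, ← Complex.exp_pi_mul_I, ← Complex.exp_add]; ring_nf
  have e2 : qpow 1 (z / 2) = qpow (1 / 2) z := by rw [qpow, qpow]; ring_nf
  have e3 : qpow 1 (2 * z) = qpow (1 / 2) z ^ 4 := by
    rw [qpow_pow, qpow, qpow]; push_cast; ring_nf
  have e4 : qpow 1 z = qpow (1 / 2) z ^ 2 := by rw [qpow_pow]; norm_num
  rw [e1, e2, e3, e4]
  have e5 : qpow (1 / 24) z ^ 3 * zeta 48 =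
      qpow (1 / 24) (z / 2) * qpow (1 / 24) (2 * z) * qpow (1 / 24) (z / 2 + 1 / 2) := by
    rw [qpow_pow, qpow, qpow, qpow, qpow, zeta, ← Complex.exp_add, ← Complex.exp_add,
      ← Complex.exp_add]
    push_cast
    ring_nf
  linear_combination eulerProd (qpow (1 / 2) z ^ 2) ^ 3 * e5 -
    qpow (1 / 24) (z / 2) * qpow (1 / 24) (2 * z) * qpow (1 / 24) (z / 2 + 1 / 2) * h

lemma im_neg_inv_pos {z : ℂ} (hz : 0 < z.im) : 0 < (-1 / z).im := by
  have h0 : z ≠ 0 := fun h => by simp [h] at hz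
  have : (-1 / z).im = z.im / normSq z := by
    rw [neg_div, one_div, neg_im, inv_im]
    ring
  rw [this]
  exact div_pos hz (normSq_pos.2 h0)

/-- Inversion sends `η` at `2z` to `η` at `z/2` and conversely, so it exchanges the first two
quotients and fixes the third. The constants `√2` come from the root factors at `z/2` and `2z`. -/
lemma theta_neg_inv {z : ℂ} (hz : 0 < z.im) :
    theta (-1 / z) 0 = Real.sqrt 2 * rootFactor z * theta z 1 ∧
    theta (-1 / z) 1 = 1 / Real.sqrt 2 * rootFactor z * theta z 0 ∧
    theta (-1 / z) 2 = rootFactor z * theta z 2 := by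
  have h0 : z ≠ 0 := fun h => by simp [h] at hz
  have hz2 : 0 < (z / 2).im := by simpa using hz
  have h2z : 0 < (2 * z).im := by simpa using hz
  have hs2 : (Real.sqrt 2 : ℂ) ≠ 0 := by simp
  have hss : (Real.sqrt 2 : ℂ) ^ 2 = 2 := by
    rw [← ofReal_pow, Real.sq_sqrt (by norm_num)]; norm_num
  have hr := rootFactor_ne_zero hz
  have r2 : rootFactor (2 * z) = Real.sqrt 2 * rootFactor z := by
    have := rootFactor_mul_ofReal (r := 2) (by norm_num) z
    simpa using this
  have rh : Real.sqrt 2 * rootFactor (z / 2) = rootFactor z := by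
    have := rootFactor_mul_ofReal (r := 2) (by norm_num) (z / 2)
    rw [← this]
    congr 1
    push_cast
    ring
  have e1 : ModularForm.eta (2 * (-1 / z)) = rootFactor (z / 2) * ModularForm.eta (z / 2) := by
    rw [← eta_neg_inv hz2]
    congr 1
    field_simp
  have e2 : ModularForm.eta (-1 / z / 2) = rootFactor (2 * z) * ModularForm.eta (2 * z) := by
    rw [← eta_neg_inv h2z]
    congr 1
    field_simp
  have n1 := ModularForm.eta_ne_zero hz
  have n2 := ModularForm.eta_ne_zero hz2
  have n3 := ModularForm.eta_ne_zero h2z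
  have hrh : rootFactor (z / 2) ≠ 0 := rootFactor_ne_zero hz2
  refine ⟨?_, ?_, ?_⟩
  · change ModularForm.eta (-1 / z) ^ 2 / ModularForm.eta (2 * (-1 / z)) =
      _ * (ModularForm.eta z ^ 2 / ModularForm.eta (z / 2))
    rw [e1, eta_neg_inv hz, ← rh]
    field_simp
  · change ModularForm.eta (-1 / z) ^ 2 / ModularForm.eta (-1 / z / 2) =
      _ * (ModularForm.eta z ^ 2 / ModularForm.eta (2 * z))
    rw [e2, eta_neg_inv hz, r2]
    field_simp
  · rw [theta_two_eq hz, theta_two_eq (im_neg_inv_pos hz), e1, e2, eta_neg_inv hz, r2]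
    have := zeta_ne_zero 48
    field_simp
    linear_combination rh

lemma theta_add_one (z : ℂ) :
    theta (z + 1) 0 = theta z 0 ∧ theta (z + 1) 1 = zeta 12 * theta z 2 ∧
      theta (z + 1) 2 = zeta 24 * theta z 1 := by
  have h24 := zeta_ne_zero 24
  have e : zeta 24 ^ 2 = zeta 12 := by
    rw [zeta, zeta, ← Complex.exp_nat_mul]
    push_cast
    ring_nf
  refine ⟨?_, ?_, ?_⟩
  · change ModularForm.eta (z + 1) ^ 2 / ModularForm.eta (2 * (z + 1)) =
      ModularForm.eta z ^ 2 / ModularForm.eta (2 * z)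
    rw [show 2 * (z + 1) = 2 * z + 1 + 1 by ring]
    simp only [eta_add_one]
    rw [← mul_assoc, mul_pow, ← sq, mul_div_mul_left _ _ (pow_ne_zero _ h24)]
  · change ModularForm.eta (z + 1) ^ 2 / ModularForm.eta ((z + 1) / 2) =
      zeta 12 * (ModularForm.eta z ^ 2 / ModularForm.eta (z / 2 + 1 / 2))
    rw [show (z + 1) / 2 = z / 2 + 1 / 2 by ring, eta_add_one, mul_pow, e, mul_div_assoc]
  · change ModularForm.eta (z + 1) ^ 2 / ModularForm.eta ((z + 1) / 2 + 1 / 2) =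
      zeta 24 * (ModularForm.eta z ^ 2 / ModularForm.eta (z / 2))
    rw [show (z + 1) / 2 + 1 / 2 = z / 2 + 1 by ring, eta_add_one, eta_add_one, mul_pow, sq, mul_assoc,
      mul_div_mul_left _ _ h24, mul_div_assoc]

lemma differentiableAt_theta {z : ℂ} (hz : 0 < z.im) (i : Fin 3) :
    DifferentiableAt ℂ (fun z => theta z i) z := by
  have hd : ∀ {w : ℂ}, 0 < w.im → DifferentiableAt ℂ ModularForm.eta w :=
    fun h => ModularForm.differentiableAt_eta_of_mem_upperHalfPlaneSet h
  have key : ∀ f : ℂ → ℂ, Differentiable ℂ f → 0 < (f z).im →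
      DifferentiableAt ℂ (fun z => ModularForm.eta z ^ 2 / ModularForm.eta (f z)) z :=
    fun f hf hfz => ((hd hz).pow 2).div ((hd hfz).comp z (hf z)) (ModularForm.eta_ne_zero hfz)
  fin_cases i
  · exact key (fun z => 2 * z) (by fun_prop) (by simpa using hz)
  · exact key (fun z => z / 2) (by fun_prop) (by simpa using hz)
  · refine key (fun z => z / 2 + 1 / 2) (by fun_prop) ?_
    have : (z / 2 + 1 / 2).im = z.im / 2 := by simp
    rw [this]; positivity

/-! ### Invariant norms and decay at the cusps -/

/-- The invariant norm of `θ_i`, raised to the fourth power. -/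
def invNorm (i : Fin 3) (z : ℂ) : ℝ := ![1, 4, 4] i * ‖theta z i‖ ^ 4 * z.im

/-- The weights `1, 4, 4` absorb `√2⁴ = 4`, and `‖rootFactor z‖⁴ = ‖z‖²` cancels the change of the
imaginary part. -/
lemma invNorm_neg_inv {z : ℂ} (hz : 0 < z.im) (i : Fin 3) :
    invNorm i (-1 / z) = invNorm (Equiv.swap 0 1 i) z := by
  obtain ⟨h1, h2, h3⟩ := theta_neg_inv hz
  have h0 : z ≠ 0 := fun h => by simp [h] at hz
  have hn : ‖z‖ ≠ 0 := norm_ne_zero_iff.2 h0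
  have him : (-1 / z).im = z.im / ‖z‖ ^ 2 := by
    rw [neg_div, one_div, neg_im, inv_im, normSq_eq_norm_sq]
    ring
  have hs : ‖(Real.sqrt 2 : ℂ)‖ ^ 4 = 4 := by
    rw [Complex.norm_real, Real.norm_of_nonneg (Real.sqrt_nonneg _),
      show (4 : ℕ) = 2 * 2 by norm_num, pow_mul, Real.sq_sqrt (by norm_num)]
    norm_num
  fin_cases i
  · change 1 * ‖theta (-1 / z) 0‖ ^ 4 * _ = 4 * ‖theta z 1‖ ^ 4 * z.im
    rw [h1, norm_mul, norm_mul, mul_pow, mul_pow, hs, norm_rootFactor_pow_four, him]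
    field_simp
  · change 4 * ‖theta (-1 / z) 1‖ ^ 4 * _ = 1 * ‖theta z 0‖ ^ 4 * z.im
    rw [h2, norm_mul, norm_mul, norm_div, mul_pow, mul_pow, div_pow, hs, norm_rootFactor_pow_four,
      him]
    field_simp
    simp
  · change 4 * ‖theta (-1 / z) 2‖ ^ 4 * _ = 4 * ‖theta z 2‖ ^ 4 * z.im
    rw [h3, norm_mul, mul_pow, norm_rootFactor_pow_four, him]
    field_simp

lemma invNorm_add_one (z : ℂ) (i : Fin 3) :
    invNorm i (z + 1) = invNorm (Equiv.swap 1 2 i) z := by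
  obtain ⟨h1, h2, h3⟩ := theta_add_one z
  have him : (z + 1).im = z.im := by simp
  fin_cases i
  · change 1 * ‖theta (z + 1) 0‖ ^ 4 * _ = 1 * ‖theta z 0‖ ^ 4 * z.im
    rw [h1, him]
  · change 4 * ‖theta (z + 1) 1‖ ^ 4 * _ = 4 * ‖theta z 2‖ ^ 4 * z.im
    rw [h2, him, norm_mul, norm_zeta, one_mul]
  · change 4 * ‖theta (z + 1) 2‖ ^ 4 * _ = 4 * ‖theta z 1‖ ^ 4 * z.im
    rw [h3, him, norm_mul, norm_zeta, one_mul]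

/-! ### Permutation action of `SL₂(ℤ)` on components and parities -/

lemma SL2Z_induction {C : SL(2, ℤ) → Prop} (h1 : C 1)
    (hS : ∀ B, C B → C (ModularGroup.S * B)) (hT : ∀ B, C B → C (ModularGroup.T * B))
    (A : SL(2, ℤ)) : C A := by
  induction A using (FixedDetMatrices.induction_on one_ne_zero) with
  | h0 A a1 a4 _ a6 =>
    rw [FixedDetMatrices.reps_one_id A a1 a4 a6]
    exact h1
  | hS B hb => exact hS B hb
  | hT B hb => exact hT B hb

lemma oddForm_S (i : Fin 3) (a b : ℤ) : OddForm i (-b) a ↔ OddForm (Equiv.swap 0 1 i) a b := by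
  fin_cases i
  · exact Iff.rfl
  · change Odd (-b) ↔ Odd b
    simp
  · change Odd (-b + a) ↔ Odd (a + b)
    rw [add_comm, Int.odd_add, Int.odd_add, even_neg]

lemma oddForm_T (i : Fin 3) (a b : ℤ) : OddForm i (a + b) b ↔ OddForm (Equiv.swap 1 2 i) a b := by
  fin_cases i
  · exact Iff.rfl
  · exact Iff.rfl
  · change Odd (a + b + b) ↔ Odd a
    rw [add_assoc, ← two_mul]
    simp [Int.odd_add]

lemma SL2Z_S_mul (B : SL(2, ℤ)) : (ModularGroup.S * B) 0 0 = -B 1 0 ∧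
    (ModularGroup.S * B) 0 1 = -B 1 1 ∧ (ModularGroup.S * B) 1 0 = B 0 0 ∧
    (ModularGroup.S * B) 1 1 = B 0 1 := by
  simp [Matrix.SpecialLinearGroup.coe_mul, ModularGroup.coe_S, Matrix.mul_apply,
    Fin.sum_univ_two]

lemma SL2Z_T_mul (B : SL(2, ℤ)) : (ModularGroup.T * B) 0 0 = B 0 0 + B 1 0 ∧
    (ModularGroup.T * B) 0 1 = B 0 1 + B 1 1 ∧ (ModularGroup.T * B) 1 0 = B 1 0 ∧
    (ModularGroup.T * B) 1 1 = B 1 1 := by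
  simp [Matrix.SpecialLinearGroup.coe_mul, ModularGroup.coe_T, Matrix.mul_apply,
    Fin.sum_univ_two]

/-- One and the same permutation governs the invariant norms and the parity conditions. This is the
link between the arithmetic domain of `φ_i` and the decay of `θ_i` at cusps. -/
lemma exists_perm_invNorm (γ : SL(2, ℤ)) : ∃ σ : Equiv.Perm (Fin 3),
    (∀ (i : Fin 3) (z : UpperHalfPlane), invNorm i ((γ • z : UpperHalfPlane) : ℂ) =
      invNorm (σ i) z) ∧
    ∀ (i : Fin 3) (a b : ℤ), OddForm i (γ 0 0 * a + γ 0 1 * b) (γ 1 0 * a + γ 1 1 * b) ↔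
      OddForm (σ i) a b := by
  induction γ using SL2Z_induction with
  | h1 => exact ⟨1, by simp, by simp⟩
  | hS B hB =>
    obtain ⟨σ, h1, h2⟩ := hB
    refine ⟨(Equiv.swap 0 1).trans σ, fun i z => ?_, fun i a b => ?_⟩
    · rw [mul_smul, UpperHalfPlane.modular_S_smul, Equiv.trans_apply, ← h1]
      have : (((UpperHalfPlane.mk _ (B • z).im_inv_neg_coe_pos : UpperHalfPlane)) : ℂ) =
          -1 / ((B • z : UpperHalfPlane) : ℂ) := by
        change (-((B • z : UpperHalfPlane) : ℂ))⁻¹ = _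
        rw [inv_neg, neg_div, one_div]
      rw [this, invNorm_neg_inv (B • z).im_pos]
    · obtain ⟨e1, e2, e3, e4⟩ := SL2Z_S_mul B
      rw [e1, e2, e3, e4, Equiv.trans_apply, ← h2, ← oddForm_S]
      ring_nf
  | hT B hB =>
    obtain ⟨σ, h1, h2⟩ := hB
    refine ⟨(Equiv.swap 1 2).trans σ, fun i z => ?_, fun i a b => ?_⟩
    · rw [mul_smul, UpperHalfPlane.modular_T_smul, Equiv.trans_apply, ← h1,
        UpperHalfPlane.coe_vadd, ofReal_one, add_comm, invNorm_add_one]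
    · obtain ⟨e1, e2, e3, e4⟩ := SL2Z_T_mul B
      rw [e1, e2, e3, e4, Equiv.trans_apply, ← h2, ← oddForm_T]
      ring_nf

/-! ### Bounds for the theta series high in the upper half plane and near the cusps -/

lemma nu_nonneg (i : Fin 3) (k : ℕ) : 0 ≤ nu i k := by
  rw [nu]
  split_ifs <;> positivity

lemma div_eight_le_nu_sq (i : Fin 3) (k : ℕ) : (k : ℝ) / 8 ≤ nu i k ^ 2 := by
  rw [nu]
  split_ifs
  · rcases Nat.eq_zero_or_pos k with rfl | h
    · simp
    · have : (1 : ℝ) ≤ k := by exact_mod_cast h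
      nlinarith
  · have : (0 : ℝ) ≤ k := by positivity
    nlinarith

lemma norm_qpow_sq (r : ℝ) (z : ℂ) :
    ‖qpow ((r : ℂ) ^ 2) z‖ = Real.exp (-(2 * Real.pi * r ^ 2 * z.im)) := by
  rw [qpow, Complex.norm_exp, show 2 * (Real.pi : ℂ) * I * (r : ℂ) ^ 2 * z =
    ((2 * Real.pi * r ^ 2 : ℝ) : ℂ) * (I * z) by push_cast; ring, re_ofReal_mul]
  simp

lemma summable_exp_nu (i : Fin 3) {y : ℝ} (hy : 0 < y) :
    Summable fun k => Real.exp (-(2 * Real.pi * nu i k ^ 2 * y)) := by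
  have h : Summable fun k : ℕ => Real.exp (-(Real.pi / 4 * y)) ^ k := by
    refine summable_geometric_of_lt_one (Real.exp_pos _).le ?_
    rw [Real.exp_lt_one_iff]
    have := Real.pi_pos
    have : 0 < Real.pi / 4 * y := by positivity
    linarith
  refine h.of_nonneg_of_le (fun k => (Real.exp_pos _).le) fun k => ?_
  rw [← Real.exp_nat_mul, Real.exp_le_exp]
  have h1 := div_eight_le_nu_sq i k
  have h2 : 0 < 2 * Real.pi * y := by have := Real.pi_pos; positivity
  nlinarith

lemma summable_theta (i : Fin 3) {z : ℂ} (hz : 0 < z.im) :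
    Summable fun k => coef i k * qpow ((nu i k : ℂ) ^ 2) z := by
  refine Summable.of_norm_bounded ((summable_exp_nu i hz).mul_left 2) fun k => ?_
  rw [norm_mul, norm_qpow_sq]
  gcongr
  exact norm_coef_le i k

/-- Comparison with height `1`: for exponents `ν² ≥ m` and `y ≥ 1`, `exp(-2πν²y) ≤ exp(-2πν²)
exp(-2πm(y - 1))`. It is used with `m = 0` for boundedness, `m = 1/16` for components `1` and `2`,
and `m = 1` for `θ_0 - 1`. -/
lemma norm_tsum_qpow_le (i : Fin 3) {m : ℝ} {a : ℕ → ℂ} (ha : ∀ k, ‖a k‖ ≤ 2)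
    (hm : ∀ k, a k ≠ 0 → m ≤ nu i k ^ 2) {z : ℂ} (hz : 1 ≤ z.im) :
    ‖∑' k, a k * qpow ((nu i k : ℂ) ^ 2) z‖ ≤
      (∑' k, 2 * Real.exp (-(2 * Real.pi * nu i k ^ 2 * 1))) * Real.exp (2 * Real.pi * m) *
        Real.exp (-(2 * Real.pi * m * z.im)) := by
  rw [mul_assoc, ← Real.exp_add, ← tsum_mul_right]
  have hs := ((summable_exp_nu i one_pos).mul_left 2).mul_right
    (Real.exp (2 * Real.pi * m + -(2 * Real.pi * m * z.im)))
  refine tsum_of_norm_bounded hs.hasSum fun k => ?_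
  by_cases h0 : a k = 0
  · rw [h0, zero_mul, norm_zero]
    positivity
  · rw [norm_mul, norm_qpow_sq, mul_assoc (2 : ℝ) (Real.exp _), ← Real.exp_add]
    refine mul_le_mul (ha k) ?_ (Real.exp_pos _).le (by norm_num)
    rw [Real.exp_le_exp]
    have h1 := hm k h0
    have h2 := Real.pi_pos
    nlinarith [mul_nonneg (mul_nonneg h2.le (sub_nonneg.2 h1)) (sub_nonneg.2 hz)]

lemma exists_norm_theta_le : ∃ C : ℝ, 0 < C ∧ ∀ (i : Fin 3) (z : ℂ), 1 ≤ z.im → ‖theta z i‖ ≤ C := by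
  have h : ∀ i : Fin 3, ∃ C : ℝ, ∀ z : ℂ, 1 ≤ z.im → ‖theta z i‖ ≤ C := fun i => by
    refine ⟨(∑' k, 2 * Real.exp (-(2 * Real.pi * nu i k ^ 2 * 1))), fun z hz => ?_⟩
    rw [theta_eq_tsum (by linarith)]
    have := norm_tsum_qpow_le i (m := 0) (norm_coef_le i) (fun k _ => sq_nonneg _) hz
    simpa using this
  choose C hC using h
  refine ⟨|C 0| + |C 1| + |C 2| + 1, by positivity, fun i z hz => (hC i z hz).trans ?_⟩
  have h0 := abs_nonneg (C 0)
  have h1 := abs_nonneg (C 1)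
  have h2 := abs_nonneg (C 2)
  fin_cases i <;> simp only [Fin.zero_eta, Fin.mk_one, Fin.reduceFinMk]
  · linarith [le_abs_self (C 0)]
  · linarith [le_abs_self (C 1)]
  · linarith [le_abs_self (C 2)]

lemma exists_norm_theta_le_exp {i : Fin 3} (hi : i ≠ 0) : ∃ C : ℝ, 0 < C ∧
    ∀ z : ℂ, 1 ≤ z.im → ‖theta z i‖ ≤ C * Real.exp (-(Real.pi / 8 * z.im)) := by
  refine ⟨(∑' k, 2 * Real.exp (-(2 * Real.pi * nu i k ^ 2 * 1))) *
    Real.exp (2 * Real.pi * (1 / 16)), ?_, fun z hz => ?_⟩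
  · exact mul_pos (((summable_exp_nu i one_pos).mul_left 2).tsum_pos
      (fun k => by positivity) 0 (by positivity)) (Real.exp_pos _)
  · rw [theta_eq_tsum (by linarith)]
    refine (norm_tsum_qpow_le i (m := 1 / 16) (norm_coef_le i) (fun k _ => ?_) hz).trans_eq ?_
    · rw [nu, if_neg hi]
      have : (0 : ℝ) ≤ k := by positivity
      nlinarith
    · ring_nf

lemma exists_norm_theta_zero_sub_one_le : ∃ C : ℝ, 0 < C ∧
    ∀ z : ℂ, 1 ≤ z.im → ‖theta z 0 - 1‖ ≤ C * Real.exp (-(2 * Real.pi * z.im)) := by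
  refine ⟨(∑' k, 2 * Real.exp (-(2 * Real.pi * nu 0 k ^ 2 * 1))) *
    Real.exp (2 * Real.pi * 1), ?_, fun z hz => ?_⟩
  · exact mul_pos (((summable_exp_nu 0 one_pos).mul_left 2).tsum_pos
      (fun k => by positivity) 0 (by positivity)) (Real.exp_pos _)
  · have h0 : theta z 0 - 1 = ∑' k, (if k = 0 then 0 else coef 0 k) * qpow ((nu 0 k : ℂ) ^ 2) z := by
      have hs := summable_theta 0 (show 0 < z.im by linarith)
      rw [theta_eq_tsum (by linarith), hs.tsum_eq_add_tsum_ite 0]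
      have : coef 0 0 * qpow ((nu 0 0 : ℂ) ^ 2) z = 1 := by simp [coef, nu, qpow]
      rw [this, add_sub_cancel_left]
      refine tsum_congr fun k => ?_
      split_ifs <;> simp
    rw [h0]
    refine (norm_tsum_qpow_le 0 (m := 1) (fun k => ?_) (fun k hk => ?_) hz).trans_eq ?_
    · split_ifs
      · simp
      · exact norm_coef_le 0 k
    · have hk0 : k ≠ 0 := fun h => by simp [h] at hk
      have : (1 : ℝ) ≤ k := by exact_mod_cast Nat.pos_of_ne_zero hk0
      rw [nu, if_pos rfl]
      nlinarith
    · ring_nf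

lemma exp_neg_le_pow {u : ℝ} (hu : 0 < u) (M : ℕ) : Real.exp (-u) ≤ M.factorial * (1 / u) ^ M := by
  have h := Real.pow_div_factorial_le_exp u hu.le M
  rw [Real.exp_neg, one_div, inv_pow]
  have h1 : (0 : ℝ) < M.factorial := by exact_mod_cast M.factorial_pos
  have h2 : 0 < u ^ M / M.factorial := by positivity
  calc (Real.exp u)⁻¹ ≤ (u ^ M / M.factorial)⁻¹ := inv_anti₀ h2 h
    _ = _ := by rw [inv_div, div_eq_mul_inv]

/-- `θ_i` decays faster than any power of the distance when approaching a point of its domain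
inside a cone. -/
theorem exists_theta_decay {x : ℚ} {i : Fin 3} (h : OddForm i x.num x.den) (N : ℕ) :
    ∃ C δ : ℝ, 0 < C ∧ 0 < δ ∧ δ ≤ 1 ∧ ∀ v : ℂ, 0 < v.im → ‖v - x‖ ≤ 2 * v.im → ‖v - x‖ ≤ δ →
      ‖theta v i‖ ≤ C * ‖v - x‖ ^ N := by
  -- Bézout coefficients complete the column `(num, den)` to a matrix `γ` that carries `∞` to `x`.
  obtain ⟨s, t, hst⟩ : IsCoprime x.num (x.den : ℤ) := Int.isCoprime_iff_nat_coprime.2 x.reduced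
  have hdet : (!![x.num, -t; (x.den : ℤ), s]).det = 1 := by
    rw [Matrix.det_fin_two_of]
    linarith
  set γ : SL(2, ℤ) := ⟨!![x.num, -t; (x.den : ℤ), s], hdet⟩ with hγ
  obtain ⟨σ, h1, h2⟩ := exists_perm_invNorm γ
  have e00 : γ 0 0 = x.num := rfl
  have e10 : γ 1 0 = (x.den : ℤ) := rfl
  have e01 : γ 0 1 = -t := rfl
  have e11 : γ 1 1 = s := rfl
  -- The parity condition transported to `∞`, that is to the pair `(1, 0)`, excludes component `0`,
  -- for which `0` would have to be odd. The remaining components decay exponentially.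
  have hσ : σ i ≠ 0 := by
    have := (h2 i 1 0).1 (by simpa [e00, e10] using h)
    intro h0
    rw [h0] at this
    simp [OddForm] at this
  obtain ⟨C, hC0, hC⟩ := exists_norm_theta_le_exp hσ
  set d : ℝ := (x.den : ℝ) with hd
  have hd1 : 1 ≤ d := by rw [hd]; exact_mod_cast x.den_pos
  -- One spare power of `R`: comparing the imaginary parts of `v` and `z` costs a factor `R^{-2}` in
  -- the fourth power of the norm.
  set M := N + 1
  set C' : ℝ := C * (M.factorial * (16 * d ^ 2) ^ M) with hC'
  have hC'0 : 0 < C' := by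
    have : (0 : ℝ) < M.factorial := by exact_mod_cast M.factorial_pos
    positivity
  refine ⟨2 * C', 1 / (2 * d ^ 2), by positivity, by positivity, ?_, fun v hv hcone hvδ => ?_⟩
  · rw [div_le_one (by positivity)]
    nlinarith
  set R := ‖v - x‖ with hR
  have hR0 : 0 < R := by
    rw [hR, norm_pos_iff, sub_ne_zero]
    rintro rfl
    simp at hv
  set z : UpperHalfPlane := γ⁻¹ • ⟨v, hv⟩ with hz
  have hgz : ((γ • z : UpperHalfPlane) : ℂ) = v := by rw [hz, smul_inv_smul]
  have hdz : (x.den : ℂ) * z + s ≠ 0 := by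
    intro h0
    have him := congrArg Complex.im h0
    simp at him
    exact z.im_pos.ne' him
  have hv' : v = ((x.num : ℂ) * z - t) / ((x.den : ℂ) * z + s) := by
    rw [← hgz, UpperHalfPlane.coe_specialLinearGroup_apply, e00, e10, e01, e11]
    simp
    ring
  have hdc : (x.den : ℂ) ≠ 0 := by exact_mod_cast x.den_nz
  have hx : (x : ℂ) = x.num / x.den := by
    rw [eq_div_iff hdc]
    exact cast_mul_den x
  have hst' : (s : ℂ) * x.num + t * x.den = 1 := by exact_mod_cast hst
  have hsub : v - x = -1 / (x.den * ((x.den : ℂ) * z + s)) := by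
    rw [hv', hx, div_sub_div _ _ hdz hdc, div_eq_div_iff (mul_ne_zero hdz hdc)
      (mul_ne_zero hdc hdz)]
    linear_combination -(x.den : ℂ) * ((x.den : ℂ) * z + s) * hst'
  have hRe : R = 1 / (d * ‖(x.den : ℂ) * z + s‖) := by
    rw [hR, hsub, norm_div, norm_mul, norm_neg, norm_one, Complex.norm_natCast]
  have hW : 0 < ‖(x.den : ℂ) * z + s‖ := norm_pos_iff.2 hdz
  have him : v.im = z.im / ‖(x.den : ℂ) * z + s‖ ^ 2 := by
    rw [hv', Complex.div_im, Complex.normSq_eq_norm_sq]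
    rw [← sub_div]
    congr 1
    simp
    have hst'' : (s : ℝ) * x.num + t * x.den = 1 := by exact_mod_cast hst
    linear_combination (z : UpperHalfPlane).im * hst''
  have hy : z.im = v.im / (d ^ 2 * R ^ 2) := by
    rw [him, hRe]
    field_simp
  have hd0 : 0 < d := by linarith
  -- The cone condition `R ≤ 2 Im v` enters here; with `R ≤ δ = 1/(2d²)` it gives `Im z ≥ 1`.
  have hylow : 1 / (2 * d ^ 2 * R) ≤ z.im := by
    rw [hy, div_le_div_iff₀ (by positivity) (by positivity)]
    have : d ^ 2 * R * R ≤ d ^ 2 * R * (2 * v.im) := by gcongr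
    nlinarith
  have hy1 : 1 ≤ z.im := by
    refine le_trans ?_ hylow
    rw [le_div_iff₀ (by positivity)]
    rw [le_div_iff₀ (by positivity)] at hvδ
    linarith
  have hθ : ‖theta z (σ i)‖ ≤ C' * R ^ M := by
    refine (hC z hy1).trans ?_
    rw [hC', mul_assoc]
    gcongr
    refine (exp_neg_le_pow (by have := Real.pi_pos; positivity) M).trans ?_
    rw [mul_assoc, ← mul_pow]
    gcongr
    rw [div_le_iff₀ (by have := Real.pi_pos; positivity)]
    have h5 : 1 ≤ 2 * d ^ 2 * R * z.im := by
      rw [div_le_iff₀ (by positivity)] at hylow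
      linarith
    have h6 := Real.pi_gt_three
    calc (1 : ℝ) ≤ 2 * d ^ 2 * R * z.im := h5
      _ ≤ Real.pi * (2 * d ^ 2 * R * z.im) := le_mul_of_one_le_left (by linarith) (by linarith)
      _ = _ := by rw [show (z.im : ℝ) = ((z : ℂ)).im from rfl]; ring
  have hinv := h1 i z
  rw [hgz] at hinv
  have hc1 : ∀ j : Fin 3, (1 : ℝ) ≤ ![1, 4, 4] j := by
    intro j
    fin_cases j <;> norm_num
  have hc4 : ∀ j : Fin 3, ![(1 : ℝ), 4, 4] j ≤ 4 := by
    intro j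
    fin_cases j <;> norm_num
  have hR1 : R ≤ 1 := hvδ.trans (by rw [div_le_one (by positivity)]; nlinarith)
  have hfin : ‖theta v i‖ ^ 4 ≤ (2 * C' * R ^ N) ^ 4 := by
    have hA : ‖theta v i‖ ^ 4 * v.im ≤ 4 * (C' * R ^ M) ^ 4 * z.im := by
      calc ‖theta v i‖ ^ 4 * v.im = 1 * ‖theta v i‖ ^ 4 * v.im := by ring
        _ ≤ ![1, 4, 4] i * ‖theta v i‖ ^ 4 * v.im := by gcongr; exact hc1 i
        _ = ![1, 4, 4] (σ i) * ‖theta z (σ i)‖ ^ 4 * z.im := hinv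
        _ ≤ 4 * (C' * R ^ M) ^ 4 * z.im := by
          have := z.im_pos
          gcongr
          exact hc4 _
    rw [hy] at hA
    have hB : ‖theta v i‖ ^ 4 ≤ 4 * (C' * R ^ M) ^ 4 / (d ^ 2 * R ^ 2) := by
      rw [le_div_iff₀ (by positivity)]
      have h7 : ‖theta v i‖ ^ 4 * v.im * (d ^ 2 * R ^ 2) ≤ 4 * (C' * R ^ M) ^ 4 * v.im := by
        calc _ ≤ 4 * (C' * R ^ M) ^ 4 * (v.im / (d ^ 2 * R ^ 2)) * (d ^ 2 * R ^ 2) := by gcongr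
          _ = _ := by field_simp
      nlinarith
    refine hB.trans ?_
    rw [div_le_iff₀ (by positivity)]
    have h8 : (C' * R ^ M) ^ 4 = C' ^ 4 * R ^ (4 * N) * R ^ 2 * R ^ 2 := by
      simp only [M]; ring
    rw [h8]
    have h9 : R ^ 2 ≤ 1 := pow_le_one₀ hR0.le hR1
    have h10 : 1 ≤ d ^ 2 := one_le_pow₀ hd1
    calc 4 * (C' ^ 4 * R ^ (4 * N) * R ^ 2 * R ^ 2)
        ≤ 16 * (C' ^ 4 * R ^ (4 * N) * R ^ 2 * 1) := by gcongr; norm_num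
      _ ≤ 16 * (C' ^ 4 * R ^ (4 * N) * R ^ 2 * d ^ 2) := by gcongr
      _ = _ := by ring
  exact le_of_pow_le_pow_left₀ (by norm_num) (by positivity) hfin

/-- Near `0`, inside a cone, every `θ_i` is bounded by a multiple of `|v|^{-1/2}`. -/
theorem exists_theta_growth : ∃ C : ℝ, 0 < C ∧ ∀ (i : Fin 3) (v : ℂ), 0 < v.im →
    ‖v‖ ≤ 2 * v.im → ‖v‖ ≤ 1 / 2 → ‖theta v i‖ ≤ C * ‖v‖ ^ (-(1 / 2) : ℝ) := by
  obtain ⟨C, hC0, hC⟩ := exists_norm_theta_le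
  refine ⟨2 * C, by positivity, fun i v hv hcone hv2 => ?_⟩
  have h0 : v ≠ 0 := fun h => by simp [h] at hv
  have hn : 0 < ‖v‖ := norm_pos_iff.2 h0
  have hw := im_neg_inv_pos hv
  have him : (-1 / v).im = v.im / ‖v‖ ^ 2 := by
    rw [neg_div, one_div, neg_im, inv_im, normSq_eq_norm_sq]
    ring
  have hw1 : 1 ≤ (-1 / v).im := by
    rw [him, le_div_iff₀ (by positivity)]
    nlinarith
  have e : -1 / (-1 / v) = v := by field_simp
  have hinv := invNorm_neg_inv hw i
  rw [e] at hinv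
  have hc1 : (1 : ℝ) ≤ ![1, 4, 4] i := by fin_cases i <;> norm_num
  have hc4 : ∀ j : Fin 3, ![(1 : ℝ), 4, 4] j ≤ 4 := by
    intro j
    fin_cases j <;> norm_num
  have hA : ‖theta v i‖ ^ 4 * v.im ≤ 4 * C ^ 4 * (v.im / ‖v‖ ^ 2) := by
    rw [← him]
    calc ‖theta v i‖ ^ 4 * v.im = 1 * ‖theta v i‖ ^ 4 * v.im := by ring
      _ ≤ ![1, 4, 4] i * ‖theta v i‖ ^ 4 * v.im := by gcongr
      _ = _ := hinv
      _ ≤ 4 * C ^ 4 * (-1 / v).im := by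
        unfold invNorm
        gcongr
        · exact hc4 _
        · exact hC _ _ hw1
  have hB : ‖theta v i‖ ^ 4 ≤ 4 * C ^ 4 / ‖v‖ ^ 2 := by
    rw [le_div_iff₀ (by positivity)]
    have h7 : ‖theta v i‖ ^ 4 * v.im * ‖v‖ ^ 2 ≤ 4 * C ^ 4 * v.im := by
      calc _ ≤ 4 * C ^ 4 * (v.im / ‖v‖ ^ 2) * ‖v‖ ^ 2 := by gcongr
        _ = _ := by field_simp
    nlinarith
  refine le_of_pow_le_pow_left₀ (n := 4) (by norm_num) (by positivity) (hB.trans ?_)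
  have h4 : (‖v‖ ^ (-(1 / 2) : ℝ)) ^ 4 = (‖v‖ ^ 2)⁻¹ := by
    rw [← Real.rpow_natCast, ← Real.rpow_mul hn.le, ← Real.rpow_natCast, ← Real.rpow_neg hn.le]
    norm_num
  rw [mul_pow, h4, div_eq_mul_inv]
  gcongr
  rw [mul_pow]
  gcongr
  norm_num

/-! ### Improper integrals -/

section FTC
variable {E : Type*} [NormedAddCommGroup E] {f f' : ℝ → E} {l m : E}

lemma hasDerivAt_update_of_pos [NormedSpace ℝ E] (h : ∀ t ∈ Set.Ioi (0 : ℝ), HasDerivAt f (f' t) t) :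
    ∀ t ∈ Set.Ioi (0 : ℝ), HasDerivAt (Function.update f 0 l) (f' t) t := by
  intro t ht
  refine (h t ht).congr_of_eventuallyEq ?_
  filter_upwards [eventually_ne_nhds (Set.mem_Ioi.1 ht).ne'] with y hy
  exact Function.update_of_ne hy _ _

lemma continuousWithinAt_update_Ici (h0 : Tendsto f (𝓝[>] 0) (𝓝 l)) :
    ContinuousWithinAt (Function.update f 0 l) (Set.Ici 0) 0 := by
  rw [continuousWithinAt_update_same, Set.Ici_sdiff_left]
  exact h0

lemma tendsto_update_atTop (h1 : Tendsto f atTop (𝓝 m)) :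
    Tendsto (Function.update f 0 l) atTop (𝓝 m) := by
  refine h1.congr' ?_
  filter_upwards [eventually_ne_atTop 0] with t ht
  exact (Function.update_of_ne ht _ _).symm

/-- The primitive need not be continuous at the left endpoint, so it is redefined at `0` by its
one-sided limit. -/
lemma integral_Ioi_of_tendsto [NormedSpace ℝ E] [CompleteSpace E]
    (hd : ∀ t ∈ Set.Ioi (0 : ℝ), HasDerivAt f (f' t) t) (hi : IntegrableOn f' (Set.Ioi 0))
    (h0 : Tendsto f (𝓝[>] 0) (𝓝 l)) (h1 : Tendsto f atTop (𝓝 m)) :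
    ∫ t in Set.Ioi (0 : ℝ), f' t = m - l := by
  have := integral_Ioi_of_hasDerivAt_of_tendsto (continuousWithinAt_update_Ici h0)
    (hasDerivAt_update_of_pos hd) hi (tendsto_update_atTop h1)
  simpa using this

end FTC

lemma integrableOn_Ioi_of_tendsto {f f' : ℝ → ℝ} {l m : ℝ}
    (hd : ∀ t ∈ Set.Ioi (0 : ℝ), HasDerivAt f (f' t) t) (hpos : ∀ t ∈ Set.Ioi (0 : ℝ), 0 ≤ f' t)
    (h0 : Tendsto f (𝓝[>] 0) (𝓝 l)) (h1 : Tendsto f atTop (𝓝 m)) :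
    IntegrableOn f' (Set.Ioi 0) :=
  integrableOn_Ioi_deriv_of_nonneg (continuousWithinAt_update_Ici h0)
    (hasDerivAt_update_of_pos hd) hpos (tendsto_update_atTop h1)

/-! ### The subordination formula -/

/-- The antiderivative of the Gaussian vanishing at `0`. -/
def gaussPrimitive (y : ℝ) : ℝ := ∫ r in (0 : ℝ)..y, Real.exp (-r ^ 2)

lemma hasDerivAt_gaussPrimitive (y : ℝ) : HasDerivAt gaussPrimitive (Real.exp (-y ^ 2)) y := by
  have hc : Continuous fun r : ℝ => Real.exp (-r ^ 2) := by fun_prop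
  exact intervalIntegral.integral_hasDerivAt_right (hc.intervalIntegrable _ _)
    (hc.stronglyMeasurableAtFilter _ _) hc.continuousAt

lemma tendsto_gaussPrimitive_atTop :
    Tendsto gaussPrimitive atTop (𝓝 (Real.sqrt Real.pi / 2)) := by
  have h := integral_gaussian_Ioi 1
  simp only [neg_mul, one_mul, div_one] at h
  rw [← h]
  refine intervalIntegral_tendsto_integral_Ioi 0 ?_ tendsto_id
  have := (integrable_exp_neg_mul_sq one_pos).integrableOn (s := Set.Ioi (0 : ℝ))
  simpa using this

lemma gaussPrimitive_neg (y : ℝ) : gaussPrimitive (-y) = -gaussPrimitive y := by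
  have := intervalIntegral.integral_comp_neg (fun r : ℝ => Real.exp (-r ^ 2)) (a := 0) (b := y)
  simp only [neg_sq, neg_zero] at this
  rw [gaussPrimitive, gaussPrimitive, this, intervalIntegral.integral_symm]

lemma tendsto_gaussPrimitive_atBot :
    Tendsto gaussPrimitive atBot (𝓝 (-(Real.sqrt Real.pi / 2))) := by
  refine (tendsto_gaussPrimitive_atTop.comp tendsto_neg_atBot_atTop).neg.congr fun y => ?_
  simp [gaussPrimitive_neg]

/-- An antiderivative of `a t^{-3/2} exp(-a²/t - b² t)`, up to sign. -/
def subordPrimitive (a b t : ℝ) : ℝ :=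
  -(Real.exp (-(2 * a * b)) * gaussPrimitive (a / Real.sqrt t - b * Real.sqrt t) +
    Real.exp (2 * a * b) * gaussPrimitive (a / Real.sqrt t + b * Real.sqrt t))

/-- Completing the square, `(a/√t ∓ b√t)² = a²/t + b²t ∓ 2ab`, so both summands carry the same
exponential; the contributions of `± b√t` to the inner derivatives cancel. -/
lemma hasDerivAt_subordPrimitive (a b : ℝ) {t : ℝ} (ht : 0 < t) :
    HasDerivAt (subordPrimitive a b)
      (a * ((Real.sqrt t ^ 3)⁻¹ * Real.exp (-(a ^ 2 / t + b ^ 2 * t)))) t := by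
  have hs : 0 < Real.sqrt t := Real.sqrt_pos.2 ht
  have hss : Real.sqrt t ^ 2 = t := Real.sq_sqrt ht.le
  have h1 := Real.hasDerivAt_sqrt ht.ne'
  have h2 := (h1.inv hs.ne').const_mul a
  have h3 := h1.const_mul b
  have d1 := ((hasDerivAt_gaussPrimitive _).comp t (h2.sub h3)).const_mul (Real.exp (-(2 * a * b)))
  have d2 := ((hasDerivAt_gaussPrimitive _).comp t (h2.add h3)).const_mul (Real.exp (2 * a * b))
  have d := (d1.add d2).neg
  refine d.congr_deriv ?_
  simp only [Pi.sub_apply, Pi.add_apply, Pi.inv_apply]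
  have e1 : Real.exp (-(2 * a * b)) *
      Real.exp (-(a * (Real.sqrt t)⁻¹ - b * Real.sqrt t) ^ 2) =
      Real.exp (-(a ^ 2 / t + b ^ 2 * t)) := by
    rw [← Real.exp_add]
    congr 1
    rw [← hss, Real.sqrt_sq hs.le]
    field_simp
    ring
  have e2 : Real.exp (2 * a * b) *
      Real.exp (-(a * (Real.sqrt t)⁻¹ + b * Real.sqrt t) ^ 2) =
      Real.exp (-(a ^ 2 / t + b ^ 2 * t)) := by
    rw [← Real.exp_add]
    congr 1
    rw [← hss, Real.sqrt_sq hs.le]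
    field_simp
    ring
  rw [← mul_assoc, ← mul_assoc, e1, e2]
  field_simp
  ring

lemma tendsto_subordPrimitive_zero {a : ℝ} (ha : 0 < a) (b : ℝ) :
    Tendsto (subordPrimitive a b) (𝓝[>] 0)
      (𝓝 (-(Real.exp (-(2 * a * b)) * (Real.sqrt Real.pi / 2) +
        Real.exp (2 * a * b) * (Real.sqrt Real.pi / 2)))) := by
  have hs : Tendsto Real.sqrt (𝓝[>] 0) (𝓝 0) := by
    have := (Real.continuous_sqrt.tendsto 0).mono_left (nhdsWithin_le_nhds (s := Set.Ioi 0))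
    simpa using this
  have hs' : Tendsto Real.sqrt (𝓝[>] 0) (𝓝[>] 0) := by
    refine tendsto_nhdsWithin_iff.2 ⟨hs, ?_⟩
    filter_upwards [self_mem_nhdsWithin] with t ht
    exact Real.sqrt_pos.2 ht
  have hinv : Tendsto (fun t => a / Real.sqrt t) (𝓝[>] 0) atTop :=
    (tendsto_inv_nhdsGT_zero.comp hs').const_mul_atTop ha
  have hb : Tendsto (fun t => b * Real.sqrt t) (𝓝[>] 0) (𝓝 0) := by
    simpa using hs.const_mul b
  have hm : Tendsto (fun t => a / Real.sqrt t - b * Real.sqrt t) (𝓝[>] 0) atTop := by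
    have := hinv.atTop_add hb.neg
    simpa [sub_eq_add_neg] using this
  exact (((tendsto_gaussPrimitive_atTop.comp hm).const_mul _).add
    ((tendsto_gaussPrimitive_atTop.comp (hinv.atTop_add hb)).const_mul _)).neg

/-- The argument `a/√t - b√t` tends to `-∞` for `b > 0` but to `0` for `b = 0`. The second case is
needed for the constant term of `θ_0`. -/
lemma exists_tendsto_subordPrimitive_atTop (a : ℝ) {b : ℝ} (hb : 0 ≤ b) :
    ∃ m, Tendsto (subordPrimitive a b) atTop (𝓝 m) ∧
      m - -(Real.exp (-(2 * a * b)) * (Real.sqrt Real.pi / 2) +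
        Real.exp (2 * a * b) * (Real.sqrt Real.pi / 2)) =
      Real.sqrt Real.pi * Real.exp (-(2 * a * b)) := by
  have hinv : Tendsto (fun t => a / Real.sqrt t) atTop (𝓝 0) := by
    have := (tendsto_inv_atTop_zero.comp Real.tendsto_sqrt_atTop).const_mul a
    simpa [div_eq_mul_inv] using this
  rcases hb.eq_or_lt with rfl | hb
  · refine ⟨0, ?_, by ring_nf⟩
    have h0 : Tendsto gaussPrimitive (𝓝 0) (𝓝 0) := by
      have := (hasDerivAt_gaussPrimitive 0).continuousAt.tendsto
      simpa [gaussPrimitive] using this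
    have := ((h0.comp hinv).const_mul (Real.exp (-(2 * a * 0)))).add
      ((h0.comp hinv).const_mul (Real.exp (2 * a * 0)))
    have h2 := this.neg
    simp only [mul_zero, add_zero, neg_zero] at h2
    refine h2.congr fun t => ?_
    simp [subordPrimitive]
  · have hbt : Tendsto (fun t => b * Real.sqrt t) atTop atTop :=
      Real.tendsto_sqrt_atTop.const_mul_atTop hb
    have hm : Tendsto (fun t => a / Real.sqrt t - b * Real.sqrt t) atTop atBot := by
      have := hinv.add_atBot (tendsto_neg_atTop_atBot.comp hbt)
      simpa [sub_eq_add_neg] using this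
    refine ⟨_, (((tendsto_gaussPrimitive_atBot.comp hm).const_mul _).add
      ((tendsto_gaussPrimitive_atTop.comp (hinv.add_atTop hbt)).const_mul _)).neg, ?_⟩
    ring

lemma subord_integrable {a b : ℝ} (ha : 0 < a) (hb : 0 ≤ b) :
    IntegrableOn (fun t => (Real.sqrt t ^ 3)⁻¹ * Real.exp (-(a ^ 2 / t + b ^ 2 * t)))
      (Set.Ioi 0) := by
  obtain ⟨m, hm, -⟩ := exists_tendsto_subordPrimitive_atTop a hb
  have := integrableOn_Ioi_of_tendsto (fun t ht => hasDerivAt_subordPrimitive a b ht)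
    (fun t ht => by positivity) (tendsto_subordPrimitive_zero ha b) hm
  refine (Integrable.const_mul this a⁻¹).congr (.of_forall fun t => ?_)
  exact inv_mul_cancel_left₀ ha.ne' _

/-- The subordination formula. -/
lemma subord_integral {a b : ℝ} (ha : 0 < a) (hb : 0 ≤ b) :
    ∫ t in Set.Ioi (0 : ℝ), (Real.sqrt t ^ 3)⁻¹ * Real.exp (-(a ^ 2 / t + b ^ 2 * t)) =
      Real.sqrt Real.pi / a * Real.exp (-(2 * a * b)) := by
  obtain ⟨m, hm, e⟩ := exists_tendsto_subordPrimitive_atTop a hb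
  have := integral_Ioi_of_tendsto (fun t ht => hasDerivAt_subordPrimitive a b ht)
    ((subord_integrable ha hb).const_mul a) (tendsto_subordPrimitive_zero ha b) hm
  rw [e, integral_const_mul] at this
  rw [div_mul_eq_mul_div, eq_div_iff ha.ne']
  linarith

/-! ### The strange series as an integral of the theta function -/

lemma integrableOn_Ioi_of_rpow_bounds {f : ℝ → ℂ} (hc : ContinuousOn f (Set.Ioi 0))
    {C₁ C₂ δ : ℝ} (hδ : 0 < δ) (h0 : ∀ t, 0 < t → t ≤ δ → ‖f t‖ ≤ C₁ * t ^ (-(1 / 2) : ℝ))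
    (h1 : ∀ t, δ < t → ‖f t‖ ≤ C₂ * t ^ (-(3 / 2) : ℝ)) : IntegrableOn f (Set.Ioi 0) := by
  rw [← Set.Ioc_union_Ioi_eq_Ioi hδ.le]
  refine IntegrableOn.union ?_ ?_
  · have hi : IntegrableOn (fun t : ℝ => C₁ * t ^ (-(1 / 2) : ℝ)) (Set.Ioc 0 δ) :=
      ((intervalIntegrable_iff_integrableOn_Ioc_of_le hδ.le).1
        (intervalIntegral.intervalIntegrable_rpow' (by norm_num))).const_mul C₁
    refine Integrable.mono' hi ((hc.mono fun t ht => ht.1).aestronglyMeasurable measurableSet_Ioc) ?_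
    filter_upwards [ae_restrict_mem measurableSet_Ioc] with t ht
    exact h0 t ht.1 ht.2
  · have hi : IntegrableOn (fun t : ℝ => C₂ * t ^ (-(3 / 2) : ℝ)) (Set.Ioi δ) :=
      (integrableOn_Ioi_rpow_of_lt (by norm_num) hδ).const_mul C₂
    refine Integrable.mono' hi
      ((hc.mono fun t ht => hδ.trans ht).aestronglyMeasurable measurableSet_Ioi) ?_
    filter_upwards [ae_restrict_mem measurableSet_Ioi] with t ht
    exact h1 t ht

lemma exists_norm_theta_le_of_le_im (i : Fin 3) {δ : ℝ} (hδ : 0 < δ) :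
    ∃ C : ℝ, ∀ z : ℂ, δ ≤ z.im → ‖theta z i‖ ≤ C := by
  refine ⟨∑' k, 2 * Real.exp (-(2 * Real.pi * nu i k ^ 2 * δ)), fun z hz => ?_⟩
  have hz0 : 0 < z.im := hδ.trans_le hz
  rw [theta_eq_tsum hz0]
  have hs := (summable_exp_nu i hδ).mul_left 2
  refine tsum_of_norm_bounded hs.hasSum fun k => ?_
  rw [norm_mul]
  refine mul_le_mul (norm_coef_le i k) ?_ (norm_nonneg _) zero_le_two
  rw [norm_qpow_sq]
  have := sq_nonneg (nu i k)
  have := Real.pi_pos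
  gcongr

lemma inv_sqrt_pow_three {t : ℝ} (ht : 0 < t) : (Real.sqrt t ^ 3)⁻¹ = t ^ (-(3 / 2) : ℝ) := by
  rw [Real.sqrt_eq_rpow, ← Real.rpow_natCast, ← Real.rpow_mul ht.le, ← Real.rpow_neg ht.le]
  norm_num

lemma continuousOn_theta_vertical (i : Fin 3) (x : ℝ) :
    ContinuousOn (fun t : ℝ => theta (x + I * t) i) (Set.Ioi 0) := by
  intro t ht
  have h1 : ContinuousAt (fun z => theta z i) (x + I * t) :=
    (differentiableAt_theta (by simpa using ht) i).continuousAt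
  have h2 : ContinuousAt (fun t : ℝ => (x : ℂ) + I * t) t := by fun_prop
  exact (ContinuousAt.comp (f := fun t : ℝ => (x : ℂ) + I * t) h1 h2).continuousWithinAt

lemma continuousOn_inv_sqrt_pow_three :
    ContinuousOn (fun t : ℝ => (((Real.sqrt t ^ 3)⁻¹ : ℝ) : ℂ)) (Set.Ioi 0) := by
  refine continuous_ofReal.comp_continuousOn (ContinuousOn.inv₀ (by fun_prop) fun t ht => ?_)
  have := Real.sqrt_pos.2 ht
  positivity

/-- Vanishing to first order at the cusp already reduces `t^{-3/2}` to the integrable `t^{-1/2}`;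
away from the cusp `θ_i` is bounded. -/
lemma integrableOn_theta_vertical {x : ℚ} {i : Fin 3} (h : OddForm i x.num x.den) :
    IntegrableOn (fun t : ℝ => (((Real.sqrt t ^ 3)⁻¹ : ℝ) : ℂ) * theta (x + I * t) i)
      (Set.Ioi 0) := by
  obtain ⟨C, δ, hC, hδ, hδ1, hb⟩ := exists_theta_decay h 1
  obtain ⟨C', hC'⟩ := exists_norm_theta_le_of_le_im i hδ
  have hcont : ContinuousOn
      (fun t : ℝ => (((Real.sqrt t ^ 3)⁻¹ : ℝ) : ℂ) * theta (x + I * t) i) (Set.Ioi 0) := by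
    have := continuousOn_theta_vertical i (x : ℝ)
    rw [ofReal_ratCast] at this
    exact continuousOn_inv_sqrt_pow_three.mul this
  refine integrableOn_Ioi_of_rpow_bounds hcont hδ (C₁ := C) (C₂ := C') ?_ ?_
  · intro t ht htd
    have e : (x : ℂ) + I * t - x = I * t := by ring
    have := hb (x + I * t) (by simpa using ht)
      (by rw [e]; simp [abs_of_pos ht]; linarith) (by rw [e]; simpa [abs_of_pos ht] using htd)
    rw [e] at this
    simp only [norm_mul, norm_I, norm_real, one_mul, Real.norm_eq_abs, abs_of_pos ht, pow_one]
      at this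
    rw [norm_mul, norm_real, Real.norm_of_nonneg (by positivity), inv_sqrt_pow_three ht]
    calc t ^ (-(3 / 2) : ℝ) * ‖theta (x + I * t) i‖ ≤ t ^ (-(3 / 2) : ℝ) * (C * t) := by gcongr
      _ = C * (t ^ (-(3 / 2) : ℝ) * t ^ (1 : ℝ)) := by rw [Real.rpow_one]; ring
      _ = _ := by rw [← Real.rpow_add ht]; norm_num
  · intro t ht
    have ht0 : 0 < t := hδ.trans ht
    rw [norm_mul, norm_real, Real.norm_of_nonneg (by positivity), inv_sqrt_pow_three ht0, mul_comm]
    have := hC' (x + I * t) (by simpa using ht.le)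
    gcongr

lemma qpow_sq_vertical (r x t : ℝ) :
    qpow ((r : ℂ) ^ 2) (x + I * t) =
      qpow ((r : ℂ) ^ 2) x * (Real.exp (-((Real.sqrt (2 * Real.pi) * r) ^ 2 * t)) : ℝ) := by
  rw [mul_pow, Real.sq_sqrt (by positivity), qpow, qpow, ofReal_exp, ← Complex.exp_add]
  congr 1
  push_cast
  linear_combination (2 * (Real.pi : ℂ) * r ^ 2 * t) * I_sq

lemma norm_qpow_sq_real (r x : ℝ) : ‖qpow ((r : ℂ) ^ 2) x‖ = 1 := by
  rw [norm_qpow_sq]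
  simp

lemma summable_exp_nu_linear (i : Fin 3) {c : ℝ} (hc : 0 < c) :
    Summable fun k => Real.exp (-(c * nu i k)) := by
  have h1 : Summable fun k : ℕ => (Real.exp (-(c / 2))) ^ k :=
    summable_geometric_of_lt_one (Real.exp_pos _).le (by rw [Real.exp_lt_one_iff]; linarith)
  refine Summable.of_nonneg_of_le (fun k => (Real.exp_pos _).le) (fun k => ?_) h1
  rw [← Real.exp_nat_mul]
  refine Real.exp_le_exp.2 ?_
  have : (k : ℝ) / 2 ≤ nu i k := by
    rw [nu]
    have : (0 : ℝ) ≤ k := by positivity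
    split_ifs <;> linarith
  nlinarith

/-- The Gaussian regularisation of the vertical integral of `θ_i`. -/
lemma integral_regularized_theta (i : Fin 3) (x : ℝ) {a : ℝ} (ha : 0 < a) :
    ∫ t in Set.Ioi (0 : ℝ), (Real.exp (-(a ^ 2 / t)) : ℂ) *
        ((((Real.sqrt t ^ 3)⁻¹ : ℝ) : ℂ) * theta (x + I * t) i) =
      (Real.sqrt Real.pi / a : ℝ) * ∑' k, coef i k * qpow ((nu i k : ℂ) ^ 2) x *
        (Real.exp (-(2 * a * (Real.sqrt (2 * Real.pi) * nu i k))) : ℝ) := by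
  set b : ℕ → ℝ := fun k => Real.sqrt (2 * Real.pi) * nu i k with hb
  have hb0 : ∀ k, 0 ≤ b k := fun k => mul_nonneg (Real.sqrt_nonneg _) (nu_nonneg i k)
  set w : ℕ → ℝ → ℝ := fun k t =>
    (Real.sqrt t ^ 3)⁻¹ * Real.exp (-(a ^ 2 / t + b k ^ 2 * t)) with hw
  set F : ℕ → ℝ → ℂ := fun k t => coef i k * qpow ((nu i k : ℂ) ^ 2) x * (w k t : ℂ) with hF
  have hw0 : ∀ k t, 0 ≤ w k t := fun k t => by positivity
  have hint : ∀ k, Integrable (F k) (volume.restrict (Set.Ioi 0)) := fun k =>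
    ((subord_integrable ha (hb0 k)).ofReal).const_mul _
  -- Without the factor `exp(-a²/t)` a single term `t^{-3/2} exp(-b²t)` would not be integrable at
  -- `0`. With it the integrals decay exponentially in `ν`, which permits termwise integration.
  have hsum : Summable fun k => ∫ t in Set.Ioi (0 : ℝ), ‖F k t‖ := by
    have h1 : Summable fun k => 2 * (Real.sqrt Real.pi / a *
        Real.exp (-(2 * a * Real.sqrt (2 * Real.pi) * nu i k))) :=
      ((summable_exp_nu_linear i (by positivity)).mul_left _).mul_left _
    refine Summable.of_nonneg_of_le (fun k => integral_nonneg fun t => norm_nonneg _)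
      (fun k => ?_) h1
    have e : ∀ t, ‖F k t‖ = ‖coef i k‖ * w k t := fun t => by
      rw [hF]
      simp only
      rw [norm_mul, norm_mul, norm_qpow_sq_real, norm_real, Real.norm_of_nonneg (hw0 k t), mul_one]
    simp only [e]
    rw [integral_const_mul, subord_integral ha (hb0 k), ← mul_assoc (2 * a)]
    exact mul_le_mul_of_nonneg_right (norm_coef_le i k) (by positivity)
  have h := (hasSum_integral_of_summable_integral_norm hint hsum).tsum_eq
  calc _ = ∫ t in Set.Ioi (0 : ℝ), ∑' k, F k t := by
        refine setIntegral_congr_fun measurableSet_Ioi fun t ht => ?_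
        rw [theta_eq_tsum (by simpa using ht), ← mul_assoc, ← tsum_mul_left]
        refine tsum_congr fun k => ?_
        rw [qpow_sq_vertical]
        simp only [hF, hw, hb]
        rw [neg_add, Real.exp_add]
        push_cast
        ring
    _ = _ := by
        rw [← h, ← tsum_mul_left]
        refine tsum_congr fun k => ?_
        simp only [hF]
        rw [integral_const_mul, integral_complex_ofReal, subord_integral ha (hb0 k)]
        simp only [hb]
        push_cast
        ring

lemma tendsto_div_one_sub_exp {c : ℝ} (hc : 0 < c) :
    Tendsto (fun a : ℝ => a / (1 - Real.exp (-(c * a)))) (𝓝[>] 0) (𝓝 c⁻¹) := by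
  have h1 : HasDerivAt (fun a : ℝ => 1 - Real.exp (-(c * a))) c 0 := by
    have := (((hasDerivAt_id (0 : ℝ)).const_mul c).neg.exp).const_sub 1
    simpa using this
  have h2 := (hasDerivAt_iff_tendsto_slope.1 h1).mono_left
    (nhdsWithin_mono (0 : ℝ) (fun t (ht : 0 < t) => ht.ne'))
  refine (h2.inv₀ hc.ne').congr fun a => ?_
  simp [slope_def_field]

/-- The value of the strange series at a rational point is a vertical integral of `θ_i`. -/
theorem phi_eq_integral {x : ℚ} {i : Fin 3} (h : OddForm i x.num x.den) :
    phi x i = ((Real.sqrt 2 * Real.pi)⁻¹ : ℝ) *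
      ∫ t in Set.Ioi (0 : ℝ), (((Real.sqrt t ^ 3)⁻¹ : ℝ) : ℂ) * theta (x + I * t) i := by
  set c := Real.sqrt (2 * Real.pi) with hc
  have hc0 : 0 < c := Real.sqrt_pos.2 (by positivity)
  have hpi : 0 < Real.sqrt Real.pi := Real.sqrt_pos.2 Real.pi_pos
  -- The regularizing parameter `exp(-c a)` with `c = √(2π)` is chosen so that its power `2ν` is the
  -- factor `exp(-2ab)`, `b = cν`, of the subordination formula. The constant is then `1/(√π c) =
  -- 1/(√2 π)`.
  have hα : Tendsto (fun a : ℝ => Real.exp (-(c * a))) (𝓝[>] 0) (𝓝[<] 1) := by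
    refine tendsto_nhdsWithin_iff.2 ⟨?_, ?_⟩
    · have : Continuous fun a : ℝ => Real.exp (-(c * a)) := by fun_prop
      have := (this.tendsto 0).mono_left (nhdsWithin_le_nhds (s := Set.Ioi 0))
      simpa using this
    · filter_upwards [self_mem_nhdsWithin] with a ha
      have : 0 < c * a := mul_pos hc0 ha
      simpa using this
  have h1 := (tendsto_phi h).comp hα
  have hlim : Tendsto (fun a : ℝ => ∫ t in Set.Ioi (0 : ℝ), (Real.exp (-(a ^ 2 / t)) : ℂ) *
        ((((Real.sqrt t ^ 3)⁻¹ : ℝ) : ℂ) * theta (x + I * t) i)) (𝓝[>] 0)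
      (𝓝 (∫ t in Set.Ioi (0 : ℝ), (((Real.sqrt t ^ 3)⁻¹ : ℝ) : ℂ) * theta (x + I * t) i)) := by
    have hI := integrableOn_theta_vertical h
    refine tendsto_integral_filter_of_dominated_convergence _ ?_ ?_ hI.norm ?_
    · refine .of_forall fun a => AEStronglyMeasurable.mul ?_ hI.1
      refine Measurable.aestronglyMeasurable ?_
      fun_prop
    · filter_upwards with a
      filter_upwards [ae_restrict_mem measurableSet_Ioi] with t ht
      rw [norm_mul]
      refine mul_le_of_le_one_left (norm_nonneg _) ?_
      rw [norm_real, Real.norm_of_nonneg (Real.exp_pos _).le, Real.exp_le_one_iff]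
      have : 0 ≤ a ^ 2 / t := div_nonneg (sq_nonneg _) (le_of_lt ht)
      linarith
    · filter_upwards with t
      have hcont : Continuous fun a : ℝ => (Real.exp (-(a ^ 2 / t)) : ℂ) *
        ((((Real.sqrt t ^ 3)⁻¹ : ℝ) : ℂ) * theta (x + I * t) i) := by fun_prop
      have := (hcont.tendsto 0).mono_left (nhdsWithin_le_nhds (s := Set.Ioi 0))
      simpa using this
  have hdiv := (tendsto_div_one_sub_exp hc0)
  have h2 := (((continuous_ofReal.tendsto _).comp hdiv).const_mul
    ((Real.sqrt Real.pi)⁻¹ : ℂ)).mul hlim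
  refine tendsto_nhds_unique h1 (Tendsto.congr' ?_ (h2.trans_eq ?_))
  · filter_upwards [self_mem_nhdsWithin] with a ha
    have ha0 : (0 : ℝ) < a := ha
    have e := integral_regularized_theta i (x : ℝ) ha0
    rw [ofReal_ratCast] at e
    simp only [Function.comp]
    rw [e, ← mul_assoc]
    congr 1
    · have hsp : (Real.sqrt Real.pi : ℂ) ≠ 0 := by exact_mod_cast hpi.ne'
      have haC : (a : ℂ) ≠ 0 := by exact_mod_cast ha0.ne'
      push_cast
      field_simp
    · refine tsum_congr fun k => ?_
      rw [← Real.exp_mul]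
      congr 3
      ring
  · congr 2
    rw [hc, Real.sqrt_mul zero_le_two]
    have : Real.sqrt Real.pi * Real.sqrt Real.pi = Real.pi := Real.mul_self_sqrt Real.pi_pos.le
    rw [← ofReal_inv, ← ofReal_mul]
    congr 1
    rw [← mul_inv, mul_left_comm, this]

/-! ### Period integrals -/

/-- A continuous function on the positive axis that is bounded and vanishes to infinite order
at `0`. -/
def FlatAtZero (F : ℝ → ℂ) : Prop :=
  ContinuousOn F (Set.Ioi 0) ∧ ∀ N : ℕ, ∃ C : ℝ, ∀ t, 0 < t → ‖F t‖ ≤ C * t ^ N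

lemma flatAtZero_of_bounds {F : ℝ → ℂ} (hc : ContinuousOn F (Set.Ioi 0))
    (h0 : ∀ N : ℕ, ∃ C δ : ℝ, 0 < δ ∧ ∀ t, 0 < t → t ≤ δ → ‖F t‖ ≤ C * t ^ N)
    (h1 : ∀ δ > 0, ∃ C : ℝ, ∀ t, δ ≤ t → ‖F t‖ ≤ C) : FlatAtZero F := by
  refine ⟨hc, fun N => ?_⟩
  obtain ⟨C, δ, hδ, hC⟩ := h0 N
  obtain ⟨B, hB⟩ := h1 δ hδ
  have hB0 : 0 ≤ B := (norm_nonneg _).trans (hB δ le_rfl)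
  refine ⟨max C (B / δ ^ N), fun t ht => ?_⟩
  rcases le_total t δ with h | h
  · exact (hC t ht h).trans (by gcongr; exact le_max_left _ _)
  · calc ‖F t‖ ≤ B := hB t h
      _ = B / δ ^ N * δ ^ N := by field_simp
      _ ≤ B / δ ^ N * t ^ N := by gcongr
      _ ≤ _ := by gcongr; exact le_max_right _ _

lemma le_norm_I_mul_sub {t : ℝ} (x : ℝ) : t ≤ ‖I * t - x‖ := by
  have := (le_abs_self _).trans (abs_im_le_norm (I * t - x : ℂ))
  simpa using this

lemma I_mul_sub_mem_slitPlane {t : ℝ} (ht : 0 < t) (x : ℝ) : I * t - x ∈ slitPlane := by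
  rw [mem_slitPlane_iff]
  right
  simpa using ht.ne'

lemma norm_cpow_neg_le {t p : ℝ} (ht : 0 < t) (hp : 0 ≤ p) (x : ℝ) :
    ‖(I * t - x : ℂ) ^ ((-p : ℝ) : ℂ)‖ ≤ t ^ (-p) := by
  rw [norm_cpow_real]
  exact Real.rpow_le_rpow_of_nonpos ht (le_norm_I_mul_sub x) (by linarith)

lemma continuousOn_cpow_vertical (c : ℂ) (x : ℝ) :
    ContinuousOn (fun t : ℝ => (I * t - x : ℂ) ^ c) (Set.Ioi 0) := by
  intro t ht
  refine ContinuousAt.continuousWithinAt ?_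
  exact ContinuousAt.cpow (by fun_prop) (by fun_prop) (I_mul_sub_mem_slitPlane ht x)

/-- Order `⌈p⌉` of vanishing compensates `t^{-p}` near `0`, and boundedness suffices at infinity.
Since `‖it - x‖ ≥ t`, this one function dominates the integrands for all real `x`, including `x =
0`. -/
lemma FlatAtZero.integrableOn_majorant {F : ℝ → ℂ} (hF : FlatAtZero F) {p : ℝ} (hp : 3 / 2 ≤ p) :
    IntegrableOn (fun t : ℝ => F t * ((t ^ (-p) : ℝ) : ℂ)) (Set.Ioi 0) := by
  obtain ⟨C, hC⟩ := hF.2 ⌈p⌉₊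
  obtain ⟨B, hB⟩ := hF.2 0
  have hC0 : 0 ≤ C := by simpa using (norm_nonneg _).trans (hC 1 one_pos)
  have hB0 : 0 ≤ B := by simpa using (norm_nonneg _).trans (hB 1 one_pos)
  refine integrableOn_Ioi_of_rpow_bounds (C₁ := C) (C₂ := B) (δ := 1) ?_ one_pos ?_ ?_
  · refine hF.1.mul (continuous_ofReal.comp_continuousOn fun t ht => ?_)
    exact (Real.continuousAt_rpow_const _ _ (.inl (ne_of_gt ht))).continuousWithinAt
  · intro t ht ht1
    rw [norm_mul, norm_real, Real.norm_of_nonneg (by positivity)]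
    calc ‖F t‖ * t ^ (-p) ≤ C * t ^ ⌈p⌉₊ * t ^ (-p) := by gcongr; exact hC t ht
      _ = C * t ^ ((⌈p⌉₊ : ℝ) + -p) := by
        rw [Real.rpow_add ht, Real.rpow_natCast, mul_assoc]
      _ ≤ C * t ^ (-(1 / 2) : ℝ) := by
        refine mul_le_mul_of_nonneg_left (Real.rpow_le_rpow_of_exponent_ge ht ht1 ?_) hC0
        have := Nat.le_ceil p
        linarith
  · intro t ht
    have ht0 : 0 < t := one_pos.trans ht
    rw [norm_mul, norm_real, Real.norm_of_nonneg (by positivity)]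
    have h1 := hB t ht0
    rw [pow_zero, mul_one] at h1
    exact mul_le_mul h1 (Real.rpow_le_rpow_of_exponent_le ht.le (by linarith)) (by positivity) hB0

lemma FlatAtZero.norm_mul_cpow_le (F : ℝ → ℂ) {p : ℝ} (hp : 3 / 2 ≤ p) (x : ℝ) {t : ℝ}
    (ht : 0 < t) :
    ‖F t * (I * t - x : ℂ) ^ ((-p : ℝ) : ℂ)‖ ≤ ‖F t * ((t ^ (-p) : ℝ) : ℂ)‖ := by
  rw [norm_mul, norm_mul, norm_real, Real.norm_of_nonneg (by positivity)]
  exact mul_le_mul_of_nonneg_left (norm_cpow_neg_le ht (by linarith) x) (norm_nonneg _)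

lemma FlatAtZero.aestronglyMeasurable {F : ℝ → ℂ} (hF : FlatAtZero F) (c : ℂ) (x : ℝ) :
    AEStronglyMeasurable (fun t : ℝ => F t * (I * t - x : ℂ) ^ c)
      (volume.restrict (Set.Ioi 0)) :=
  (hF.1.mul (continuousOn_cpow_vertical c x)).aestronglyMeasurable measurableSet_Ioi

lemma FlatAtZero.integrableOn {F : ℝ → ℂ} (hF : FlatAtZero F) {p : ℝ} (hp : 3 / 2 ≤ p) (x : ℝ) :
    IntegrableOn (fun t : ℝ => F t * (I * t - x : ℂ) ^ ((-p : ℝ) : ℂ)) (Set.Ioi 0) := by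
  refine Integrable.mono (hF.integrableOn_majorant hp) (hF.aestronglyMeasurable _ x) ?_
  filter_upwards [ae_restrict_mem measurableSet_Ioi] with t ht
  exact FlatAtZero.norm_mul_cpow_le F hp x ht

lemma FlatAtZero.hasDerivAt_integral {F : ℝ → ℂ} (hF : FlatAtZero F) {p : ℝ} (hp : 3 / 2 ≤ p)
    (x : ℝ) :
    HasDerivAt (fun x : ℝ => ∫ t in Set.Ioi (0 : ℝ), F t * (I * t - x : ℂ) ^ ((-p : ℝ) : ℂ))
      ((p : ℂ) * ∫ t in Set.Ioi (0 : ℝ), F t * (I * t - x : ℂ) ^ ((-(p + 1) : ℝ) : ℂ)) x := by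
  have hp1 : 3 / 2 ≤ p + 1 := by linarith
  rw [← integral_const_mul]
  refine (hasDerivAt_integral_of_dominated_loc_of_deriv_le (s := Set.univ) univ_mem
    (bound := fun t => ‖(p : ℂ)‖ * ‖F t * ((t ^ (-(p + 1)) : ℝ) : ℂ)‖)
    (.of_forall fun y => hF.aestronglyMeasurable _ y) (hF.integrableOn hp x)
    (F' := fun y t => (p : ℂ) * (F t * (I * t - y : ℂ) ^ ((-(p + 1) : ℝ) : ℂ)))
    ((hF.aestronglyMeasurable _ x).const_mul _) ?_
    ((hF.integrableOn_majorant hp1).norm.const_mul _) ?_).2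
  · filter_upwards [ae_restrict_mem measurableSet_Ioi] with t ht y _
    rw [norm_mul]
    exact mul_le_mul_of_nonneg_left (FlatAtZero.norm_mul_cpow_le F hp1 y ht) (norm_nonneg _)
  · filter_upwards [ae_restrict_mem measurableSet_Ioi] with t ht y _
    have h1 : HasDerivAt (fun z : ℂ => I * t - z) (-1) (y : ℂ) := by
      simpa using (hasDerivAt_id (y : ℂ)).const_sub (I * t)
    have h2 := ((h1.cpow_const (c := ((-p : ℝ) : ℂ))
      (I_mul_sub_mem_slitPlane ht y)).comp_ofReal).const_mul (F t)
    refine h2.congr_deriv ?_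
    rw [show ((-(p + 1) : ℝ) : ℂ) = ((-p : ℝ) : ℂ) - 1 by push_cast; ring]
    push_cast
    ring

/-- Each derivative in `x` raises the exponent `p` by one and stays within the same family, so the
induction on the order runs over all `p` at once. -/
lemma FlatAtZero.contDiff_integral {F : ℝ → ℂ} (hF : FlatAtZero F) {p : ℝ} (hp : 3 / 2 ≤ p) :
    ContDiff ℝ ∞
      (fun x : ℝ => ∫ t in Set.Ioi (0 : ℝ), F t * (I * t - x : ℂ) ^ ((-p : ℝ) : ℂ)) := by
  rw [contDiff_infty]
  intro n
  induction n generalizing p with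
  | zero =>
    refine contDiff_zero.2 (continuous_iff_continuousAt.2 fun x => ?_)
    exact (hF.hasDerivAt_integral hp x).continuousAt
  | succ n ih =>
    rw [Nat.cast_succ]
    refine contDiff_succ_iff_deriv.2
      ⟨fun x => (hF.hasDerivAt_integral hp x).differentiableAt, by simp, ?_⟩
    rw [funext fun x => (hF.hasDerivAt_integral hp x).deriv]
    exact contDiff_const.mul (ih (by linarith))

lemma FlatAtZero.const_mul {F : ℝ → ℂ} (hF : FlatAtZero F) (c : ℂ) :
    FlatAtZero fun t => c * F t := by
  refine ⟨hF.1.const_mul c, fun N => ?_⟩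
  obtain ⟨C, hC⟩ := hF.2 N
  refine ⟨‖c‖ * C, fun t ht => ?_⟩
  rw [norm_mul, mul_assoc]
  exact mul_le_mul_of_nonneg_left (hC t ht) (norm_nonneg _)

/-! ### Theta functions on the imaginary axis and regularity of `g` -/

lemma periodIntegrand_eq (i : Fin 3) (x t : ℝ) :
    periodIntegrand i x t = I * theta (I * t) i * (I * t - x : ℂ) ^ ((-(3 / 2) : ℝ) : ℂ) := by
  rw [periodIntegrand, show ((-(3 / 2) : ℝ) : ℂ) = -(3 / 2 : ℂ) by push_cast; ring, cpow_neg]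
  ring

lemma continuousOn_theta_I_mul (i : Fin 3) :
    ContinuousOn (fun t : ℝ => theta (I * t) i) (Set.Ioi 0) := by
  simpa using continuousOn_theta_vertical i 0

lemma exists_norm_theta_I_mul_le (i : Fin 3) {δ : ℝ} (hδ : 0 < δ) :
    ∃ C : ℝ, ∀ t : ℝ, δ ≤ t → ‖theta (I * t) i‖ ≤ C := by
  obtain ⟨C, hC⟩ := exists_norm_theta_le_of_le_im i hδ
  exact ⟨C, fun t ht => hC _ (by simpa using ht)⟩

lemma flatAtZero_theta {i : Fin 3} (hi : i ≠ 1) : FlatAtZero fun t => theta (I * t) i := by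
  refine flatAtZero_of_bounds (continuousOn_theta_I_mul i) (fun N => ?_)
    fun δ hδ => exists_norm_theta_I_mul_le i hδ
  have h : OddForm i (0 : ℚ).num (0 : ℚ).den := by
    fin_cases i <;> simp_all [OddForm]
  obtain ⟨C, δ, hC, hδ, -, hb⟩ := exists_theta_decay h N
  refine ⟨C, δ, hδ, fun t ht htd => ?_⟩
  have := hb (I * t) (by simpa using ht) (by simp [abs_of_pos ht]; linarith)
    (by simpa [abs_of_pos ht] using htd)
  simpa [abs_of_pos ht] using this

lemma theta_I_mul_one {t : ℝ} (ht : 0 < t) :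
    theta (I * t) 1 =
      1 / (Real.sqrt 2 : ℂ) * ((t ^ (-(1 / 2) : ℝ) : ℝ) : ℂ) * theta (I * (t⁻¹ : ℝ)) 0 := by
  have hz : 0 < (I * (t⁻¹ : ℝ) : ℂ).im := by simpa using ht
  have h := (theta_neg_inv hz).2.1
  have e : -1 / (I * (t⁻¹ : ℝ) : ℂ) = I * t := by
    have : (t : ℂ) ≠ 0 := by exact_mod_cast ht.ne'
    push_cast
    field_simp
    simp
  rw [e] at h
  rw [h]
  congr 2
  rw [rootFactor, show -I * (I * (t⁻¹ : ℝ)) = ((t⁻¹ : ℝ) : ℂ) by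
    linear_combination -((t⁻¹ : ℝ) : ℂ) * I_sq,
    show (1 / 2 : ℂ) = ((1 / 2 : ℝ) : ℂ) by push_cast; rfl,
    ← ofReal_cpow (by positivity), Real.inv_rpow ht.le, Real.rpow_neg ht.le]

/-- `θ₂` along the imaginary axis, without its singular part at `0`. -/
def thetaOneRegular (t : ℝ) : ℂ :=
  theta (I * t) 1 - 1 / (Real.sqrt 2 : ℂ) * ((t ^ (-(1 / 2) : ℝ) : ℝ) : ℂ)

lemma continuousOn_rpow_ofReal (p : ℝ) :
    ContinuousOn (fun t : ℝ => ((t ^ p : ℝ) : ℂ)) (Set.Ioi 0) :=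
  continuous_ofReal.comp_continuousOn fun _ ht =>
    (Real.continuousAt_rpow_const _ _ (.inl (ne_of_gt ht))).continuousWithinAt

lemma norm_inv_sqrt_two_le : ‖1 / (Real.sqrt 2 : ℂ)‖ ≤ 1 := by
  rw [norm_div, norm_one, norm_real, Real.norm_of_nonneg (Real.sqrt_nonneg _)]
  exact div_le_one_of_le₀ (Real.one_le_sqrt.2 one_le_two) (Real.sqrt_nonneg _)

/-- By inversion the remainder is `(2t)^{-1/2} (θ_0(i/t) - 1)`, which is exponentially small in
`1/t`. -/
lemma flatAtZero_thetaOneRegular : FlatAtZero thetaOneRegular := by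
  refine flatAtZero_of_bounds ?_ (fun N => ?_) fun δ hδ => ?_
  · exact (continuousOn_theta_I_mul 1).sub ((continuousOn_rpow_ofReal _).const_mul _)
  · obtain ⟨C, hC, hb⟩ := exists_norm_theta_zero_sub_one_le
    -- The exponential is bounded by order `N + 1`, one more than required, to pay for `t^{-1/2} ≤
    -- t⁻¹`.
    refine ⟨C * (N + 1).factorial, 1, one_pos, fun t ht ht1 => ?_⟩
    have e : thetaOneRegular t = 1 / (Real.sqrt 2 : ℂ) * ((t ^ (-(1 / 2) : ℝ) : ℝ) : ℂ) *
        (theta (I * (t⁻¹ : ℝ)) 0 - 1) := by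
      rw [thetaOneRegular, theta_I_mul_one ht]
      ring
    have h1 := hb (I * (t⁻¹ : ℝ)) (by simpa using (one_le_inv₀ ht).2 ht1)
    have h2 := exp_neg_le_pow (u := 2 * Real.pi * t⁻¹) (by positivity) (N + 1)
    have h3 : (1 / (2 * Real.pi * t⁻¹)) ^ (N + 1) ≤ t ^ (N + 1) := by
      refine pow_le_pow_left₀ (by positivity) ?_ _
      rw [one_div, mul_inv, inv_inv]
      refine mul_le_of_le_one_left ht.le (inv_le_one_of_one_le₀ ?_)
      linarith [Real.pi_gt_three]
    have him : (I * (t⁻¹ : ℝ) : ℂ).im = t⁻¹ := by simp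
    rw [him] at h1
    have h4 : t ^ (-(1 / 2) : ℝ) ≤ t⁻¹ := by
      rw [← Real.rpow_neg_one]
      exact Real.rpow_le_rpow_of_exponent_ge ht ht1 (by norm_num)
    rw [e, norm_mul, norm_mul, norm_real, Real.norm_of_nonneg (by positivity)]
    calc ‖1 / (Real.sqrt 2 : ℂ)‖ * t ^ (-(1 / 2) : ℝ) * ‖theta (I * (t⁻¹ : ℝ)) 0 - 1‖
        ≤ 1 * t⁻¹ * (C * ((N + 1).factorial * t ^ (N + 1))) := by
          refine mul_le_mul (mul_le_mul norm_inv_sqrt_two_le h4 (by positivity) zero_le_one)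
            (h1.trans (mul_le_mul_of_nonneg_left (h2.trans ?_) hC.le)) (norm_nonneg _)
            (by positivity)
          exact mul_le_mul_of_nonneg_left h3 (by positivity)
      _ = C * (N + 1).factorial * t ^ N := by
          rw [pow_succ]
          field_simp
  · obtain ⟨C, hC⟩ := exists_norm_theta_I_mul_le 1 hδ
    refine ⟨C + 1 * δ ^ (-(1 / 2) : ℝ), fun t ht => (norm_sub_le _ _).trans ?_⟩
    have ht0 : 0 < t := hδ.trans_le ht
    refine add_le_add (hC t ht) ?_
    rw [norm_mul, norm_real, Real.norm_of_nonneg (by positivity)]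
    exact mul_le_mul norm_inv_sqrt_two_le
      (Real.rpow_le_rpow_of_nonpos hδ ht (by norm_num)) (by positivity) zero_le_one

lemma abs_le_norm_I_mul_sub (x t : ℝ) : |x| ≤ ‖(I * t - x : ℂ)‖ := by
  have := abs_re_le_norm (I * t - x : ℂ)
  simpa using this

lemma integrableOn_rpow_mul_cpow {x : ℝ} (hx : x ≠ 0) :
    IntegrableOn (fun t : ℝ => ((t ^ (-(1 / 2) : ℝ) : ℝ) : ℂ) *
      (I * t - x : ℂ) ^ ((-(3 / 2) : ℝ) : ℂ)) (Set.Ioi 0) := by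
  have hx0 : 0 < |x| := abs_pos.2 hx
  refine integrableOn_Ioi_of_rpow_bounds (C₁ := |x| ^ (-(3 / 2) : ℝ)) (C₂ := 1)
    ((continuousOn_rpow_ofReal _).mul (continuousOn_cpow_vertical _ _)) one_pos ?_ ?_
  · intro t ht _
    rw [norm_mul, norm_real, Real.norm_of_nonneg (by positivity), norm_cpow_real, mul_comm]
    exact mul_le_mul_of_nonneg_right (Real.rpow_le_rpow_of_nonpos hx0
      (abs_le_norm_I_mul_sub x t) (by norm_num)) (by positivity)
  · intro t ht
    have ht0 : 0 < t := one_pos.trans ht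
    rw [norm_mul, norm_real, Real.norm_of_nonneg (by positivity)]
    refine mul_le_mul ?_ (norm_cpow_neg_le ht0 (by norm_num) x) (norm_nonneg _) zero_le_one
    exact Real.rpow_le_one_of_one_le_of_nonpos ht.le (by norm_num)

/-- An explicit primitive is `-(2/x) t^{1/2} (it - x)^{-1/2}`: it vanishes at `0` and tends to
`-(2/x) I^{-1/2}` at infinity. This is the source of the pole of `g_1`. -/
lemma integral_rpow_mul_cpow {x : ℝ} (hx : x ≠ 0) :
    ∫ t in Set.Ioi (0 : ℝ), ((t ^ (-(1 / 2) : ℝ) : ℝ) : ℂ) *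
      (I * t - x : ℂ) ^ ((-(3 / 2) : ℝ) : ℂ) = -2 / x * I ^ (-(1 / 2) : ℂ) := by
  have hxC : (x : ℂ) ≠ 0 := by exact_mod_cast hx
  have hx0 : 0 < |x| := abs_pos.2 hx
  have key := integral_Ioi_of_tendsto (l := (0 : ℂ)) (m := -2 / x * I ^ (-(1 / 2) : ℂ))
    (f := fun t : ℝ => -2 / (x : ℂ) *
      (((t ^ (1 / 2 : ℝ) : ℝ) : ℂ) * (I * t - x : ℂ) ^ (-(1 / 2) : ℂ)))
    (f' := fun t : ℝ => ((t ^ (-(1 / 2) : ℝ) : ℝ) : ℂ) *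
      (I * t - x : ℂ) ^ ((-(3 / 2) : ℝ) : ℂ)) ?_ (integrableOn_rpow_mul_cpow hx) ?_ ?_
  · rw [key, sub_zero]
  · intro t ht
    have ht0 : (0 : ℝ) < t := ht
    have h1 : HasDerivAt (fun t : ℝ => ((t ^ (1 / 2 : ℝ) : ℝ) : ℂ))
        (((1 / 2 * t ^ (-(1 / 2) : ℝ) : ℝ)) : ℂ) t := by
      have := (Real.hasDerivAt_rpow_const (p := (1 / 2 : ℝ)) (.inl ht0.ne')).ofReal_comp
      norm_num at this ⊢
      exact this
    have h2 : HasDerivAt (fun z : ℂ => I * z - x) I (t : ℂ) := by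
      simpa using ((hasDerivAt_id (t : ℂ)).const_mul I).sub_const (x : ℂ)
    have h3 := (h2.cpow_const (c := (-(1 / 2) : ℂ)) (I_mul_sub_mem_slitPlane ht0 x)).comp_ofReal
    refine ((h1.mul h3).const_mul (-2 / (x : ℂ))).congr_deriv ?_
    have hu : (I * t - x : ℂ) ≠ 0 := slitPlane_ne_zero (I_mul_sub_mem_slitPlane ht0 x)
    have e1 : (I * t - x : ℂ) ^ (-(1 / 2) : ℂ) =
        (I * t - x : ℂ) ^ ((-(3 / 2) : ℝ) : ℂ) * (I * t - x) := by
      nth_rewrite 3 [← cpow_one (I * t - x : ℂ)]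
      rw [← cpow_add _ _ hu]
      congr 1
      push_cast
      ring
    have e2 : (I * t - x : ℂ) ^ (-(1 / 2) - 1 : ℂ) = (I * t - x : ℂ) ^ ((-(3 / 2) : ℝ) : ℂ) := by
      congr 1
      push_cast
      ring
    have e3 : ((t ^ (1 / 2 : ℝ) : ℝ) : ℂ) = ((t ^ (-(1 / 2) : ℝ) : ℝ) : ℂ) * t := by
      rw [← ofReal_mul]
      congr 1
      rw [← Real.rpow_add_one ht0.ne']
      norm_num
    rw [e2, e1, e3, ofReal_mul]
    push_cast
    field_simp
    ring
  · have h1 : Tendsto (fun t : ℝ => ‖-2 / (x : ℂ)‖ * (t ^ (1 / 2 : ℝ) * |x| ^ (-(1 / 2) : ℝ)))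
        (𝓝[>] 0) (𝓝 0) := by
      have h2 : Continuous fun t : ℝ => t ^ (1 / 2 : ℝ) := Real.continuous_rpow_const (by norm_num)
      have h3 := ((h2.tendsto 0).mono_left (nhdsWithin_le_nhds (s := Set.Ioi 0))).mul_const
        (|x| ^ (-(1 / 2) : ℝ)) |>.const_mul ‖-2 / (x : ℂ)‖
      rw [Real.zero_rpow (by norm_num), zero_mul, mul_zero] at h3
      exact h3
    refine squeeze_zero_norm' ?_ h1
    filter_upwards [self_mem_nhdsWithin] with t ht
    have ht0 : (0 : ℝ) < t := ht
    rw [norm_mul, norm_mul, norm_real, Real.norm_of_nonneg (by positivity),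
      show (-(1 / 2) : ℂ) = ((-(1 / 2) : ℝ) : ℂ) by push_cast; rfl, norm_cpow_real]
    have := Real.rpow_le_rpow_of_nonpos hx0 (abs_le_norm_I_mul_sub x t)
      (show (-(1 / 2) : ℝ) ≤ 0 by norm_num)
    gcongr
  · refine Tendsto.const_mul _ ?_
    have h1 : Tendsto (fun t : ℝ => (I - (x * t⁻¹ : ℝ) : ℂ) ^ (-(1 / 2) : ℂ)) atTop
        (𝓝 (I ^ (-(1 / 2) : ℂ))) := by
      have h2 : Tendsto (fun t : ℝ => (I - (x * t⁻¹ : ℝ) : ℂ)) atTop (𝓝 I) := by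
        have h3 : Tendsto (fun t : ℝ => x * t⁻¹) atTop (𝓝 0) := by
          simpa using tendsto_inv_atTop_zero.const_mul x
        have := ((continuous_ofReal.tendsto 0).comp h3).const_sub I
        simpa using this
      exact h2.cpow tendsto_const_nhds (by simp [mem_slitPlane_iff])
    refine h1.congr' ?_
    filter_upwards [eventually_gt_atTop 0] with t ht
    have htC : (t : ℂ) ≠ 0 := by exact_mod_cast ht.ne'
    rw [show (I * t - x : ℂ) = (t : ℂ) * (I - (x * t⁻¹ : ℝ)) by push_cast; field_simp,
      ofReal_mul_cpow ht, ← mul_assoc, ofReal_cpow ht.le, ← cpow_add _ _ htC]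
    norm_num

lemma I_cpow_neg_half : I ^ (-(1 / 2) : ℂ) = (1 - I) / (Real.sqrt 2 : ℂ) := by
  rw [cpow_def_of_ne_zero I_ne_zero, log_I,
    show (Real.pi : ℂ) / 2 * I * -(1 / 2) = ((-(Real.pi / 4) : ℝ) : ℂ) * I by push_cast; ring,
    exp_mul_I, ← ofReal_cos, ← ofReal_sin, Real.cos_neg, Real.sin_neg, Real.cos_pi_div_four,
    Real.sin_pi_div_four]
  have h2 : (Real.sqrt 2 : ℂ) * (Real.sqrt 2 : ℂ) = 2 := by
    rw [← ofReal_mul, Real.mul_self_sqrt zero_le_two]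
    simp
  have h0 : (Real.sqrt 2 : ℂ) ≠ 0 := by
    exact_mod_cast (Real.sqrt_pos.2 zero_lt_two).ne'
  push_cast
  rw [eq_div_iff h0]
  linear_combination (1 - I) / 2 * h2

lemma periodIntegrand_one_eq (x t : ℝ) :
    periodIntegrand 1 x t =
      I * thetaOneRegular t * (I * t - x : ℂ) ^ ((-(3 / 2) : ℝ) : ℂ) +
      I / (Real.sqrt 2 : ℂ) * (((t ^ (-(1 / 2) : ℝ) : ℝ) : ℂ) *
        (I * t - x : ℂ) ^ ((-(3 / 2) : ℝ) : ℂ)) := by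
  rw [periodIntegrand_eq, thetaOneRegular]
  ring

theorem integrableOn_periodIntegrand (i : Fin 3) (x : ℝ) (h : i = 1 → x ≠ 0) :
    IntegrableOn (periodIntegrand i x) (Set.Ioi 0) := by
  by_cases hi : i = 1
  · subst hi
    rw [funext (periodIntegrand_one_eq x)]
    exact ((flatAtZero_thetaOneRegular.const_mul I).integrableOn le_rfl x).add
      ((integrableOn_rpow_mul_cpow (h rfl)).const_mul _)
  · rw [funext (periodIntegrand_eq i x)]
    exact ((flatAtZero_theta hi).const_mul I).integrableOn le_rfl x

theorem contDiff_g {i : Fin 3} (hi : i ≠ 1) : ContDiff ℝ ∞ fun x : ℝ => g x i := by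
  simp only [g, periodIntegrand_eq]
  exact contDiff_const.mul (((flatAtZero_theta hi).const_mul I).contDiff_integral le_rfl)

/-- The flat part of `θ_1` contributes `r`. The singular part contributes `I/(π(1+I)) · I/√2 ·
(-2/x) · (1-I)/√2 = -I/(πx)`. -/
theorem exists_contDiff_g_one : ∃ r : ℝ → ℂ, ContDiff ℝ ∞ r ∧
    ∀ x : ℝ, x ≠ 0 → g x 1 = r x - I / (Real.pi * x) := by
  have hF := flatAtZero_thetaOneRegular.const_mul I
  refine ⟨_, (contDiff_const (c := I / (Real.pi * (1 + I)))).mul (hF.contDiff_integral le_rfl),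
    fun x hx => ?_⟩
  · simp only [g, periodIntegrand_one_eq]
    rw [integral_add (hF.integrableOn le_rfl x) ((integrableOn_rpow_mul_cpow hx).const_mul _),
      integral_const_mul, integral_rpow_mul_cpow hx, I_cpow_neg_half, mul_add, sub_eq_add_neg]
    have h2 : (Real.sqrt 2 : ℂ) ^ 2 = 2 := by
      rw [← ofReal_pow, Real.sq_sqrt zero_le_two]
      simp
    have h0 : (Real.sqrt 2 : ℂ) ≠ 0 := by
      exact_mod_cast (Real.sqrt_pos.2 zero_lt_two).ne'
    have hpi : (Real.pi : ℂ) ≠ 0 := by exact_mod_cast Real.pi_ne_zero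
    have hxC : (x : ℂ) ≠ 0 := by exact_mod_cast hx
    have h1 : (1 + I : ℂ) ≠ 0 := fun h => by simpa using congrArg re h
    field_simp
    rw [h2]
    linear_combination 2 * I_sq

/-! ### The transformation under `x ↦ -1 / x` -/

/-- The Cayley transform carries the question to the unit disc, where holomorphic functions have
primitives. A global primitive replaces Cauchy's theorem for the contours below. -/
lemma exists_primitive_of_differentiableAt {f : ℂ → ℂ}
    (hf : ∀ z : ℂ, 0 < z.im → DifferentiableAt ℂ f z) :
    ∃ P : ℂ → ℂ, ∀ z : ℂ, 0 < z.im → HasDerivAt P (f z) z := by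
  have hne : ∀ u ∈ Metric.ball (0 : ℂ) 1, 1 - u ≠ 0 := fun u hu h => by
    rw [mem_ball_zero_iff] at hu
    rw [← sub_eq_zero.1 h, norm_one] at hu
    exact lt_irrefl _ hu
  have him : ∀ u ∈ Metric.ball (0 : ℂ) 1, 0 < (I * (1 + u) / (1 - u)).im := fun u hu => by
    have h1 := hne u hu
    have h2 : 0 < normSq (1 - u) := normSq_pos.2 h1
    have h3 : normSq u < 1 := by
      rw [mem_ball_zero_iff] at hu
      rw [normSq_eq_norm_sq]
      nlinarith [norm_nonneg u]
    have : (I * (1 + u) / (1 - u)).im = (1 - normSq u) / normSq (1 - u) := by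
      rw [div_im, normSq_apply u]
      simp only [mul_im, mul_re, I_re, I_im, add_re, add_im, one_re, one_im, sub_re, sub_im]
      ring
    rw [this]
    exact div_pos (by linarith) h2
  have hQ : DifferentiableOn ℂ (fun u => f (I * (1 + u) / (1 - u)) * (2 * I / (1 - u) ^ 2))
      (Metric.ball 0 1) := by
    intro u hu
    have h1 := hne u hu
    refine DifferentiableAt.differentiableWithinAt ?_
    have h2 : DifferentiableAt ℂ (fun u : ℂ => I * (1 + u) / (1 - u)) u :=
      DifferentiableAt.div (by fun_prop) (by fun_prop) h1
    refine (DifferentiableAt.comp u (hf _ (him u hu)) h2).mul ?_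
    exact DifferentiableAt.div (by fun_prop) (by fun_prop) (pow_ne_zero 2 h1)
  obtain ⟨Q, hQ⟩ := hQ.isExactOn_ball
  refine ⟨fun z => Q ((z - I) / (z + I)), fun z hz => ?_⟩
  have hz1 : z + I ≠ 0 := fun h => by
    have := congrArg im h
    simp at this
    linarith
  have hmem : (z - I) / (z + I) ∈ Metric.ball (0 : ℂ) 1 := by
    rw [mem_ball_zero_iff, norm_div, div_lt_one (norm_pos_iff.2 hz1)]
    refine lt_of_pow_lt_pow_left₀ 2 (norm_nonneg _) ?_
    rw [← normSq_eq_norm_sq, ← normSq_eq_norm_sq, normSq_apply, normSq_apply]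
    simp
    nlinarith
  have hd : HasDerivAt (fun z : ℂ => (z - I) / (z + I)) (2 * I / (z + I) ^ 2) z := by
    refine (((hasDerivAt_id z).sub_const I).div ((hasDerivAt_id z).add_const I) hz1).congr_deriv ?_
    simp only [id]
    ring
  refine ((hQ _ hmem).comp z hd).congr_deriv ?_
  have e1 : 1 - (z - I) / (z + I) = 2 * I / (z + I) := by
    field_simp
    ring
  have e2 : I * (1 + (z - I) / (z + I)) / (1 - (z - I) / (z + I)) = z := by
    rw [e1]
    field_simp
    ring
  simp only
  rw [e2, e1]
  field_simp

/-- Truncation to `(ε, ε⁻¹)` with a common `ε` lets the endpoints of the three sides of the contour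
be compared corner by corner. -/
lemma tendsto_sub_integral_Ioi {H h : ℝ → ℂ} (hd : ∀ t ∈ Set.Ioi (0 : ℝ), HasDerivAt H (h t) t)
    (hi : IntegrableOn h (Set.Ioi 0)) :
    Tendsto (fun ε : ℝ => H ε⁻¹ - H ε) (𝓝[>] 0) (𝓝 (∫ t in Set.Ioi (0 : ℝ), h t)) := by
  have hcov : AECover (volume.restrict (Set.Ioi (0 : ℝ))) (𝓝[>] (0 : ℝ))
      fun ε => Set.Ioc ε ε⁻¹ := by
    refine ⟨?_, fun ε => measurableSet_Ioc⟩
    filter_upwards [ae_restrict_mem measurableSet_Ioi] with t ht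
    have h1 : ∀ᶠ ε : ℝ in 𝓝[>] 0, ε < t :=
      (eventually_lt_nhds ht).filter_mono nhdsWithin_le_nhds
    have h2 : ∀ᶠ ε : ℝ in 𝓝[>] 0, t ≤ ε⁻¹ := tendsto_inv_nhdsGT_zero.eventually_ge_atTop t
    filter_upwards [h1, h2] with ε h1 h2
    exact ⟨h1, h2⟩
  refine (hcov.integral_tendsto_of_countably_generated hi).congr' ?_
  have h1 : ∀ᶠ ε : ℝ in 𝓝[>] 0, ε < 1 :=
    (eventually_lt_nhds one_pos).filter_mono nhdsWithin_le_nhds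
  filter_upwards [self_mem_nhdsWithin, h1] with ε hε hε1
  have hε0 : (0 : ℝ) < ε := hε
  have hle : ε ≤ ε⁻¹ := hε1.le.trans ((one_le_inv₀ hε0).2 hε1.le)
  have hsub : Set.Ioc ε ε⁻¹ ⊆ Set.Ioi 0 := fun t ht => hε0.trans ht.1
  rw [Measure.restrict_restrict measurableSet_Ioc, Set.inter_eq_left.2 hsub, ← intervalIntegral.integral_of_le hle]
  refine intervalIntegral.integral_eq_sub_of_hasDerivAt (fun t ht => ?_) ?_
  · rw [Set.uIcc_of_le hle] at ht
    exact hd t (hε0.trans_le ht.1)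
  · rw [intervalIntegrable_iff_integrableOn_Ioc_of_le hle]
    exact hi.mono_set fun t ht => hε0.trans ht.1

lemma mul_cpow_of_arg_add_mem {z w : ℂ} (hz : z ≠ 0) (hw : w ≠ 0)
    (h : z.arg + w.arg ∈ Set.Ioc (-Real.pi) Real.pi) (c : ℂ) : (z * w) ^ c = z ^ c * w ^ c := by
  rw [cpow_def_of_ne_zero (mul_ne_zero hz hw), cpow_def_of_ne_zero hz, cpow_def_of_ne_zero hw,
    log_mul hz hw h, add_mul, Complex.exp_add]

lemma arg_I_mul_ofReal_of_pos {x : ℝ} (hx : 0 < x) : (I * x).arg = Real.pi / 2 := by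
  rw [mul_comm, arg_real_mul _ hx, arg_I]

lemma arg_I_mul_ofReal_of_neg {x : ℝ} (hx : x < 0) : (I * x).arg = -(Real.pi / 2) := by
  rw [show I * (x : ℂ) = ((-x : ℝ) : ℂ) * -I by push_cast; ring, arg_real_mul _ (by linarith),
    arg_neg_I]

lemma rootFactor_eq {v : ℂ} (hv : 0 < v.im) :
    rootFactor v = (1 - I) / (Real.sqrt 2 : ℂ) * v ^ (1 / 2 : ℂ) := by
  have hv0 : v ≠ 0 := fun h => by simp [h] at hv
  have h1 := arg_nonneg_iff.2 hv.le
  have h2 := arg_le_pi v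
  have hpi := Real.pi_pos
  rw [rootFactor, mul_cpow_of_arg_add_mem (neg_ne_zero.2 I_ne_zero) hv0
    (by rw [arg_neg_I]; constructor <;> linarith), ← I_cpow_neg_half,
    cpow_def_of_ne_zero (neg_ne_zero.2 I_ne_zero), cpow_def_of_ne_zero I_ne_zero, log_I, log_neg_I]
  congr 2
  ring

/-- The branch of `(i x v)^{-3/2} v²` on the semicircle above `0` and `x`. -/
lemma cpow_mul_sq_eq {x : ℝ} {v : ℂ} (hv : 0 < v.im) (hxv : 0 < x * v.re) :
    (I * x * v) ^ ((-(3 / 2) : ℝ) : ℂ) * v ^ 2 =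
      (1 + I) / (Real.sqrt 2 : ℂ) * (I * x) ^ ((-(3 / 2) : ℝ) : ℂ) * rootFactor v := by
  have hx : x ≠ 0 := fun h => by simp [h] at hxv
  have hv0 : v ≠ 0 := fun h => by simp [h] at hv
  have hxC : (I * x : ℂ) ≠ 0 := mul_ne_zero I_ne_zero (by exact_mod_cast hx)
  have hpi := Real.pi_pos
  have h1 := arg_nonneg_iff.2 hv.le
  have h2 := arg_le_pi v
  -- No wrap-around occurs: `arg (I x) = -π/2` for `x < 0`, while for `x > 0` the point `v` has
  -- positive real part and so `arg v < π/2`.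
  have harg : (I * x : ℂ).arg + v.arg ∈ Set.Ioc (-Real.pi) Real.pi := by
    rcases lt_or_gt_of_ne hx with h | h
    · rw [arg_I_mul_ofReal_of_neg h]
      constructor <;> linarith
    · rw [arg_I_mul_ofReal_of_pos h]
      have h3 : v.arg < Real.pi / 2 :=
        arg_lt_pi_div_two_iff.2 (.inl (pos_of_mul_pos_right hxv h.le))
      constructor <;> linarith
  have hs : (Real.sqrt 2 : ℂ) * (Real.sqrt 2 : ℂ) = 2 := by
    rw [← ofReal_mul, Real.mul_self_sqrt zero_le_two]
    simp
  have h0 : (Real.sqrt 2 : ℂ) ≠ 0 := by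
    exact_mod_cast (Real.sqrt_pos.2 zero_lt_two).ne'
  have e : v ^ ((-(3 / 2) : ℝ) : ℂ) * v ^ 2 = v ^ (1 / 2 : ℂ) := by
    rw [← cpow_two, ← cpow_add _ _ hv0]
    congr 1
    push_cast
    ring
  rw [mul_cpow_of_arg_add_mem hxC hv0 harg, mul_assoc, e, rootFactor_eq hv]
  have e2 : (1 + I) / (Real.sqrt 2 : ℂ) * ((1 - I) / (Real.sqrt 2 : ℂ)) = 1 := by
    rw [div_mul_div_comm, hs]
    linear_combination -1 / 2 * I_sq
  linear_combination (-(I * x : ℂ) ^ ((-(3 / 2) : ℝ) : ℂ) * v ^ (1 / 2 : ℂ)) * e2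

/-! ### Primitives of the period form near the corners `i∞`, `x` and `0` -/

section Contour

variable {j : Fin 3} {x : ℝ} {P : ℂ → ℂ}

/-- The integrand of the period integral as a function on the upper half plane. -/
def periodForm (j : Fin 3) (x : ℝ) (w : ℂ) : ℂ := theta w j * (w - x) ^ ((-(3 / 2) : ℝ) : ℂ)

lemma sub_ofReal_mem_slitPlane {w : ℂ} (hw : 0 < w.im) (x : ℝ) : w - x ∈ slitPlane := by
  rw [mem_slitPlane_iff]
  right
  simpa using hw.ne'

lemma differentiableAt_periodForm (j : Fin 3) (x : ℝ) {w : ℂ} (hw : 0 < w.im) :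
    DifferentiableAt ℂ (periodForm j x) w :=
  (differentiableAt_theta hw j).mul
    (DifferentiableAt.cpow_const (by fun_prop) (sub_ofReal_mem_slitPlane hw x))

lemma norm_periodForm (j : Fin 3) (x : ℝ) (w : ℂ) :
    ‖periodForm j x w‖ = ‖theta w j‖ * ‖w - x‖ ^ (-(3 / 2) : ℝ) := by
  rw [periodForm, norm_mul, norm_cpow_real]

lemma norm_primitive_sub_le (hP : ∀ w : ℂ, 0 < w.im → HasDerivAt P (periodForm j x w) w)
    {s : Set ℂ} (hs : Convex ℝ s) (him : ∀ w ∈ s, 0 < w.im) {C : ℝ}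
    (hC : ∀ w ∈ s, ‖periodForm j x w‖ ≤ C) {a b : ℂ} (ha : a ∈ s) (hb : b ∈ s) :
    ‖P b - P a‖ ≤ C * ‖b - a‖ :=
  hs.norm_image_sub_le_of_norm_hasDerivWithin_le
    (fun w hw => (hP w (him w hw)).hasDerivWithinAt) hC ha hb

/-- The kernel is `O(ε^{3/2})` at height `ε⁻¹` and the horizontal distance is fixed, so boundedness
of `θ_j` is enough; component `0`, which does not decay at `i∞`, is covered. -/
lemma tendsto_primitive_sub_infty (hP : ∀ w : ℂ, 0 < w.im → HasDerivAt P (periodForm j x w) w) :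
    Tendsto (fun ε : ℝ => P (x + I * (ε⁻¹ : ℝ)) - P (I * (ε⁻¹ : ℝ))) (𝓝[>] 0) (𝓝 0) := by
  obtain ⟨C, hC0, hC⟩ := exists_norm_theta_le
  have hlim : Tendsto (fun ε : ℝ => C * (ε⁻¹) ^ (-(3 / 2) : ℝ) * |x|) (𝓝[>] 0) (𝓝 0) := by
    have h := (tendsto_rpow_neg_atTop (y := 3 / 2) (by norm_num)).comp tendsto_inv_nhdsGT_zero
    simpa using (h.const_mul C).mul_const |x|
  refine squeeze_zero_norm' ?_ hlim
  filter_upwards [tendsto_inv_nhdsGT_zero.eventually_ge_atTop (1 : ℝ)] with ε hε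
  have h := norm_primitive_sub_le hP (convex_halfSpace_im_ge ε⁻¹)
    (fun w hw => lt_of_lt_of_le (by linarith) hw) (C := C * (ε⁻¹) ^ (-(3 / 2) : ℝ))
    (a := I * (ε⁻¹ : ℝ)) (b := x + I * (ε⁻¹ : ℝ)) (fun w hw => ?_) (by simp) (by simp)
  · simpa using h
  · have hw' : ε⁻¹ ≤ w.im := hw
    rw [norm_periodForm]
    refine mul_le_mul (hC j w (hε.trans hw')) ?_ (by positivity) hC0.le
    refine Real.rpow_le_rpow_of_nonpos (by linarith) ?_ (by norm_num)
    have := (le_abs_self _).trans (abs_im_le_norm (w - x : ℂ))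
    simp only [sub_im, ofReal_im, sub_zero] at this
    linarith

lemma convex_cone (x δ : ℝ) :
    Convex ℝ {w : ℂ | 0 < w.im ∧ ‖w - x‖ ≤ 2 * w.im ∧ ‖w - x‖ ≤ δ} := by
  rintro w ⟨hw0, hw1, hw2⟩ z ⟨hz0, hz1, hz2⟩ a b ha hb hab
  have hn : ‖a • w + b • z - x‖ ≤ a * ‖w - x‖ + b * ‖z - x‖ := by
    have e : a • w + b • z - (x : ℂ) = a • (w - x) + b • (z - x) := by
      have : (x : ℂ) = ((a + b : ℝ) : ℂ) * x := by rw [hab]; simp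
      simp only [real_smul]
      nth_rewrite 1 [this]
      push_cast
      ring
    rw [e]
    refine (norm_add_le _ _).trans_eq ?_
    rw [norm_smul, norm_smul, Real.norm_of_nonneg ha, Real.norm_of_nonneg hb]
  have him : (a • w + b • z).im = a * w.im + b * z.im := by simp
  refine ⟨?_, ?_, ?_⟩
  · rw [him]
    rcases ha.eq_or_lt with rfl | ha
    · have : b = 1 := by linarith
      subst this
      linarith
    · have := mul_pos ha hw0
      have := mul_nonneg hb hz0.le
      linarith
  · rw [him]
    nlinarith [mul_le_mul_of_nonneg_left hw1 ha, mul_le_mul_of_nonneg_left hz1 hb]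
  · nlinarith [mul_le_mul_of_nonneg_left hw2 ha, mul_le_mul_of_nonneg_left hz2 hb]

/-- Nontangentially at a point where `θ_j` vanishes to infinite order, a primitive has a limit. -/
lemma tendsto_primitive_sub_cusp {x : ℚ} (h : OddForm j x.num x.den)
    (hP : ∀ w : ℂ, 0 < w.im → HasDerivAt P (periodForm j x w) w) {a b : ℝ → ℂ}
    (ha : Tendsto a (𝓝[>] 0) (𝓝 x)) (hb : Tendsto b (𝓝[>] 0) (𝓝 x))
    (ha' : ∀ᶠ ε in 𝓝[>] (0 : ℝ), 0 < (a ε).im ∧ ‖a ε - x‖ ≤ 2 * (a ε).im)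
    (hb' : ∀ᶠ ε in 𝓝[>] (0 : ℝ), 0 < (b ε).im ∧ ‖b ε - x‖ ≤ 2 * (b ε).im) :
    Tendsto (fun ε : ℝ => P (b ε) - P (a ε)) (𝓝[>] 0) (𝓝 0) := by
  -- Vanishing of order `2 > 3/2` makes the form bounded on the truncated cone at `x`, which is
  -- convex.
  obtain ⟨C, δ, hC, hδ, hδ1, hdec⟩ := exists_theta_decay h 2
  have hlim : Tendsto (fun ε : ℝ => C * ‖b ε - a ε‖) (𝓝[>] 0) (𝓝 0) := by
    simpa using ((hb.sub ha).norm).const_mul C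
  refine squeeze_zero_norm' ?_ hlim
  have hclose : ∀ {u : ℝ → ℂ}, Tendsto u (𝓝[>] 0) (𝓝 (x : ℂ)) →
      ∀ᶠ ε in 𝓝[>] (0 : ℝ), ‖u ε - x‖ ≤ δ := fun {u} hu => by
    have : Tendsto (fun ε => ‖u ε - (x : ℂ)‖) (𝓝[>] (0 : ℝ)) (𝓝 0) := by
      simpa using (hu.sub_const (x : ℂ)).norm
    exact this.eventually_le_const hδ
  filter_upwards [ha', hb', hclose ha, hclose hb] with ε ha1 hb1 ha2 hb2
  refine norm_primitive_sub_le hP (convex_cone x δ) (fun w hw => hw.1) (fun w hw => ?_)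
    ⟨ha1.1, by simpa using ha1.2, by simpa using ha2⟩
    ⟨hb1.1, by simpa using hb1.2, by simpa using hb2⟩
  obtain ⟨h1, h2, h3⟩ := hw
  rw [ofReal_ratCast] at h2 h3
  have hpos : 0 < ‖w - x‖ := by
    have := (le_abs_self _).trans (abs_im_le_norm (w - x : ℂ))
    simp at this
    linarith
  rw [norm_periodForm, ofReal_ratCast]
  calc ‖theta w j‖ * ‖w - x‖ ^ (-(3 / 2) : ℝ)
      ≤ C * ‖w - x‖ ^ 2 * ‖w - x‖ ^ (-(3 / 2) : ℝ) := by gcongr; exact hdec w h1 h2 h3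
    _ = C * ‖w - x‖ ^ (1 / 2 : ℝ) := by
        rw [mul_assoc, ← Real.rpow_natCast, ← Real.rpow_add hpos]
        norm_num
    _ ≤ C * 1 := by
        gcongr
        exact Real.rpow_le_one hpos.le (h3.trans hδ1) (by norm_num)
    _ = C := mul_one C

/-- Near `0` the theta functions are `O(ε^{-1/2})` at height `ε/2`, the kernel is bounded since `x ≠
0`, and the two points are `O(ε)` apart; the difference is `O(ε^{1/2})`, whether or not `θ_j`
vanishes at `0`. -/
lemma tendsto_primitive_sub_zero (hx : x ≠ 0)
    (hP : ∀ w : ℂ, 0 < w.im → HasDerivAt P (periodForm j x w) w) {a b : ℝ → ℂ}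
    (ha : ∀ᶠ ε in 𝓝[>] (0 : ℝ), ε / 2 ≤ (a ε).im ∧ ‖a ε‖ ≤ ε)
    (hb : ∀ᶠ ε in 𝓝[>] (0 : ℝ), ε / 2 ≤ (b ε).im ∧ ‖b ε‖ ≤ ε) :
    Tendsto (fun ε : ℝ => P (b ε) - P (a ε)) (𝓝[>] 0) (𝓝 0) := by
  obtain ⟨C, hC0, hC⟩ := exists_theta_growth
  have hx0 : 0 < |x| := abs_pos.2 hx
  set D := C * (|x| / 2) ^ (-(3 / 2) : ℝ) * 4 with hD
  have hD0 : 0 < C * (|x| / 2) ^ (-(3 / 2) : ℝ) := by positivity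
  have hlim : Tendsto (fun ε : ℝ => D * (ε / 2) ^ (1 / 2 : ℝ)) (𝓝[>] 0) (𝓝 0) := by
    have hc : Continuous fun ε : ℝ => D * (ε / 2) ^ (1 / 2 : ℝ) :=
      continuous_const.mul ((continuous_id.div_const 2).rpow_const fun _ => .inr (by norm_num))
    have := (hc.tendsto 0).mono_left (nhdsWithin_le_nhds (s := Set.Ioi 0))
    rw [zero_div, Real.zero_rpow (by norm_num), mul_zero] at this
    exact this
  refine squeeze_zero_norm' ?_ hlim
  have h1 : ∀ᶠ ε : ℝ in 𝓝[>] 0, ε < min (1 / 2) (|x| / 2) :=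
    (eventually_lt_nhds (by positivity)).filter_mono nhdsWithin_le_nhds
  filter_upwards [ha, hb, h1, self_mem_nhdsWithin] with ε ha hb hε hε0
  have hε0 : (0 : ℝ) < ε := hε0
  obtain ⟨hε1, hε2⟩ := lt_min_iff.1 hε
  have h := norm_primitive_sub_le hP
    ((convex_halfSpace_im_ge (ε / 2)).inter (convex_closedBall (0 : ℂ) ε))
    (fun w hw => lt_of_lt_of_le (by linarith) hw.1)
    (C := C * (ε / 2) ^ (-(1 / 2) : ℝ) * (|x| / 2) ^ (-(3 / 2) : ℝ)) (fun w hw => ?_)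
    ⟨ha.1, mem_closedBall_zero_iff.2 ha.2⟩ ⟨hb.1, mem_closedBall_zero_iff.2 hb.2⟩
  · refine h.trans ?_
    have h2 : ‖b ε - a ε‖ ≤ 4 * (ε / 2) := (norm_sub_le _ _).trans (by linarith [ha.2, hb.2])
    calc _ ≤ C * (ε / 2) ^ (-(1 / 2) : ℝ) * (|x| / 2) ^ (-(3 / 2) : ℝ) * (4 * (ε / 2)) := by gcongr
      _ = D * ((ε / 2) ^ (-(1 / 2) : ℝ) * (ε / 2)) := by rw [hD]; ring
      _ = _ := by
        rw [← Real.rpow_add_one (by positivity)]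
        norm_num
  · obtain ⟨hw1, hw2⟩ := hw
    have hw1 : ε / 2 ≤ w.im := hw1
    rw [mem_closedBall_zero_iff] at hw2
    have hn : ε / 2 ≤ ‖w‖ := hw1.trans ((le_abs_self _).trans (abs_im_le_norm w))
    rw [norm_periodForm]
    refine mul_le_mul ((hC j w (by linarith) (by linarith) (by linarith)).trans ?_) ?_
      (by positivity) (by positivity)
    · exact mul_le_mul_of_nonneg_left
        (Real.rpow_le_rpow_of_nonpos (by positivity) hn (by norm_num)) hC0.le
    · refine Real.rpow_le_rpow_of_nonpos (by positivity) ?_ (by norm_num)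
      have := norm_sub_norm_le (x : ℂ) w
      rw [norm_real, Real.norm_eq_abs, norm_sub_rev] at this
      linarith

end Contour

/-- The image of the vertical line over `-1 / x` under `z ↦ -1 / z`. -/
def semicircle (x τ : ℝ) : ℂ := -1 / (-1 / (x : ℂ) + I * τ)

/-! ### Geometry of the semicircle from `x` to `0` -/

section Semicircle

variable {x : ℝ}

lemma semicircle_eq (hx : x ≠ 0) (τ : ℝ) : semicircle x τ = x / (1 - I * τ * x) := by
  have hxC : (x : ℂ) ≠ 0 := by exact_mod_cast hx
  rw [semicircle, show -1 / (x : ℂ) + I * τ = -((1 - I * τ * x) / x) by field_simp; ring,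
    neg_div_neg_eq, one_div_div]

lemma one_sub_I_mul_ne_zero (τ x : ℝ) : (1 - I * τ * x : ℂ) ≠ 0 := fun h => by
  simpa using congrArg re h

lemma semicircle_eq' (hx : x ≠ 0) (τ : ℝ) :
    semicircle x τ = ⟨x / (1 + (τ * x) ^ 2), τ * x ^ 2 / (1 + (τ * x) ^ 2)⟩ := by
  have hN : (1 + (τ * x) ^ 2) ≠ 0 := by positivity
  rw [semicircle_eq hx, div_eq_iff (one_sub_I_mul_ne_zero τ x)]
  refine Complex.ext ?_ ?_
  · simp only [ofReal_re, mul_re, sub_re, one_re, I_re, ofReal_im, I_im, sub_im, one_im, mul_im]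
    field_simp
    ring
  · simp only [ofReal_re, mul_re, sub_re, one_re, I_re, ofReal_im, I_im, sub_im, one_im, mul_im]
    field_simp
    ring

/-- The positive factor `τ` can be split off the principal power of `v - x`, producing the kernel
`τ^{-3/2}` of the vertical integral. -/
lemma semicircle_sub (hx : x ≠ 0) (τ : ℝ) : semicircle x τ - x = τ * (I * x * semicircle x τ) := by
  have h := div_mul_cancel₀ (x : ℂ) (one_sub_I_mul_ne_zero τ x)
  rw [semicircle_eq hx]
  linear_combination h

lemma semicircle_re (hx : x ≠ 0) (τ : ℝ) : (semicircle x τ).re = x / (1 + (τ * x) ^ 2) := by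
  rw [semicircle_eq' hx]

lemma semicircle_im (hx : x ≠ 0) (τ : ℝ) :
    (semicircle x τ).im = τ * x ^ 2 / (1 + (τ * x) ^ 2) := by
  rw [semicircle_eq' hx]

lemma semicircle_im_pos (hx : x ≠ 0) {τ : ℝ} (hτ : 0 < τ) : 0 < (semicircle x τ).im := by
  rw [semicircle_im hx]
  positivity

lemma mul_semicircle_re_pos (hx : x ≠ 0) (τ : ℝ) : 0 < x * (semicircle x τ).re := by
  rw [semicircle_re hx, ← mul_div_assoc]
  have : 0 < x * x := mul_self_pos.2 hx
  positivity

lemma norm_semicircle_sq (hx : x ≠ 0) (τ : ℝ) :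
    ‖semicircle x τ‖ ^ 2 = x ^ 2 / (1 + (τ * x) ^ 2) := by
  have hN : (0 : ℝ) < 1 + (τ * x) ^ 2 := by positivity
  rw [← normSq_eq_norm_sq, normSq_apply, semicircle_re hx, semicircle_im hx]
  field_simp

lemma hasDerivAt_semicircle (hx : x ≠ 0) (τ : ℝ) :
    HasDerivAt (semicircle x) (I * semicircle x τ ^ 2) τ := by
  have hxC : (x : ℂ) ≠ 0 := by exact_mod_cast hx
  have hne : (-1 / (x : ℂ) + I * τ) ≠ 0 := by
    rw [show -1 / (x : ℂ) + I * τ = -((1 - I * τ * x) / x) by field_simp; ring]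
    exact neg_ne_zero.2 (div_ne_zero (one_sub_I_mul_ne_zero τ x) hxC)
  have h1 : HasDerivAt (fun z : ℂ => -1 / (x : ℂ) + I * z) I (τ : ℂ) := by
    simpa using ((hasDerivAt_id (τ : ℂ)).const_mul I).const_add (-1 / (x : ℂ))
  have h2 := ((hasDerivAt_const (τ : ℂ) (-1 : ℂ)).div h1 hne).comp_ofReal
  refine h2.congr_deriv ?_
  rw [semicircle, div_pow]
  ring

/-- The semicircle meets the real axis perpendicularly, so near `x` it stays in the cone where the
decay estimate is available. -/
lemma norm_semicircle_sub_le (hx : x ≠ 0) {τ : ℝ} (hτ : 0 < τ) (h : τ * |x| ≤ 1) :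
    ‖semicircle x τ - x‖ ≤ 2 * (semicircle x τ).im := by
  have him := semicircle_im_pos hx hτ
  refine le_of_sq_le_sq ?_ (by positivity)
  have hN : (0 : ℝ) < 1 + (τ * x) ^ 2 := by positivity
  have h2 : (τ * x) ^ 2 ≤ 1 := by
    rw [← sq_abs, abs_mul, abs_of_pos hτ]
    exact pow_le_one₀ (by positivity) h
  rw [semicircle_sub hx, norm_mul, norm_mul, norm_mul, norm_I, norm_real, norm_real, one_mul,
    mul_pow, mul_pow, norm_semicircle_sq hx, semicircle_im hx, Real.norm_eq_abs, Real.norm_eq_abs,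
    sq_abs, sq_abs, ← sub_nonneg]
  have : (2 * (τ * x ^ 2 / (1 + (τ * x) ^ 2))) ^ 2 -
      τ ^ 2 * (x ^ 2 * (x ^ 2 / (1 + (τ * x) ^ 2))) =
      (τ * x ^ 2) ^ 2 * (4 - (1 + (τ * x) ^ 2)) / (1 + (τ * x) ^ 2) ^ 2 := by
    field_simp
    ring
  rw [this]
  refine div_nonneg (mul_nonneg (sq_nonneg _) (by linarith)) (sq_nonneg _)

lemma tendsto_semicircle (hx : x ≠ 0) : Tendsto (semicircle x) (𝓝[>] 0) (𝓝 x) := by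
  have h := ((hasDerivAt_semicircle hx 0).continuousAt.tendsto).mono_left
    (nhdsWithin_le_nhds (s := Set.Ioi 0))
  simpa [semicircle_eq hx] using h

lemma semicircle_inv_bounds (hx : x ≠ 0) {ε : ℝ} (hε : 0 < ε) (h : ε ≤ |x|) :
    ε / 2 ≤ (semicircle x ε⁻¹).im ∧ ‖semicircle x ε⁻¹‖ ≤ ε := by
  have h2 : ε ^ 2 ≤ x ^ 2 := by
    rw [← sq_abs x]
    exact pow_le_pow_left₀ hε.le h 2
  have hN : (0 : ℝ) < ε ^ 2 + x ^ 2 := by positivity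
  constructor
  · rw [semicircle_im hx, show ε⁻¹ * x ^ 2 / (1 + (ε⁻¹ * x) ^ 2) = ε * x ^ 2 / (ε ^ 2 + x ^ 2) by
      field_simp, div_le_div_iff₀ two_pos hN]
    nlinarith
  · refine le_of_sq_le_sq ?_ hε.le
    rw [norm_semicircle_sq hx, show x ^ 2 / (1 + (ε⁻¹ * x) ^ 2) = ε ^ 2 * x ^ 2 / (ε ^ 2 + x ^ 2) by
      field_simp, div_le_iff₀ hN]
    nlinarith [sq_nonneg (ε ^ 2)]

end Semicircle

lemma ofReal_cpow_neg_three_half {t : ℝ} (ht : 0 < t) :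
    (t : ℂ) ^ ((-(3 / 2) : ℝ) : ℂ) = ((Real.sqrt t ^ 3)⁻¹ : ℝ) := by
  rw [inv_sqrt_pow_three ht, ofReal_cpow ht.le]

lemma I_mul_cpow_neg_three_half :
    I * I ^ ((-(3 / 2) : ℝ) : ℂ) = (1 - I) / (Real.sqrt 2 : ℂ) := by
  rw [← I_cpow_neg_half]
  nth_rewrite 1 [← cpow_one I]
  rw [← cpow_add _ _ I_ne_zero]
  congr 1
  push_cast
  ring

/-- Cauchy's theorem for `θ_j(w) (w - x)^{-3/2} dw` on the ideal triangle `x`, `0`, `i∞`. The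
vertical side over `x` gives `φ_j(x)`, the imaginary axis gives `g_j(x)`, and the semicircle, mapped
by `z ↦ -1/z` to the vertical line over `-1/x`, gives `φ_i(-1/x)`. -/
theorem phi_neg_inv {x : ℚ} (hx : x ≠ 0) {i j : Fin 3} {m : ℂ} (hm : m ≠ 0)
    (hθ : ∀ z : ℂ, 0 < z.im → theta (-1 / z) i = m * rootFactor z * theta z j)
    (hi : OddForm i (-1 / x).num (-1 / x).den) (hj : OddForm j x.num x.den) :
    ((x : ℂ) / (-I)) ^ (-(3 / 2) : ℂ) * phi (-1 / x) i + m * phi x j = m * g x j := by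
  have hxR : (x : ℝ) ≠ 0 := by exact_mod_cast hx
  obtain ⟨P, hP⟩ := exists_primitive_of_differentiableAt
    fun z hz => differentiableAt_periodForm j x hz
  have hvert : ∀ (y t : ℝ), 0 < t →
      HasDerivAt (fun t : ℝ => P (y + I * t)) (I * periodForm j x (y + I * t)) t := by
    intro y t ht
    have h1 : HasDerivAt (fun z : ℂ => (y : ℂ) + I * z) I (t : ℂ) := by
      simpa using ((hasDerivAt_id (t : ℂ)).const_mul I).const_add (y : ℂ)
    refine (HasDerivAt.comp (t : ℂ) (hP (y + I * t) (by simpa using ht)) h1).comp_ofReal.congr_deriv ?_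
    ring
  have eA : ∀ t ∈ Set.Ioi (0 : ℝ), I * periodForm j x ((x : ℝ) + I * t) =
      (1 - I) / (Real.sqrt 2 : ℂ) * ((((Real.sqrt t ^ 3)⁻¹ : ℝ) : ℂ) * theta (x + I * t) j) := by
    intro t ht
    rw [periodForm, add_sub_cancel_left, mul_comm I (t : ℂ), ofReal_mul_cpow ht,
      ofReal_cpow_neg_three_half ht, ← I_mul_cpow_neg_three_half, ofReal_ratCast]
    ring
  have iA : IntegrableOn (fun t : ℝ => I * periodForm j x ((x : ℝ) + I * t)) (Set.Ioi 0) :=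
    IntegrableOn.congr_fun ((integrableOn_theta_vertical hj).const_mul _) (fun t ht => (eA t ht).symm)
      measurableSet_Ioi
  have lA := tendsto_sub_integral_Ioi (fun t ht => hvert x t ht) iA
  rw [setIntegral_congr_fun measurableSet_Ioi eA, integral_const_mul] at lA
  have eB : ∀ t ∈ Set.Ioi (0 : ℝ), I * periodForm j x ((0 : ℝ) + I * t) = periodIntegrand j x t := by
    intro t _
    rw [periodForm, periodIntegrand_eq, ofReal_zero, zero_add, mul_assoc]
  have iB : IntegrableOn (fun t : ℝ => I * periodForm j x ((0 : ℝ) + I * t)) (Set.Ioi 0) :=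
    (integrableOn_periodIntegrand j x fun _ => hxR).congr_fun (fun t ht => (eB t ht).symm)
      measurableSet_Ioi
  have lB := tendsto_sub_integral_Ioi (fun t ht => hvert 0 t ht) iB
  rw [setIntegral_congr_fun measurableSet_Ioi eB] at lB
  -- The ratio of the form on the semicircle to the integrand over `-1/x`; the weight `(I x)^{-3/2}`
  -- is what remains after the root factor of `θ` cancels against `dw` and the kernel.
  set c : ℂ := m⁻¹ * (I * ((1 + I) / (Real.sqrt 2 : ℂ) * (I * x) ^ ((-(3 / 2) : ℝ) : ℂ))) with hc
  have eC : ∀ t ∈ Set.Ioi (0 : ℝ),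
      periodForm j x (semicircle x t) * (I * semicircle x t ^ 2) =
      c * ((((Real.sqrt t ^ 3)⁻¹ : ℝ) : ℂ) * theta ((-1 / x : ℚ) + I * t) i) := by
    intro t ht
    have him := semicircle_im_pos hxR ht
    have h1 := cpow_mul_sq_eq him (mul_semicircle_re_pos hxR t)
    have h2 := hθ _ him
    have h3 : -1 / semicircle x t = (-1 / x : ℚ) + I * t := by
      rw [semicircle, neg_div, neg_div, one_div, one_div, inv_neg, neg_neg, inv_inv]
      push_cast
      ring
    rw [h3] at h2
    rw [h2, periodForm, semicircle_sub hxR, ofReal_mul_cpow ht, ofReal_cpow_neg_three_half ht, hc]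
    rw [ofReal_ratCast] at h1 ⊢
    linear_combination (theta (semicircle x t) j * (((Real.sqrt t ^ 3)⁻¹ : ℝ) : ℂ) * I) * h1 -
      (theta (semicircle x t) j * (((Real.sqrt t ^ 3)⁻¹ : ℝ) : ℂ) * I * ((1 + I) /
        (Real.sqrt 2 : ℂ)) * (I * x) ^ ((-(3 / 2) : ℝ) : ℂ) * rootFactor (semicircle x t)) *
        inv_mul_cancel₀ hm
  have iC : IntegrableOn (fun t : ℝ => periodForm j x (semicircle x t) *
      (I * semicircle x t ^ 2)) (Set.Ioi 0) :=
    IntegrableOn.congr_fun ((integrableOn_theta_vertical hi).const_mul _) (fun t ht => (eC t ht).symm)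
      measurableSet_Ioi
  have lC := tendsto_sub_integral_Ioi (H := fun t => P (semicircle x t)) (fun t ht =>
    (HasDerivAt.comp_of_eq t (hP _ (semicircle_im_pos hxR ht)) (hasDerivAt_semicircle hxR t) rfl)) iC
  rw [setIntegral_congr_fun measurableSet_Ioi eC, integral_const_mul] at lC
  have hsmall : ∀ y : ℝ, 0 < y → ∀ᶠ ε : ℝ in 𝓝[>] 0, ε < y := fun y hy =>
    (eventually_lt_nhds hy).filter_mono nhdsWithin_le_nhds
  have hx0 : 0 < |(x : ℝ)| := abs_pos.2 hxR
  have z1 := tendsto_primitive_sub_infty hP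
  have z2 : Tendsto (fun ε : ℝ => P (semicircle x ε) - P ((x : ℝ) + I * ε)) (𝓝[>] 0) (𝓝 0) := by
    refine tendsto_primitive_sub_cusp hj hP ?_ ?_ ?_ ?_
    · have hc : Continuous fun ε : ℝ => (((x : ℝ) : ℂ) + I * ε) := by fun_prop
      have := (hc.tendsto 0).mono_left (nhdsWithin_le_nhds (s := Set.Ioi 0))
      simpa using this
    · simpa using tendsto_semicircle hxR
    · filter_upwards [self_mem_nhdsWithin] with ε hε
      have hε : (0 : ℝ) < ε := hε
      refine ⟨by simpa using hε, ?_⟩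
      simp [abs_of_pos hε]
      linarith
    · filter_upwards [self_mem_nhdsWithin, hsmall |(x : ℝ)|⁻¹ (by positivity)] with ε hε hε1
      refine ⟨semicircle_im_pos hxR hε, ?_⟩
      have := norm_semicircle_sub_le hxR hε (by
        rw [← inv_mul_cancel₀ hx0.ne']
        gcongr)
      simpa using this
  have z3 : Tendsto (fun ε : ℝ => P (semicircle x ε⁻¹) - P ((0 : ℝ) + I * ε)) (𝓝[>] 0) (𝓝 0) := by
    refine tendsto_primitive_sub_zero hxR hP ?_ ?_
    · filter_upwards [self_mem_nhdsWithin] with ε hε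
      have hε : (0 : ℝ) < ε := hε
      simp [abs_of_pos hε]
      linarith
    · filter_upwards [self_mem_nhdsWithin, hsmall _ hx0] with ε hε hε1
      exact semicircle_inv_bounds hxR hε hε1.le
  -- The alternating sum of the truncated sides regroups into the three corner differences, each of
  -- which tends to `0`.
  have key := tendsto_nhds_unique ((lA.sub lB).sub lC) (((z1.add z2).sub z3).congr fun ε => by
    simp only [ofReal_zero, zero_add]
    ring)
  have pA := phi_eq_integral hj
  have pC := phi_eq_integral hi
  set A := ∫ t in Set.Ioi (0 : ℝ), (((Real.sqrt t ^ 3)⁻¹ : ℝ) : ℂ) * theta (x + I * t) j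
  set D := ∫ t in Set.Ioi (0 : ℝ),
    (((Real.sqrt t ^ 3)⁻¹ : ℝ) : ℂ) * theta ((-1 / x : ℚ) + I * t) i
  rw [pA, pC, g]
  set B := ∫ t in Set.Ioi (0 : ℝ), periodIntegrand j x t
  have hB : B = (1 - I) / (Real.sqrt 2 : ℂ) * A - c * D := by linear_combination -key
  have h0 : (Real.sqrt 2 : ℂ) ≠ 0 := by
    exact_mod_cast (Real.sqrt_pos.2 zero_lt_two).ne'
  have hpi : (Real.pi : ℂ) ≠ 0 := by exact_mod_cast Real.pi_ne_zero
  have h1 : (1 + I : ℂ) ≠ 0 := fun h => by simpa using congrArg re h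
  have e1 : (x : ℂ) / -I = I * x := by
    rw [div_eq_iff (neg_ne_zero.2 I_ne_zero)]
    linear_combination (x : ℂ) * I_sq
  have e2 : (-(3 / 2) : ℂ) = ((-(3 / 2) : ℝ) : ℂ) := by push_cast; ring
  rw [hB, hc, e1, e2]
  generalize (I * x : ℂ) ^ ((-(3 / 2) : ℝ) : ℂ) = X
  push_cast
  field_simp
  linear_combination (X * D * (1 + I) + m * A) * I_sq

/-! ### The generators of `SL₂(ℤ)` -/

lemma add_one_mem_strangeDomain_iff (x : ℚ) (i : Fin 3) :
    x + 1 ∈ strangeDomain i ↔ x ∈ strangeDomain (Equiv.swap 1 2 i) := by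
  have hd : (x.den : ℤ) ≠ 0 := by exact_mod_cast x.den_ne_zero
  have hc : IsCoprime (x.num + x.den) (x.den : ℤ) := by
    have : IsCoprime x.num (x.den : ℤ) := Int.isCoprime_iff_nat_coprime.2 x.reduced
    simpa using this.add_mul_right_left 1
  have e : x + 1 = ((x.num + x.den : ℤ) : ℚ) / (x.den : ℤ) := by
    have hq : (x.den : ℚ) ≠ 0 := by exact_mod_cast x.den_ne_zero
    push_cast
    rw [add_div, div_self hq, Rat.num_div_den]
  rw [e, mem_strangeDomain_div hc hd, oddForm_T, mem_strangeDomain_iff]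

lemma neg_one_div_mem_strangeDomain_iff {x : ℚ} (hx : x ≠ 0) (i : Fin 3) :
    -1 / x ∈ strangeDomain i ↔ x ∈ strangeDomain (Equiv.swap 0 1 i) := by
  have hn : x.num ≠ 0 := Rat.num_ne_zero.2 hx
  have hc : IsCoprime (-x.den : ℤ) x.num := by
    have : IsCoprime x.num (x.den : ℤ) := Int.isCoprime_iff_nat_coprime.2 x.reduced
    exact this.symm.neg_left
  have e : -1 / x = ((-x.den : ℤ) : ℚ) / x.num := by
    nth_rewrite 1 [← Rat.num_div_den x]
    rw [div_div_eq_mul_div]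
    push_cast
    ring
  rw [e, mem_strangeDomain_div hc hn, oddForm_S, mem_strangeDomain_iff]

/-- Each row has a single nonzero entry, placed by the transposition that moves the parity
conditions; the domain conditions over all `j` thereby reduce to one `j`. -/
lemma MT_apply_ne_zero_iff (i j : Fin 3) : MT i j ≠ 0 ↔ j = Equiv.swap 1 2 i := by
  have h1 := zeta_ne_zero 12
  have h2 := zeta_ne_zero 24
  fin_cases i <;> fin_cases j <;> simp [MT, h1, h2, Equiv.swap_apply_def]

lemma MS_apply_ne_zero_iff (i j : Fin 3) : MS i j ≠ 0 ↔ j = Equiv.swap 0 1 i := by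
  fin_cases i <;> fin_cases j <;> simp [MS, Equiv.swap_apply_def]

lemma isUnit_det_MT : IsUnit MT.det := by
  have h1 := zeta_ne_zero 12
  have h2 := zeta_ne_zero 24
  simp [MT, Matrix.det_fin_three, h1, h2]

lemma isUnit_det_MS : IsUnit MS.det := by
  simp [MS, Matrix.det_fin_three]

lemma mulVec_of_monomial {ρ : Matrix (Fin 3) (Fin 3) ℂ} {i k : Fin 3}
    (h : ∀ j, ρ i j ≠ 0 ↔ j = k) (v : Fin 3 → ℂ) : ρ.mulVec v i = ρ i k * v k := by
  rw [Matrix.mulVec, dotProduct, Finset.sum_eq_single k]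
  · intro j _ hj
    have : ρ i j = 0 := by
      by_contra h'
      exact hj ((h j).1 h')
    rw [this, zero_mul]
  · simp

lemma mul_apply_of_monomial {M ρ : Matrix (Fin 3) (Fin 3) ℂ} {i k : Fin 3}
    (h : ∀ j, M i j ≠ 0 ↔ j = k) (l : Fin 3) : (M * ρ) i l = M i k * ρ k l :=
  mulVec_of_monomial h fun j => ρ j l

lemma phi_add_one_eq (x : ℚ) (i : Fin 3) :
    phi (x + 1) i = MT i (Equiv.swap 1 2 i) * phi x (Equiv.swap 1 2 i) := by
  obtain ⟨h0, h1, h2⟩ := phi_add_one x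
  fin_cases i
  · simpa [MT, Equiv.swap_apply_def] using h0
  · simpa [MT] using h1
  · simpa [MT] using h2

lemma theta_neg_inv_eq {z : ℂ} (hz : 0 < z.im) (i : Fin 3) :
    theta (-1 / z) i =
      MS i (Equiv.swap 0 1 i) * rootFactor z * theta z (Equiv.swap 0 1 i) := by
  obtain ⟨h0, h1, h2⟩ := theta_neg_inv hz
  fin_cases i
  · simpa [MS] using h0
  · simpa [MS] using h1
  · simpa [MS, Equiv.swap_apply_def] using h2

lemma phi_neg_one_div_eq {x : ℚ} (hx : x ≠ 0) {i : Fin 3} (h : -1 / x ∈ strangeDomain i) :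
    ((x : ℂ) / (-I)) ^ (-(3 / 2) : ℂ) * phi (-1 / x) i +
      MS i (Equiv.swap 0 1 i) * phi x (Equiv.swap 0 1 i) =
      MS i (Equiv.swap 0 1 i) * g x (Equiv.swap 0 1 i) :=
  phi_neg_inv hx ((MS_apply_ne_zero_iff i _).2 rfl) (fun _ hz => theta_neg_inv_eq hz i)
    ((mem_strangeDomain_iff _ _).1 h)
    ((mem_strangeDomain_iff _ _).1 ((neg_one_div_mem_strangeDomain_iff hx i).1 h))

/-! ### The automorphy factor -/

/-- The value of `(i r)^{-3/2}` for real `r`. -/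
def rotPow (r : ℝ) : ℂ := (I * r) ^ (-(3 / 2) : ℂ)

/-- The value of `rotPow` at `±1`, according to the sign of `r`. -/
def rotSign (r : ℝ) : ℂ := if 0 < r then rotPow 1 else rotPow (-1)

lemma rotPow_eq {r : ℝ} (hr : r ≠ 0) :
    rotPow r = ((|r| ^ (-(3 / 2) : ℝ) : ℝ) : ℂ) * rotSign r := by
  have e : (-(3 / 2) : ℂ) = ((-(3 / 2) : ℝ) : ℂ) := by push_cast; ring
  rw [ofReal_cpow (abs_nonneg r), ← e, rotSign]
  split_ifs with h
  · rw [rotPow, rotPow, ← ofReal_mul_cpow (abs_pos.2 hr), abs_of_pos h]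
    congr 1
    push_cast
    ring
  · have h' : r < 0 := lt_of_le_of_ne (not_lt.1 h) hr
    rw [rotPow, rotPow, ← ofReal_mul_cpow (abs_pos.2 hr), abs_of_neg h']
    congr 1
    push_cast
    ring

lemma rotPow_one_mul_rotPow_neg_one : rotPow 1 * rotPow (-1) = 1 := by
  rw [rotPow, rotPow, ofReal_one, ofReal_neg, ofReal_one, mul_one, mul_neg_one,
    cpow_def_of_ne_zero I_ne_zero, cpow_def_of_ne_zero (neg_ne_zero.2 I_ne_zero), log_I, log_neg_I,
    ← Complex.exp_add, ← Complex.exp_zero]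
  congr 1
  ring

/-- Away from `0` it is `|r|^{-3/2}` times a locally constant phase. -/
lemma contDiffAt_rotPow {r : ℝ} (hr : r ≠ 0) : ContDiffAt ℝ ∞ rotPow r := by
  have h1 : ContDiffAt ℝ ∞ (fun r : ℝ => |r| ^ (-(3 / 2) : ℝ)) r :=
    (contDiffAt_abs hr).rpow_const_of_ne (abs_pos.2 hr).ne'
  have h2 : ContDiffAt ℝ ∞ (fun t : ℝ => ((|t| ^ (-(3 / 2) : ℝ) : ℝ) : ℂ) * rotSign r) r :=
    (ofRealCLM.contDiff.contDiffAt.comp r h1).mul contDiffAt_const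
  refine h2.congr_of_eventuallyEq ?_
  rcases lt_or_gt_of_ne hr with h | h
  · filter_upwards [eventually_lt_nhds h] with t ht
    rw [rotPow_eq ht.ne, rotSign, rotSign, if_neg ht.le.not_gt, if_neg h.le.not_gt]
  · filter_upwards [eventually_gt_nhds h] with t ht
    rw [rotPow_eq ht.ne', rotSign, rotSign, if_pos ht, if_pos h]

/-- The automorphy factor of weight `3/2` as a function of a real variable. -/
def realAutFactor (γ : SL(2, ℤ)) (x : ℝ) : ℂ :=
  if γ 1 0 = 0 then 1 else rotPow ((γ 1 0).sign * (γ 1 0 * x + γ 1 1))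

lemma autFactor_eq (γ : SL(2, ℤ)) (x : ℚ) : autFactor (3 / 2) γ x = realAutFactor γ x := by
  rw [autFactor, realAutFactor]
  split_ifs with h
  · rfl
  · rw [rotPow]
    congr 1
    push_cast
    ring

lemma contDiffAt_realAutFactor (γ : SL(2, ℤ)) {x : ℝ} (hx : (γ 1 0 : ℝ) * x + γ 1 1 ≠ 0) :
    ContDiffAt ℝ ∞ (realAutFactor γ) x := by
  by_cases h : γ 1 0 = 0
  · have : realAutFactor γ = fun _ => 1 := funext fun x => by rw [realAutFactor, if_pos h]
    rw [this]
    exact contDiffAt_const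
  · have : realAutFactor γ = fun x => rotPow ((γ 1 0).sign * (γ 1 0 * x + γ 1 1)) :=
      funext fun x => by rw [realAutFactor, if_neg h]
    rw [this]
    have hs : ((γ 1 0).sign : ℝ) ≠ 0 := by exact_mod_cast mt Int.sign_eq_zero_iff_zero.1 h
    have hg : ContDiffAt ℝ ∞ (fun x : ℝ => ((γ 1 0).sign : ℝ) * (γ 1 0 * x + γ 1 1)) x := by
      fun_prop
    exact ContDiffAt.comp (g := rotPow) x (contDiffAt_rotPow (mul_ne_zero hs hx)) hg

lemma rotPow_sign_mul {c : ℤ} (hc : c ≠ 0) {u : ℝ} (hu : u ≠ 0) :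
    rotPow (c.sign * u) = ((|u| ^ (-(3 / 2) : ℝ) : ℝ) : ℂ) * rotSign (c * u) := by
  have hs : (c.sign : ℝ) ≠ 0 := by exact_mod_cast mt Int.sign_eq_zero_iff_zero.1 hc
  rw [rotPow_eq (mul_ne_zero hs hu)]
  rcases lt_or_gt_of_ne hc with h | h
  · have h' : (c : ℝ) < 0 := by exact_mod_cast h
    have : (0 < -u) ↔ 0 < c * u :=
      ⟨fun hu => mul_pos_of_neg_of_neg h' (by linarith), fun hu => by
        have := neg_of_mul_pos_right hu h'.le
        linarith⟩
    simp only [Int.sign_eq_neg_one_of_neg h, rotSign, Int.cast_neg, Int.cast_one, neg_one_mul,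
      abs_neg, this]
  · have h' : (0 : ℝ) < c := by exact_mod_cast h
    simp only [Int.sign_eq_one_of_pos h, rotSign, Int.cast_one, one_mul, mul_pos_iff_of_pos_left h']

/-- With `u = γ₁₀ x + γ₁₁` and `v = γ₀₀ x + γ₀₁` the constraint is the determinant. It implies `a²
(cu) = ac + c² (av)`, which rules out one of the four sign patterns of `(cu, av)`, the one depending
on the sign of `ac`. On the other three the ratio of phases is constant; on the excluded one it
would differ. -/
lemma exists_rotSign_cocycle {a c : ℝ} (ha : a ≠ 0) (hc : c ≠ 0) :
    ∃ κ : ℂ, κ ≠ 0 ∧ ∀ u v : ℝ, u ≠ 0 → v ≠ 0 → a * u - c * v = 1 →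
      rotSign (a * v) = κ * (rotSign (c * u) * rotSign (v / u)) := by
  have h1 := rotPow_one_mul_rotPow_neg_one
  have hn1 : rotPow 1 ≠ 0 := left_ne_zero_of_mul_eq_one h1
  have hn2 : rotPow (-1) ≠ 0 := right_ne_zero_of_mul_eq_one h1
  have hdiv : ∀ u v : ℝ, u ≠ 0 → v ≠ 0 → (0 < v / u ↔ 0 < u * v) := fun u v hu hv => by
    rw [div_pos_iff, mul_pos_iff]
    tauto
  rcases lt_or_gt_of_ne (mul_ne_zero ha hc) with h | h
  · refine ⟨rotPow 1, hn1, fun u v hu hv huv => ?_⟩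
    have e : a ^ 2 * (c * u) = a * c + c ^ 2 * (a * v) := by linear_combination a * c * huv
    have e2 : (a * c) * (u * v) = (c * u) * (a * v) := by ring
    have ha2 : 0 < a ^ 2 := by positivity
    have hc2 : 0 < c ^ 2 := by positivity
    have hcu : c * u ≠ 0 := mul_ne_zero hc hu
    have hav : a * v ≠ 0 := mul_ne_zero ha hv
    simp only [rotSign, hdiv u v hu hv]
    rcases lt_or_gt_of_ne hcu with h2 | h2 <;> rcases lt_or_gt_of_ne hav with h3 | h3
    · have h4 : u * v < 0 := by nlinarith [mul_pos_of_neg_of_neg h2 h3]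
      rw [if_neg h3.not_gt, if_neg h2.not_gt, if_neg h4.not_gt]
      linear_combination -rotPow (-1) * h1
    · have h4 : 0 < u * v := by nlinarith [mul_neg_of_neg_of_pos h2 h3]
      rw [if_pos h3, if_neg h2.not_gt, if_pos h4]
      linear_combination -rotPow 1 * h1
    · nlinarith [mul_pos ha2 h2, mul_neg_of_pos_of_neg hc2 h3]
    · have h4 : u * v < 0 := by nlinarith [mul_pos h2 h3]
      rw [if_pos h3, if_pos h2, if_neg h4.not_gt]
      linear_combination -rotPow 1 * h1
  · refine ⟨rotPow (-1), hn2, fun u v hu hv huv => ?_⟩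
    have e : a ^ 2 * (c * u) = a * c + c ^ 2 * (a * v) := by linear_combination a * c * huv
    have e2 : (a * c) * (u * v) = (c * u) * (a * v) := by ring
    have ha2 : 0 < a ^ 2 := by positivity
    have hc2 : 0 < c ^ 2 := by positivity
    have hcu : c * u ≠ 0 := mul_ne_zero hc hu
    have hav : a * v ≠ 0 := mul_ne_zero ha hv
    simp only [rotSign, hdiv u v hu hv]
    rcases lt_or_gt_of_ne hcu with h2 | h2 <;> rcases lt_or_gt_of_ne hav with h3 | h3
    · have h4 : 0 < u * v := by nlinarith [mul_pos_of_neg_of_neg h2 h3]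
      rw [if_neg h3.not_gt, if_neg h2.not_gt, if_pos h4]
      linear_combination -rotPow (-1) * h1
    · nlinarith [mul_neg_of_pos_of_neg ha2 h2, mul_pos hc2 h3]
    · have h4 : u * v < 0 := by nlinarith [mul_neg_of_pos_of_neg h2 h3]
      rw [if_neg h3.not_gt, if_pos h2, if_neg h4.not_gt]
      linear_combination -rotPow (-1) * h1
    · have h4 : 0 < u * v := by nlinarith [mul_pos h2 h3]
      rw [if_pos h3, if_pos h2, if_pos h4]
      linear_combination -rotPow 1 * h1

lemma SL2Z_det (γ : SL(2, ℤ)) : γ 0 0 * γ 1 1 - γ 0 1 * γ 1 0 = 1 := by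
  have := γ.det_coe
  rwa [Matrix.det_fin_two] at this

/-- The cocycle relation of the automorphy factor under left multiplication by `S`. -/
lemma exists_realAutFactor_S_mul (γ : SL(2, ℤ)) : ∃ κ : ℂ, κ ≠ 0 ∧ ∀ x : ℝ,
    (γ 1 0 : ℝ) * x + γ 1 1 ≠ 0 → (γ 0 0 : ℝ) * x + γ 0 1 ≠ 0 →
    realAutFactor (ModularGroup.S * γ) x = κ * (realAutFactor γ x *
      rotPow (((γ 0 0 : ℝ) * x + γ 0 1) / ((γ 1 0 : ℝ) * x + γ 1 1))) := by
  obtain ⟨-, -, e3, e4⟩ := SL2Z_S_mul γ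
  have hdet := SL2Z_det γ
  simp only [realAutFactor, e3, e4]
  generalize γ 0 0 = a at *
  generalize γ 0 1 = b at *
  generalize γ 1 0 = c at *
  generalize γ 1 1 = d at *
  have h1 := rotPow_one_mul_rotPow_neg_one
  have hdet' : (a : ℝ) * d - b * c = 1 := by exact_mod_cast hdet
  by_cases hc : c = 0
  · subst hc
    -- For `c = 0` the sign normalization in the factor of `S γ` makes it agree exactly with
    -- `rotPow` at the translated point.
    have ha : a = 1 ∧ d = 1 ∨ a = -1 ∧ d = -1 := by
      have : a * d = 1 := by linarith
      exact Int.mul_eq_one_iff_eq_one_or_neg_one.1 this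
    refine ⟨1, one_ne_zero, fun x _ _ => ?_⟩
    rcases ha with ⟨rfl, rfl⟩ | ⟨rfl, rfl⟩
    · simp
    · simp [div_neg]
  · by_cases ha : a = 0
    · subst ha
      have hb : b = 1 ∧ c = -1 ∨ b = -1 ∧ c = 1 := by
        have : b * -c = 1 := by linarith
        rcases Int.mul_eq_one_iff_eq_one_or_neg_one.1 this with h | h
        · left; omega
        · right; omega
      refine ⟨1, one_ne_zero, fun x hu _ => ?_⟩
      -- For `a = 0` the product `S γ` is upper triangular with factor `1`, so the relation
      -- expresses that applying the inversion twice is trivial.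
      have key : ∀ u : ℝ, u ≠ 0 → rotPow u * rotPow (-1 / u) = 1 := fun u hu => by
        have hn : -1 / u ≠ 0 := div_ne_zero (by norm_num) hu
        have hp : 0 < |u| := abs_pos.2 hu
        have e1 : |u| ^ (-(3 / 2) : ℝ) * |-1 / u| ^ (-(3 / 2) : ℝ) = 1 := by
          rw [← Real.mul_rpow (abs_nonneg _) (abs_nonneg _), ← abs_mul, mul_div_cancel₀ _ hu]
          simp
        have e2 : rotSign u * rotSign (-1 / u) = 1 := by
          rcases lt_or_gt_of_ne hu with h | h
          · rw [rotSign, rotSign, if_neg h.not_gt, if_pos (div_pos_of_neg_of_neg (by norm_num) h),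
              mul_comm, h1]
          · rw [rotSign, rotSign, if_pos h,
              if_neg (div_neg_of_neg_of_pos (by norm_num) h).not_gt, h1]
        have e1' := congrArg ((↑) : ℝ → ℂ) e1
        rw [ofReal_mul, ofReal_one] at e1'
        rw [rotPow_eq hu, rotPow_eq hn]
        linear_combination (rotSign u * rotSign (-1 / u)) * e1' + e2
      rcases hb with ⟨rfl, rfl⟩ | ⟨rfl, rfl⟩
      · have := key (-(-1 * x + d)) (neg_ne_zero.2 (by simpa using hu))
        rw [neg_div_neg_eq] at this
        simpa using this.symm
      · have := key (1 * x + d) (by simpa using hu)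
        simpa using this.symm
    · have haR : (a : ℝ) ≠ 0 := by exact_mod_cast ha
      have hcR : (c : ℝ) ≠ 0 := by exact_mod_cast hc
      obtain ⟨κ, hκ, h⟩ := exists_rotSign_cocycle haR hcR
      refine ⟨κ, hκ, fun x hu hv => ?_⟩
      rw [if_neg ha, if_neg hc, rotPow_sign_mul ha hv, rotPow_sign_mul hc hu,
        rotPow_eq (div_ne_zero hv hu), h _ _ hu hv (by linear_combination hdet'), abs_div,
        Real.div_rpow (abs_nonneg _) (abs_nonneg _)]
      have hp : ((|(c : ℝ) * x + d| ^ (-(3 / 2) : ℝ) : ℝ) : ℂ) ≠ 0 := by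
        have : 0 < |(c : ℝ) * x + d| := abs_pos.2 hu
        exact_mod_cast (Real.rpow_pos_of_pos this _).ne'
      rw [ofReal_div]
      generalize ((|(c : ℝ) * x + d| ^ (-(3 / 2) : ℝ) : ℝ) : ℂ) = q at hp
      generalize rotSign _ = r₁
      generalize rotSign _ = r₂
      field_simp

/-! ### Quantum modularity -/

/-- The action of `γ` on rational points. -/
def ratMoebius (γ : SL(2, ℤ)) (x : ℚ) : ℚ :=
  ((γ 0 0 : ℚ) * x + (γ 0 1 : ℚ)) / ((γ 1 0 : ℚ) * x + (γ 1 1 : ℚ))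

lemma ratMoebius_T_mul (γ : SL(2, ℤ)) {x : ℚ} (hx : (γ 1 0 : ℚ) * x + γ 1 1 ≠ 0) :
    ratMoebius (ModularGroup.T * γ) x = ratMoebius γ x + 1 := by
  obtain ⟨e1, e2, e3, e4⟩ := SL2Z_T_mul γ
  rw [ratMoebius, ratMoebius, e1, e2, e3, e4, eq_comm, ← div_self hx, ← add_div]
  push_cast
  ring

lemma ratMoebius_S_mul (γ : SL(2, ℤ)) (x : ℚ) :
    ratMoebius (ModularGroup.S * γ) x = -1 / ratMoebius γ x := by
  obtain ⟨e1, e2, e3, e4⟩ := SL2Z_S_mul γ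
  rw [ratMoebius, ratMoebius, e1, e2, e3, e4, div_div_eq_mul_div]
  push_cast
  ring

lemma isCoprime_moebius (γ : SL(2, ℤ)) {m n : ℤ} (h : IsCoprime m n) :
    IsCoprime (γ 0 0 * m + γ 0 1 * n) (γ 1 0 * m + γ 1 1 * n) := by
  obtain ⟨s, t, hst⟩ := h
  refine ⟨s * γ 1 1 - t * γ 1 0, t * γ 0 0 - s * γ 0 1, ?_⟩
  linear_combination hst + (s * m + t * n) * SL2Z_det γ

lemma ratMoebius_mem_strangeDomain_iff {γ : SL(2, ℤ)} {i k : Fin 3}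
    (h : ∀ a b : ℤ, OddForm i (γ 0 0 * a + γ 0 1 * b) (γ 1 0 * a + γ 1 1 * b) ↔ OddForm k a b)
    {x : ℚ} (hx : (γ 1 0 : ℚ) * x + γ 1 1 ≠ 0) :
    ratMoebius γ x ∈ strangeDomain i ↔ x ∈ strangeDomain k := by
  have hd : (x.den : ℚ) ≠ 0 := by exact_mod_cast x.den_ne_zero
  have hnum := Rat.mul_den_eq_num x
  have e : ratMoebius γ x = ((γ 0 0 * x.num + γ 0 1 * x.den : ℤ) : ℚ) /
      ((γ 1 0 * x.num + γ 1 1 * x.den : ℤ) : ℚ) := by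
    rw [ratMoebius, ← mul_div_mul_right _ _ hd]
    push_cast
    rw [← hnum]
    ring
  have hn : γ 1 0 * x.num + γ 1 1 * x.den ≠ 0 := fun h0 => by
    have h1 : ((γ 1 0 * x.num + γ 1 1 * x.den : ℤ) : ℚ) = 0 := by rw [h0]; simp
    push_cast at h1
    rw [← hnum] at h1
    refine mul_ne_zero hx hd ?_
    linear_combination h1
  rw [e, mem_strangeDomain_div
    (isCoprime_moebius γ (Int.isCoprime_iff_nat_coprime.2 x.reduced)) hn, h, mem_strangeDomain_iff]

lemma contDiffAt_g (i : Fin 3) {x : ℝ} (hx : x ≠ 0) : ContDiffAt ℝ ∞ (fun x : ℝ => g x i) x := by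
  by_cases hi : i = 1
  · subst hi
    obtain ⟨r, hr, h⟩ := exists_contDiff_g_one
    have hpole : ContDiffAt ℝ ∞ (fun x : ℝ => r x - I / (Real.pi * x)) x := by
      simp only [div_eq_mul_inv]
      refine hr.contDiffAt.sub (contDiffAt_const.mul (ContDiffAt.inv ?_ ?_))
      · exact contDiffAt_const.mul ofRealCLM.contDiff.contDiffAt
      · exact mul_ne_zero (by exact_mod_cast Real.pi_ne_zero) (by exact_mod_cast hx)
    refine hpole.congr_of_eventuallyEq ?_
    filter_upwards [eventually_ne_nhds hx] with y hy
    exact h y hy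
  · exact (contDiff_g hi).contDiffAt

/-- The transformation law of `φ` under `γ`, away from finitely many points, with a monomial
multiplier matrix. -/
def HasCocycle (γ : SL(2, ℤ)) : Prop :=
  ∃ (ρ : Matrix (Fin 3) (Fin 3) ℂ) (σ : Equiv.Perm (Fin 3)) (h : Fin 3 → ℝ → ℂ) (s : Finset ℝ),
    IsUnit ρ.det ∧ (∀ i j, ρ i j ≠ 0 ↔ j = σ i) ∧
    (∀ (i : Fin 3) (a b : ℤ), OddForm i (γ 0 0 * a + γ 0 1 * b) (γ 1 0 * a + γ 1 1 * b) ↔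
      OddForm (σ i) a b) ∧
    (∀ i, ∀ x ∉ s, ContDiffAt ℝ ∞ (h i) x) ∧
    ∀ x : ℚ, (x : ℝ) ∉ s → (γ 1 0 : ℚ) * x + γ 1 1 ≠ 0 → ∀ i : Fin 3,
      ratMoebius γ x ∈ strangeDomain i →
      realAutFactor γ x * phi (ratMoebius γ x) i - ρ i (σ i) * phi x (σ i) = h i x

lemma hasCocycle_one : HasCocycle 1 := by
  refine ⟨1, 1, 0, ∅, by simp, fun i j => ?_, by simp, fun i x _ => contDiffAt_const, ?_⟩
  · rw [Matrix.one_apply, Equiv.Perm.one_apply]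
    simp [eq_comm]
  · intro x _ _ i _
    simp [ratMoebius, realAutFactor, Matrix.one_apply]

lemma HasCocycle.T_mul {γ : SL(2, ℤ)} (hγ : HasCocycle γ) :
    HasCocycle (ModularGroup.T * γ) := by
  obtain ⟨ρ, σ, h, s, hdet, hρ, hσ, hs, heq⟩ := hγ
  obtain ⟨e1, e2, e3, e4⟩ := SL2Z_T_mul γ
  have hmul := fun i => mul_apply_of_monomial (ρ := ρ) (MT_apply_ne_zero_iff i)
  refine ⟨MT * ρ, (Equiv.swap 1 2).trans σ,
    fun i x => MT i (Equiv.swap 1 2 i) * h (Equiv.swap 1 2 i) x, s, ?_, fun i j => ?_,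
    fun i a b => ?_, fun i x hx => contDiffAt_const.mul (hs _ x hx), fun x hx hd i hmem => ?_⟩
  · rw [Matrix.det_mul]
    exact isUnit_det_MT.mul hdet
  · rw [hmul, Equiv.trans_apply, mul_ne_zero_iff, hρ]
    exact and_iff_right ((MT_apply_ne_zero_iff i _).2 rfl)
  · rw [e1, e2, e3, e4, Equiv.trans_apply, ← hσ, ← oddForm_T]
    ring_nf
  · rw [e3, e4] at hd
    rw [ratMoebius_T_mul γ hd] at hmem ⊢
    have h1 := heq x hx hd _ ((add_one_mem_strangeDomain_iff _ i).1 hmem)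
    have h2 : realAutFactor (ModularGroup.T * γ) x = realAutFactor γ x := by
      rw [realAutFactor, realAutFactor, e3, e4]
    rw [h2, phi_add_one_eq, hmul, Equiv.trans_apply]
    beta_reduce
    rw [← h1]
    ring

lemma exists_finset_affine_eq_zero {a b : ℝ} (h : a ≠ 0 ∨ b ≠ 0) :
    ∃ s : Finset ℝ, ∀ x ∉ s, a * x + b ≠ 0 := by
  refine ⟨{-b / a}, fun x hx h0 => ?_⟩
  rw [Finset.mem_singleton] at hx
  by_cases ha : a = 0
  · rw [ha, zero_mul, zero_add] at h0
    exact h.elim (fun h => h ha) fun h => h h0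
  · refine hx ?_
    rw [eq_div_iff ha]
    linarith

lemma HasCocycle.S_mul {γ : SL(2, ℤ)} (hγ : HasCocycle γ) :
    HasCocycle (ModularGroup.S * γ) := by
  obtain ⟨ρ, σ, h, s, hdet, hρ, hσ, hs, heq⟩ := hγ
  obtain ⟨e1, e2, e3, e4⟩ := SL2Z_S_mul γ
  obtain ⟨κ, hκ, hcoc⟩ := exists_realAutFactor_S_mul γ
  have hγdet : (γ 0 0 : ℝ) * γ 1 1 - γ 0 1 * γ 1 0 = 1 := by exact_mod_cast SL2Z_det γ
  obtain ⟨s₁, hs₁⟩ := exists_finset_affine_eq_zero (a := γ 0 0) (b := γ 0 1) (by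
    by_contra! hc
    rw [hc.1, hc.2] at hγdet
    norm_num at hγdet)
  obtain ⟨s₂, hs₂⟩ := exists_finset_affine_eq_zero (a := γ 1 0) (b := γ 1 1) (by
    by_contra! hc
    rw [hc.1, hc.2] at hγdet
    norm_num at hγdet)
  have hmul := fun i => mul_apply_of_monomial (ρ := ρ) (MS_apply_ne_zero_iff i)
  -- The `S`-law at `γ x`, multiplied by `κ` times the automorphy factor of `γ`, leaves `φ (γ x)`
  -- with coefficient `-κ MS`; substituting the law of `γ` gives this matrix and error. The
  -- exceptional set gains the zeros of both linear forms, covering `γ x = 0`, where `g` may have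
  -- its pole, and `γ x = ∞`.
  refine ⟨-κ • (MS * ρ), (Equiv.swap 0 1).trans σ,
    fun i x => κ * MS i (Equiv.swap 0 1 i) * (realAutFactor γ x *
      g ((γ 0 0 * x + γ 0 1) / (γ 1 0 * x + γ 1 1)) (Equiv.swap 0 1 i) -
      h (Equiv.swap 0 1 i) x), s ∪ (s₁ ∪ s₂), ?_, fun i j => ?_,
    fun i a b => ?_, fun i x hx => ?_, fun x hx hd i hmem => ?_⟩
  · rw [Matrix.det_smul, Matrix.det_mul]
    exact (((neg_ne_zero.2 hκ).isUnit).pow _).mul (isUnit_det_MS.mul hdet)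
  · rw [Matrix.smul_apply, hmul, Equiv.trans_apply, smul_eq_mul, mul_ne_zero_iff, mul_ne_zero_iff,
      hρ]
    exact (and_iff_right (neg_ne_zero.2 hκ)).trans
      (and_iff_right ((MS_apply_ne_zero_iff i _).2 rfl))
  · rw [e1, e2, e3, e4, Equiv.trans_apply, ← hσ, ← oddForm_S]
    ring_nf
  · simp only [Finset.mem_union, not_or] at hx
    have hu := hs₂ x hx.2.2
    have hv := hs₁ x hx.2.1
    refine contDiffAt_const.mul (((contDiffAt_realAutFactor γ hu).mul ?_).sub (hs _ x hx.1))
    have hm : ContDiffAt ℝ ∞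
        (fun x : ℝ => ((γ 0 0 : ℝ) * x + γ 0 1) / ((γ 1 0 : ℝ) * x + γ 1 1)) x :=
      ContDiffAt.div (by fun_prop) (by fun_prop) hu
    exact ContDiffAt.comp (g := fun y : ℝ => g y (Equiv.swap 0 1 i)) x
      (contDiffAt_g _ (div_ne_zero hv hu)) hm
  · simp only [Finset.mem_union, not_or] at hx
    have hu := hs₂ x hx.2.2
    have hv := hs₁ x hx.2.1
    have huQ : (γ 1 0 : ℚ) * x + γ 1 1 ≠ 0 := by exact_mod_cast hu
    have hvQ : (γ 0 0 : ℚ) * x + γ 0 1 ≠ 0 := by exact_mod_cast hv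
    have hy : ratMoebius γ x ≠ 0 := div_ne_zero hvQ huQ
    rw [ratMoebius_S_mul] at hmem ⊢
    have h1 := heq x hx.1 huQ _ ((neg_one_div_mem_strangeDomain_iff hy i).1 hmem)
    have h2 := phi_neg_one_div_eq hy hmem
    have ey : ((ratMoebius γ x : ℚ) : ℝ) = (γ 0 0 * x + γ 0 1) / (γ 1 0 * x + γ 1 1) := by
      rw [ratMoebius]
      push_cast
      rfl
    have e5 : ((ratMoebius γ x : ℚ) : ℂ) / -I =
        I * (((γ 0 0 * x + γ 0 1) / (γ 1 0 * x + γ 1 1) : ℝ) : ℂ) := by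
      rw [← ey, ofReal_ratCast, div_eq_iff (neg_ne_zero.2 I_ne_zero)]
      linear_combination ((ratMoebius γ x : ℚ) : ℂ) * I_sq
    rw [e5, ey] at h2
    rw [hcoc x hu hv, rotPow, Matrix.smul_apply, hmul, Equiv.trans_apply, smul_eq_mul]
    beta_reduce
    rw [← h1]
    linear_combination κ * realAutFactor γ x * h2

theorem hasCocycle (γ : SL(2, ℤ)) : HasCocycle γ :=
  SL2Z_induction hasCocycle_one (fun _ h => h.S_mul) (fun _ h => h.T_mul) γ

theorem isVectorQuantumModularForm_phi :
    IsVectorQuantumModularForm (3 / 2) strangeDomain phi := by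
  intro γ
  obtain ⟨ρ, σ, h, s, hdet, hρ, hσ, hs, heq⟩ := hasCocycle γ
  classical
  let E : Fin 3 → ℚ → ℂ := fun i x =>
    autFactor (3 / 2) γ x * phi (ratMoebius γ x) i - ρ.mulVec (phi x) i
  -- The identity must hold at every rational point, including the exceptional ones. Since
  -- smoothness is required only off `s`, the error function is set there to the actual discrepancy;
  -- the chosen rational is unique because the cast to `ℝ` is injective.
  let h' : Fin 3 → ℝ → ℂ := fun i r =>
    if hr : r ∈ s ∧ ∃ q : ℚ, (q : ℝ) = r then E i hr.2.choose else h i r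
  refine ⟨ρ, h', s, hdet, fun i x hx => ?_, fun x hx i => ⟨?_, fun hy => ?_⟩⟩
  · have hx' : x ∉ s := by simpa using hx
    refine ContDiffWithinAt.congr (hs i x hx').contDiffWithinAt (fun y hy => ?_) ?_
    · exact dif_neg fun hr => hy (by simpa using hr.1)
    · exact dif_neg fun hr => hx' hr.1
  · change ratMoebius γ x ∈ strangeDomain i ↔ _
    rw [ratMoebius_mem_strangeDomain_iff (hσ i) hx]
    simp only [hρ, forall_eq]
  · change E i x = h' i x
    by_cases hxs : (x : ℝ) ∈ s
    · have hr : (x : ℝ) ∈ s ∧ ∃ q : ℚ, (q : ℝ) = x := ⟨hxs, x, rfl⟩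
      have e : hr.2.choose = x := by exact_mod_cast hr.2.choose_spec
      simp only [h', dif_pos hr, e]
    · have := heq x hxs hx i hy
      simp only [h', dif_neg fun hr : (x : ℝ) ∈ s ∧ ∃ q : ℚ, (q : ℝ) = x => hxs hr.1, E]
      rw [mulVec_of_monomial (hρ i), autFactor_eq, this]

lemma even_num_or_even_den_iff (x : ℚ) :
    Even x.num ∨ Even x.den ↔ Odd (x.num + x.den) := by
  have hodd : ¬(Even x.num ∧ Even x.den) := fun ⟨h1, h2⟩ => by
    have h3 : 2 ∣ x.num.natAbs := Int.natCast_dvd.1 (by simpa using h1.two_dvd)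
    have h4 := Nat.dvd_gcd h3 h2.two_dvd
    rw [x.reduced] at h4
    omega
  rw [Int.odd_add, ← Int.not_even_iff_odd, Int.even_coe_nat]
  tauto

end StrangeTheta

end

open StrangeTheta in
theorem theorem1p1 :
    -- where the strange series converge
    (∀ x : ℚ, (x ∈ strangeDomain 0 ↔ Odd x.den) ∧ (x ∈ strangeDomain 1 ↔ Odd x.num) ∧
      (x ∈ strangeDomain 2 ↔ Even x.num ∨ Even x.den)) ∧
    -- (1) the reflected series
    (∀ i : Fin 3,
      (∀ z : ℂ, 0 < z.im → ReflConverges i z) ∧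
      (∀ x : ℚ, -x ∈ strangeDomain i → ReflConverges i (x : ℂ) ∧ phi (-x) i = G (x : ℂ) i)) ∧
    -- (2) quantum modularity
    IsVectorQuantumModularForm (3 / 2) strangeDomain phi ∧
    (∀ (x : ℚ) (i : Fin 3),
      (x + 1 ∈ strangeDomain i ↔ ∀ j, MT i j ≠ 0 → x ∈ strangeDomain j) ∧
      (x + 1 ∈ strangeDomain i → phi (x + 1) i - (MT.mulVec (phi x)) i = 0)) ∧
    (∀ (x : ℚ), x ≠ 0 → ∀ i : Fin 3,
      (-1 / x ∈ strangeDomain i ↔ ∀ j, MS i j ≠ 0 → x ∈ strangeDomain j) ∧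
      (-1 / x ∈ strangeDomain i →
        ((x : ℂ) / (-Complex.I)) ^ (-(3 / 2) : ℂ) * phi (-1 / x) i + (MS.mulVec (phi x)) i =
          (MS.mulVec (g (x : ℝ))) i)) ∧
    -- the period integrals converge, and are smooth up to an explicit pole of the second one at `0`
    (∀ (i : Fin 3) (x : ℝ), (i = 1 → x ≠ 0) →
      MeasureTheory.IntegrableOn (periodIntegrand i x) (Set.Ioi 0)) ∧
    ContDiff ℝ ∞ (fun x : ℝ => g x 0) ∧
    (∃ r : ℝ → ℂ, ContDiff ℝ ∞ r ∧
      ∀ x : ℝ, x ≠ 0 → g x 1 = r x - Complex.I / (Real.pi * x)) ∧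
    ContDiff ℝ ∞ (fun x : ℝ => g x 2) := by
  refine ⟨fun x => ⟨?_, ?_, ?_⟩, fun i => ⟨fun z hz => reflConverges_of_im_pos i hz,
    fun x hx => phi_neg_eq_G hx⟩, isVectorQuantumModularForm_phi, fun x i => ⟨?_, fun _ => ?_⟩,
    fun x hx i => ⟨?_, fun h => ?_⟩, integrableOn_periodIntegrand, contDiff_g (by decide),
    exists_contDiff_g_one, contDiff_g (by decide)⟩
  · rw [mem_strangeDomain_iff]
    exact Int.odd_coe_nat _
  · exact mem_strangeDomain_iff x 1
  · rw [mem_strangeDomain_iff, even_num_or_even_den_iff]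
    exact Iff.rfl
  · simp only [MT_apply_ne_zero_iff, forall_eq]
    exact add_one_mem_strangeDomain_iff x i
  · rw [mulVec_of_monomial (MT_apply_ne_zero_iff i), phi_add_one_eq, sub_self]
  · simp only [MS_apply_ne_zero_iff, forall_eq]
    exact neg_one_div_mem_strangeDomain_iff hx i
  · rw [mulVec_of_monomial (MS_apply_ne_zero_iff i), mulVec_of_monomial (MS_apply_ne_zero_iff i)]
    exact phi_neg_one_div_eq hx h
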